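/- **Setting.** Let $d\ge 1$, $L,\rho>0$, $f_{\max},\sigma,\tilde\ell\ge 0$, $\mu\in(0,1]$, $\varepsilon>0$. Let $f:\mathbb R^d\to\mathbb R$ be twice differentiable with, for all $x,y$, $$|f(x)-f(y)|\le f_{\max},\qquad \|\nabla f(x)-\nabla f(y)\|\le L\|x-y\|,\qquad \|\nabla^2 f(x)-\nabla^2 f(y)\|\le\rho\|x-y\|.$$ Let $\nabla F(x,\theta)$, $\theta\sim\mathcal D$, be a stochastic gradient oracle with $\mathbb E_\theta\nabla F(x,\theta)=\nabla f(x)$ and $\mathbb E_\theta\|\nabla F(x,\theta)-\nabla f(x)\|^2\le\sigma^2$ for all $x$. Let $\mathcal C(x,\tilde\theta)$, $\tilde\theta\sim\tilde{\mathcal D}$, be a linear $\mu$-compressor: $x\mapsto\mathcal C(x,\tilde\theta)$ is linear for every $\tilde\theta$, and $\mathbb E_{\tilde\theta}\|x-\mathcal C(x,\tilde\theta)\|^2\le(1-\mu)\|x\|^2$ for all $x$. Put $\alpha=1$ if it is assumed that $\|\nabla F(x,\theta)-\nabla F(y,\theta)\|\le\tilde\ell\|x-y\|$ for all $x,y,\theta$,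 and $\alpha=d$ if no such assumption is made. **Algorithm.** Perturbed compressed SGD with error feedback (without error reset), with step size $\eta$ and noise level $r$, starts at an arbitrary $x_0\in\mathbb R^d$ with $e_0=0$. At each $t=0,1,\dots$ it draws independent $\xi_t$, $\theta_t\sim\mathcal D$, $\tilde\theta_t\sim\tilde{\mathcal D}$ (independent also of the earlier draws), where $\xi_t$ is an isotropic centred Gaussian vector of total variance $r^2$ (variance $r^2/d$ per coordinate), and sets $$g_t=\mathcal C(e_t+\nabla F(x_t,\theta_t)+\xi_t,\tilde\theta_t),\qquad x_{t+1}=x_t-\eta g_t,\qquad e_{t+1}=e_t+\nabla F(x_t,\theta_t)+\xi_t-g_t .$$ A point $x$ is an $\varepsilon$-SOSP of $f$ if $\|\nabla f(x)\|\le\varepsilon$ and $\lambda_{\min}(\nabla^2 f(x))\ge-\sqrt{\rho\varepsilon}$. **Theorem.** For every $\delta\in(0,1)$ there are $C>0$ and $k\in\mathbb N$, depending only on $\delta$, such that the following holds for all parameters as above. Let $$Q=C\,(1+L+\rho+\rho^{-1}+f_{\max}+\sigma+\tilde\ell)^k\,\log^k\!\left(2+d+\tfrac1\varepsilon+\tfrac1\mu\right),\qquad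 s=\min\left(\frac{\varepsilon^2}{\alpha},\ \frac{\mu\varepsilon}{\sqrt{1-\mu}},\ \frac{\mu^2\sqrt\varepsilon}{1-\mu}\right),$$ where $\tilde\ell$ is omitted from $Q$ if the stochastic gradient is not assumed to be Lipschitz, and where the last two terms of $s$ are $+\infty$ if $\mu=1$. There are a step size $\eta\in[s/Q,\,s]$, a noise level $r\in\left[\frac{\varepsilon}{Q\sqrt\eta},\ \frac{Q\varepsilon}{\sqrt\eta}\right]$ and a number of iterations $T_0\in\mathbb N$ with $$T_0\le \frac{Q}{\varepsilon^2\eta}\qquad\text{and}\qquad T_0\le Q\left(\frac{\alpha}{\varepsilon^4}+\frac{\sqrt{1-\mu}}{\mu\varepsilon^3}+\frac{1-\mu}{\mu^2\varepsilon^2\sqrt\varepsilon}\right),$$ depending only on $\delta$, on the parameters $d,L,\rho,f_{\max},\sigma,\tilde\ell,\mu,\varepsilon$ and on whether the stochastic gradient is assumed to be Lipschitz, such that for all $f$, $\nabla F$, $\mathcal D$, $\mathcal C$, $\tilde{\mathcal D}$ and $x_0$ as above and for every $T\ge T_0$, at least half of the visited points $x_0,\dots,x_{T-1}$ are $\varepsilon$-SOSP,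 both in expectation and with probability at least $1-\delta$: $$\mathbb E\,\#\{t<T: x_t\text{ is an }\varepsilon\text{-SOSP}\}\ge \tfrac T2,\qquad \mathbb P\left(\#\{t<T: x_t\text{ is an }\varepsilon\text{-SOSP}\}\ge\tfrac T2\right)\ge 1-\delta .$$ -/

import Mathlib

open MeasureTheory ProbabilityTheory
open scoped Gradient

/-- The Hessian of `f` at `x`, as the (Fréchet) derivative of the gradient; its norm is the
Euclidean operator norm. -/
noncomputable def hessian {d : ℕ} (f : EuclideanSpace ℝ (Fin d) → ℝ)
    (x : EuclideanSpace ℝ (Fin d)) :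
    EuclideanSpace ℝ (Fin d) →L[ℝ] EuclideanSpace ℝ (Fin d) :=
  fderiv ℝ (∇ f) x

/-- `f` is twice differentiable, `fmax`-bounded, `L`-smooth and has a `ρ`-Lipschitz Hessian. -/
structure IsRegularObjective {d : ℕ} (f : EuclideanSpace ℝ (Fin d) → ℝ) (fmax L ρ : ℝ) :
    Prop where
  differentiable : Differentiable ℝ f
  differentiable_gradient : Differentiable ℝ (∇ f)
  bounded : ∀ x y, |f x - f y| ≤ fmax
  smooth : ∀ x y, ‖∇ f x - ∇ f y‖ ≤ L * ‖x - y‖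
  hessian_lipschitz : ∀ x y, ‖hessian f x - hessian f y‖ ≤ ρ * ‖x - y‖

/-- `G` (with `G x θ` in the role of `∇F(x, θ)`) is an unbiased stochastic gradient oracle for `f`
with variance at most `σ ^ 2`, where `θ` has law `D`. -/
structure IsStochasticGradient {d : ℕ} {Θ : Type*} [MeasurableSpace Θ]
    (f : EuclideanSpace ℝ (Fin d) → ℝ)
    (G : EuclideanSpace ℝ (Fin d) → Θ → EuclideanSpace ℝ (Fin d))
    (D : Measure Θ) (σ : ℝ) : Prop where
  measurable : Measurable (Function.uncurry G)
  integrable : ∀ x, Integrable (G x) D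
  unbiased : ∀ x, ∫ θ, G x θ ∂D = ∇ f x
  integrable_sq : ∀ x, Integrable (fun θ => ‖G x θ - ∇ f x‖ ^ 2) D
  variance_le : ∀ x, ∫ θ, ‖G x θ - ∇ f x‖ ^ 2 ∂D ≤ σ ^ 2

/-- The stochastic gradient is `ℓ`-Lipschitz, for every value of its randomness. -/
def IsLipschitzStochasticGradient {d : ℕ} {Θ : Type*}
    (G : EuclideanSpace ℝ (Fin d) → Θ → EuclideanSpace ℝ (Fin d)) (ℓ : ℝ) : Prop :=
  ∀ x y θ, ‖G x θ - G y θ‖ ≤ ℓ * ‖x - y‖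

/-- `Cmp` is a `μ`-compressor, whose randomness has law `D`. The inequality is not strict, because a
strict one fails at `x = 0`. -/
structure IsCompressor {d : ℕ} {Θ : Type*} [MeasurableSpace Θ]
    (Cmp : EuclideanSpace ℝ (Fin d) → Θ → EuclideanSpace ℝ (Fin d))
    (D : Measure Θ) (μ : ℝ) : Prop where
  measurable : Measurable (Function.uncurry Cmp)
  integrable_sq : ∀ x, Integrable (fun θ => ‖x - Cmp x θ‖ ^ 2) D
  error_le : ∀ x, ∫ θ, ‖x - Cmp x θ‖ ^ 2 ∂D ≤ (1 - μ) * ‖x‖ ^ 2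

/-- `Cmp` is linear once its randomness is fixed. -/
def IsLinearCompressor {d : ℕ} {Θ : Type*}
    (Cmp : EuclideanSpace ℝ (Fin d) → Θ → EuclideanSpace ℝ (Fin d)) : Prop :=
  ∀ θ, IsLinearMap ℝ (fun x => Cmp x θ)

/-- `x` is an `ε`-second-order stationary point of `f`: the gradient has norm at most `ε`, and the
smallest eigenvalue (that is, every eigenvalue) of the Hessian is at least `-√(ρ ε)`. -/
def IsSOSP {d : ℕ} (f : EuclideanSpace ℝ (Fin d) → ℝ) (ρ ε : ℝ)
    (x : EuclideanSpace ℝ (Fin d)) : Prop :=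
  ‖∇ f x‖ ≤ ε ∧
    ∀ lam : ℝ, Module.End.HasEigenvalue
      (hessian f x : EuclideanSpace ℝ (Fin d) →ₗ[ℝ] EuclideanSpace ℝ (Fin d)) lam →
      -√(ρ * ε) ≤ lam

/-- The isotropic Gaussian law on `ℝ^d` of mean `0` and total variance `r ^ 2`
(`r ^ 2 / d` in each coordinate). -/
noncomputable def noiseLaw (d : ℕ) (r : ℝ) : Measure (EuclideanSpace ℝ (Fin d)) :=
  (stdGaussian (EuclideanSpace ℝ (Fin d))).map (fun z => (r / √(d : ℝ)) • z)

/-- Perturbed compressed SGD with error feedback and without error reset: the pair `(x_t, e_t)`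
after `t` iterations with step size `η`, started at `(x₀, 0)`, when the artificial noise, the
randomness of the stochastic gradient and that of the compressor are `ξ`, `θ` and `θ'`. -/
def compressedSGD {d : ℕ} {Θ Θ' : Type*} (η : ℝ)
    (G : EuclideanSpace ℝ (Fin d) → Θ → EuclideanSpace ℝ (Fin d))
    (Cmp : EuclideanSpace ℝ (Fin d) → Θ' → EuclideanSpace ℝ (Fin d))
    (x₀ : EuclideanSpace ℝ (Fin d)) (ξ : ℕ → EuclideanSpace ℝ (Fin d)) (θ : ℕ → Θ)
    (θ' : ℕ → Θ') : ℕ → EuclideanSpace ℝ (Fin d) × EuclideanSpace ℝ (Fin d)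
  | 0 => (x₀, 0)
  | t + 1 =>
    let x := (compressedSGD η G Cmp x₀ ξ θ θ' t).1
    let e := (compressedSGD η G Cmp x₀ ξ θ θ' t).2
    let g := Cmp (e + G x (θ t) + ξ t) (θ' t)
    (x - η • g, e + G x (θ t) + ξ t - g)

/-- The samples of the algorithm: the triples `(ξ_t, θ_t, θ'_t)`, `t = 0, 1, …`, are independent
random variables, and each has the product law `noiseLaw d r ⊗ D ⊗ D'`. -/
structure AreSamples {d : ℕ} {Ω Θ Θ' : Type*} [MeasurableSpace Ω] [MeasurableSpace Θ]
    [MeasurableSpace Θ'] (P : Measure Ω) (r : ℝ) (D : Measure Θ) (D' : Measure Θ')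
    (ξ : ℕ → Ω → EuclideanSpace ℝ (Fin d)) (θ : ℕ → Ω → Θ) (θ' : ℕ → Ω → Θ') : Prop where
  measurable_noise : ∀ t, Measurable (ξ t)
  measurable_gradient : ∀ t, Measurable (θ t)
  measurable_compressor : ∀ t, Measurable (θ' t)
  law : ∀ t, P.map (fun ω => (ξ t ω, θ t ω, θ' t ω)) = (noiseLaw d r).prod (D.prod D')
  indep : iIndepFun (fun t ω => (ξ t ω, θ t ω, θ' t ω)) P

/-- The number of indices `t < T` for which `x t` is an `ε`-SOSP of `f`. -/
noncomputable def sospCount {d : ℕ} (f : EuclideanSpace ℝ (Fin d) → ℝ) (ρ ε : ℝ) (T : ℕ)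
    (x : ℕ → EuclideanSpace ℝ (Fin d)) : ℕ :=
  Set.ncard {t : ℕ | t < T ∧ IsSOSP f ρ ε (x t)}

/-- `α = 1` in the case of a Lipschitz stochastic gradient and `α = d` otherwise. -/
def alphaParam (lip : Bool) (d : ℕ) : ℝ := if lip then 1 else d

/-- `min (ε² / α, μ ε / √(1 - μ), μ² √ε / (1 - μ))`, written as the inverse of the largest
reciprocal, so that the last two terms are `+∞` when `μ = 1`. -/
noncomputable def stepScale (α μ ε : ℝ) : ℝ :=
  (max (α / ε ^ 2) (max (√(1 - μ) / (μ * ε)) ((1 - μ) / (μ ^ 2 * √ε))))⁻¹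

/-- `α / ε⁴ + √(1 - μ) / (μ ε³) + (1 - μ) / (μ² ε² √ε)`. -/
noncomputable def iterationScale (α μ ε : ℝ) : ℝ :=
  α / ε ^ 4 + √(1 - μ) / (μ * ε ^ 3) + (1 - μ) / (μ ^ 2 * ε ^ 2 * √ε)

/-- The factor hidden by `Õ`: polynomial in `L`, `ρ`, `1/ρ`, `fmax`, `σ` and (if the stochastic
gradient is assumed to be Lipschitz) `ℓ`, and polylogarithmic in `d`, `1/ε`, `1/μ`. -/
noncomputable def hiddenFactor (C : ℝ) (k : ℕ) (lip : Bool) (d : ℕ) (L ρ fmax σ ℓ μ ε : ℝ) : ℝ :=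
  C * (1 + L + ρ + 1 / ρ + fmax + σ + (if lip then ℓ else 0)) ^ k *
    Real.log (2 + d + 1 / ε + 1 / μ) ^ k

/-- The point `x_t` visited by the algorithm on the outcome `ω` of the samples. -/
def visitedPoint {d : ℕ} {Ω Θ Θ' : Type*} (η : ℝ)
    (G : EuclideanSpace ℝ (Fin d) → Θ → EuclideanSpace ℝ (Fin d))
    (Cmp : EuclideanSpace ℝ (Fin d) → Θ' → EuclideanSpace ℝ (Fin d))
    (x₀ : EuclideanSpace ℝ (Fin d)) (ξ : ℕ → Ω → EuclideanSpace ℝ (Fin d)) (θ : ℕ → Ω → Θ)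
    (θ' : ℕ → Ω → Θ') (ω : Ω) (t : ℕ) : EuclideanSpace ℝ (Fin d) :=
  (compressedSGD η G Cmp x₀ (fun s => ξ s ω) (fun s => θ s ω) (fun s => θ' s ω) t).1

open scoped RealInnerProductSpace

/-! The corrected iterate y = x - η e does not see the compressor: it moves by -η (∇F(x, θ) + ξ), an
SGD step whose gradient is merely evaluated at x instead of y. The compressor contracts e in mean
square, so f(y) plus a suitable multiple of ‖η e‖² drops in expectation at each step by η/8 times
the `defect` ‖∇f(x)‖² + ‖η e‖², up to a noise floor. Since f has bounded range, this bounds the sum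
of the expected defects (`sum_integral_defect_le`). It remains to charge every point that is not an
SOSP to some defect. A point with gradient larger than ε has defect at least ε² by itself.

For the other points, `le_sum_defect_of_not_isSOSP` shows that the expected defects of the next I
steps, together with I ‖η e‖² at the start, sum to at least β. If they did not, the corrected
iterates would stay close to their start in mean square, and the iterates x would do so on average
over time. Run two copies of the chain with common θ and θ', the second one receiving the Gaussian
noise reflected across the hyperplane orthogonal to an eigenvector v of the smallest Hessian
eigenvalue -γ. Both copies have the law of the algorithm, hence both stay close. But their
difference contains N v, where N is a Gaussian process driven by the noise along v alone and
amplified by 1 + ηγ at each step, so its variance is exponentially large after I steps.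

The rest of the difference is small relative to N in mean square. Linearity of the compressor makes
the difference of the two error vectors contract like a single one. The nonlinearity of the gradient
multiplies the difference by a random factor; the weight exp(-350 P) in `gapEnergy`, with P the
accumulated distance to the reference point, absorbs this factor, so no stopping time is needed.
Markov bounds for P, for the distances and for the energy, and anti-concentration of N, leave a
common outcome of positive probability, on which |N| is both large and small.

By the Markov property the saddle estimate holds from every time on. Summing over time bounds the
expected number of bad points by δT/2 (`IsAdmissible.sum_measureReal_not_isSOSP_le`), which yields
both conclusions, the second by Markov's inequality.

All parameters are tuned by one number Y = K A log M, with A and M the two bases in `hiddenFactor`,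
so that Q = Y^30: the step size is the scale s divided by Y^16, the noise level is ε / (√η Y^6), and
the window I is about Y / (η √(ρε)). For ε > A³ every point is an SOSP and nothing has to be
iterated. -/

/-- The Euclidean space `ℝ^d`. -/
abbrev Vec (d : ℕ) : Type := EuclideanSpace ℝ (Fin d)

/-! ### Smooth objectives and their saddle points -/

section Objective

variable {d : ℕ} {f : Vec d → ℝ} {fmax L ρ ε : ℝ}

namespace IsRegularObjective

lemma continuous_gradient (hf : IsRegularObjective f fmax L ρ) : Continuous (∇ f) :=
  hf.differentiable_gradient.continuous

lemma hasFDerivAt (hf : IsRegularObjective f fmax L ρ) (x : Vec d) :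
    HasFDerivAt f (innerSL ℝ (∇ f x)) x := by
  exact (hf.differentiable x).hasGradientAt.hasFDerivAt

lemma hasFDerivAt_gradient (hf : IsRegularObjective f fmax L ρ) (x : Vec d) :
    HasFDerivAt (∇ f) (hessian f x) x :=
  (hf.differentiable_gradient x).hasFDerivAt

lemma hessian_symm (hf : IsRegularObjective f fmax L ρ) (x u w : Vec d) :
    ⟪hessian f x u, w⟫ = ⟪u, hessian f x w⟫ := by
  have h2 : HasFDerivAt (fun z => innerSL ℝ (∇ f z)) ((innerSL ℝ).comp (hessian f x)) x :=
    (innerSL ℝ).hasFDerivAt.comp x (hf.hasFDerivAt_gradient x)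
  have := second_derivative_symmetric hf.hasFDerivAt h2 u w
  simp only [ContinuousLinearMap.comp_apply, innerSL_apply_apply] at this
  rw [this, real_inner_comm]

lemma isSymmetric_hessian (hf : IsRegularObjective f fmax L ρ) (x : Vec d) :
    (hessian f x : Vec d →ₗ[ℝ] Vec d).IsSymmetric := fun u w => hf.hessian_symm x u w

lemma norm_hessian_le (hf : IsRegularObjective f fmax L ρ) (hL : 0 ≤ L) (x : Vec d) :
    ‖hessian f x‖ ≤ L := by
  have : LipschitzWith ⟨L, hL⟩ (∇ f) := by
    refine LipschitzWith.of_dist_le_mul fun x y => ?_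
    rw [dist_eq_norm, dist_eq_norm]
    exact hf.smooth x y
  exact norm_fderiv_le_of_lipschitz ℝ this

lemma continuous_hessian (hf : IsRegularObjective f fmax L ρ) (hρ : 0 ≤ ρ) :
    Continuous (hessian f) := by
  have : LipschitzWith ⟨ρ, hρ⟩ (hessian f) := by
    refine LipschitzWith.of_dist_le_mul fun x y => ?_
    rw [dist_eq_norm, dist_eq_norm]
    exact hf.hessian_lipschitz x y
  exact this.continuous

/-- The descent lemma. -/
lemma le_quadratic (hf : IsRegularObjective f fmax L ρ) (x p : Vec d) :
    f (x + p) ≤ f x + ⟪∇ f x, p⟫ + L / 2 * ‖p‖ ^ 2 := by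
  have hline : ∀ t : ℝ, HasDerivAt (fun t : ℝ => f (x + t • p)) ⟪∇ f (x + t • p), p⟫ t := by
    intro t
    have h1 : HasDerivAt (fun t : ℝ => x + t • p) p t := by
      simpa using ((hasDerivAt_id t).smul_const p).const_add x
    exact (hf.hasFDerivAt (x + t • p)).comp_hasDerivAt t h1
  -- Restricted to the segment, f minus the claimed quadratic bound is nonincreasing, because its
  -- derivative is nonpositive by the Lipschitz gradient; compare its values at 0 and 1.
  let g : ℝ → ℝ := fun t => f (x + t • p) - t * ⟪∇ f x, p⟫ - L / 2 * ‖p‖ ^ 2 * t ^ 2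
  have hg : ∀ t, HasDerivAt g (⟪∇ f (x + t • p), p⟫ - ⟪∇ f x, p⟫ - L * ‖p‖ ^ 2 * t) t := by
    intro t
    have h2 := ((hasDerivAt_id t).mul_const ⟪∇ f x, p⟫)
    have h3 := ((hasDerivAt_pow 2 t).const_mul (L / 2 * ‖p‖ ^ 2))
    refine (((hline t).sub h2).sub h3).congr_deriv ?_
    norm_num
    ring
  have hanti : AntitoneOn g (Set.Icc 0 1) := by
    refine antitoneOn_of_deriv_nonpos (convex_Icc 0 1)
      (fun t _ => (hg t).continuousAt.continuousWithinAt)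
      (fun t _ => (hg t).differentiableAt.differentiableWithinAt) fun t ht => ?_
    rw [interior_Icc] at ht
    rw [(hg t).deriv, ← inner_sub_left]
    have h4 := real_inner_le_norm (∇ f (x + t • p) - ∇ f x) p
    have h5 := hf.smooth (x + t • p) x
    rw [add_sub_cancel_left, norm_smul, Real.norm_of_nonneg ht.1.le] at h5
    nlinarith [norm_nonneg p]
  have := hanti (Set.left_mem_Icc.2 zero_le_one) (Set.right_mem_Icc.2 zero_le_one) zero_le_one
  simp only [g, one_smul, zero_smul, add_zero] at this
  linarith

/-- A gradient step of length 1/L lowers f by at least ‖∇f‖² / (2L), and f cannot drop by more than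
`fmax`. -/
lemma norm_gradient_sq_le (hf : IsRegularObjective f fmax L ρ) (hL : 0 < L) (x : Vec d) :
    ‖∇ f x‖ ^ 2 ≤ 2 * L * fmax := by
  have h := hf.le_quadratic x (-(1 / L) • ∇ f x)
  have hb := (abs_le.1 (hf.bounded x (x + -(1 / L) • ∇ f x))).2
  rw [inner_smul_right, real_inner_self_eq_norm_sq, norm_smul, Real.norm_eq_abs, abs_neg,
    abs_of_pos (one_div_pos.2 hL), mul_pow] at h
  have h2 : (1 / (2 * L)) * ‖∇ f x‖ ^ 2 ≤ fmax := by
    have : L / 2 * ((1 / L) ^ 2 * ‖∇ f x‖ ^ 2) = (1 / (2 * L)) * ‖∇ f x‖ ^ 2 := by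
      field_simp
    have e2 : -(1 / L) * ‖∇ f x‖ ^ 2 = - 2 * ((1 / (2 * L)) * ‖∇ f x‖ ^ 2) := by
      field_simp
    linarith
  rw [div_mul_eq_mul_div, one_mul, div_le_iff₀ (by positivity)] at h2
  linarith

/-- Mean value inequality on the ball about z of radius ‖x - z‖ + ‖x' - z‖: it contains both points,
and the Hessian there differs from that at z by at most ρ times the radius. -/
lemma norm_gradient_sub_hessian_le (hf : IsRegularObjective f fmax L ρ) (hρ : 0 ≤ ρ)
    (z x x' : Vec d) :
    ‖∇ f x - ∇ f x' - hessian f z (x - x')‖ ≤ ρ * (‖x - z‖ + ‖x' - z‖) * ‖x - x'‖ := by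
  set r := ‖x - z‖ + ‖x' - z‖
  refine (convex_closedBall z r).norm_image_sub_le_of_norm_hasFDerivWithin_le'
    (f' := hessian f) (C := ρ * r) (fun y _ => (hf.hasFDerivAt_gradient y).hasFDerivWithinAt)
    (fun y hy => ?_) ?_ ?_
  · refine (hf.hessian_lipschitz y z).trans ?_
    rw [mem_closedBall_iff_norm] at hy
    gcongr
  · rw [mem_closedBall_iff_norm]
    exact le_add_of_nonneg_left (norm_nonneg _)
  · rw [mem_closedBall_iff_norm]
    exact le_add_of_nonneg_right (norm_nonneg _)

end IsRegularObjective

/-- Everything is read off in an orthonormal eigenbasis. The last clause holds because 1 - ηλ lies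
between 0 and 1 - ηm for each eigenvalue λ, the lower bound being ηL ≤ 1; it says that a linearised
gradient step expands no direction more than that of v. -/
lemma LinearMap.IsSymmetric.exists_min_eigenvector {T : Vec d →ₗ[ℝ] Vec d} (hT : T.IsSymmetric)
    {lam L : ℝ} (hlam : Module.End.HasEigenvalue T lam) (hTL : ∀ x, ‖T x‖ ≤ L * ‖x‖) :
    ∃ (m : ℝ) (v : Vec d), m ≤ lam ∧ ‖v‖ = 1 ∧ T v = m • v ∧ (∀ x, m * ‖x‖ ^ 2 ≤ ⟪x, T x⟫) ∧
      ∀ η, 0 ≤ η → η * L ≤ 1 → m ≤ 0 → ∀ x, ‖x - η • T x‖ ≤ (1 - η * m) * ‖x‖ := by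
  classical
  have hd : Module.finrank ℝ (Vec d) = d := by simp
  let b := hT.eigenvectorBasis hd
  let l := hT.eigenvalues hd
  have hTb : ∀ i, T (b i) = l i • b i := hT.apply_eigenvectorBasis hd
  obtain ⟨i₀, hi₀⟩ := hT.exists_eigenvalues_eq hd hlam
  obtain ⟨j, -, hj⟩ := Finset.exists_min_image Finset.univ l ⟨i₀, Finset.mem_univ _⟩
  have hcoord : ∀ x i, ⟪b i, T x⟫ = l i * ⟪b i, x⟫ := by
    intro x i
    rw [← hT, hTb, real_inner_smul_left]
  refine ⟨l j, b j, ?_, b.norm_eq_one j, hTb j, ?_, ?_⟩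
  · exact (hj i₀ (Finset.mem_univ _)).trans (le_of_eq hi₀)
  · intro x
    have h1 : ⟪x, T x⟫ = ∑ i, l i * ⟪b i, x⟫ ^ 2 := by
      rw [← b.sum_inner_mul_inner]
      refine Finset.sum_congr rfl fun i _ => ?_
      rw [hcoord, real_inner_comm]; ring
    have h2 : ‖x‖ ^ 2 = ∑ i, ⟪b i, x⟫ ^ 2 := (b.sum_sq_inner_right x).symm
    rw [h1, h2, Finset.mul_sum]
    exact Finset.sum_le_sum fun i _ =>
      mul_le_mul_of_nonneg_right (hj i (Finset.mem_univ _)) (sq_nonneg _)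
  · intro η hη hηL hm x
    have hq : 0 ≤ 1 - η * l j := by nlinarith
    refine abs_le_of_sq_le_sq' ?_ (by positivity) |>.2
    rw [mul_pow, ← b.sum_sq_inner_right, ← b.sum_sq_inner_right, Finset.mul_sum]
    refine Finset.sum_le_sum fun i _ => ?_
    rw [inner_sub_right, inner_smul_right, hcoord]
    have hli : l i ≤ L := by
      have := hTL (b i)
      rw [hTb, norm_smul, b.norm_eq_one, mul_one, mul_one] at this
      exact (le_abs_self _).trans this
    have hmi := hj i (Finset.mem_univ _)
    have e : ⟪b i, x⟫ - η * (l i * ⟪b i, x⟫) = (1 - η * l i) * ⟪b i, x⟫ := by ring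
    rw [e, mul_pow]
    refine mul_le_mul_of_nonneg_right ?_ (sq_nonneg _)
    have : η * l j ≤ η * l i := mul_le_mul_of_nonneg_left hmi hη
    have : η * l i ≤ η * L := mul_le_mul_of_nonneg_left hli hη
    exact pow_le_pow_left₀ (by linarith) (by linarith) 2

lemma IsRegularObjective.norm_hessian_apply_le (hf : IsRegularObjective f fmax L ρ) (hL : 0 ≤ L)
    (x u : Vec d) : ‖hessian f x u‖ ≤ L * ‖u‖ :=
  ((hessian f x).le_opNorm u).trans
    (mul_le_mul_of_nonneg_right (hf.norm_hessian_le hL x) (norm_nonneg u))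

/-- The variational form of the eigenvalue condition, which is a family of closed conditions in x
and so gives measurability. -/
lemma isSOSP_iff (hf : IsRegularObjective f fmax L ρ) (hL : 0 ≤ L) (x : Vec d) :
    IsSOSP f ρ ε x ↔ ‖∇ f x‖ ≤ ε ∧ ∀ u, -√(ρ * ε) * ‖u‖ ^ 2 ≤ ⟪u, hessian f x u⟫ := by
  refine and_congr_right fun _ => ⟨fun h u => ?_, fun h lam hlam => ?_⟩
  · by_cases hu : u = 0
    · simp [hu]
    have : Nontrivial (Vec d) := ⟨u, 0, hu⟩
    obtain ⟨m, v, -, hv, hTv, hq, -⟩ := (hf.isSymmetric_hessian x).exists_min_eigenvector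
      (hf.isSymmetric_hessian x).hasEigenvalue_iInf_of_finiteDimensional
      (hf.norm_hessian_apply_le hL x)
    refine le_trans (mul_le_mul_of_nonneg_right (h m ?_) (sq_nonneg _)) (hq u)
    refine Module.End.hasEigenvalue_of_hasEigenvector (x := v) ⟨?_, ?_⟩
    · rw [Module.End.mem_eigenspace_iff]; exact hTv
    · rintro rfl; simp at hv
  · obtain ⟨v, hv⟩ := hlam.exists_hasEigenvector
    have h1 := h v
    have h2 : hessian f x v = lam • v := hv.apply_eq_smul
    rw [h2, inner_smul_right, real_inner_self_eq_norm_sq] at h1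
    have : 0 < ‖v‖ ^ 2 := pow_pos (norm_pos_iff.2 hv.2) 2
    exact le_of_mul_le_mul_right h1 this

lemma measurableSet_isSOSP (hf : IsRegularObjective f fmax L ρ) (hL : 0 ≤ L) (hρ : 0 ≤ ρ) :
    MeasurableSet {x | IsSOSP f ρ ε x} := by
  have h1 := hf.continuous_gradient
  have h2 := hf.continuous_hessian hρ
  simp_rw [isSOSP_iff hf hL, Set.ofPred_and, Set.ofPred_forall]
  refine IsClosed.measurableSet (IsClosed.inter (isClosed_le h1.norm continuous_const)
    (isClosed_iInter fun u => isClosed_le continuous_const ?_))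
  exact continuous_const.inner (h2.clm_apply continuous_const)

/-- A point of large gradient excluded, the failure of second-order stationarity gives a direction
of most negative curvature. -/
lemma exists_escape_direction (hf : IsRegularObjective f fmax L ρ) (hL : 0 ≤ L) {x : Vec d}
    (hx : ‖∇ f x‖ ≤ ε) (hns : ¬ IsSOSP f ρ ε x) :
    ∃ (γ : ℝ) (v : Vec d), √(ρ * ε) ≤ γ ∧ γ ≤ L ∧ ‖v‖ = 1 ∧ hessian f x v = -γ • v ∧
      ∀ η, 0 ≤ η → η * L ≤ 1 → ∀ u, ‖u - η • hessian f x u‖ ≤ (1 + η * γ) * ‖u‖ := by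
  simp only [IsSOSP, hx, true_and, not_forall, not_le] at hns
  obtain ⟨lam, hlam, hlt⟩ := hns
  obtain ⟨m, v, hm, hv, hTv, -, hop⟩ := (hf.isSymmetric_hessian x).exists_min_eigenvector hlam
    (hf.norm_hessian_apply_le hL x)
  have hs := Real.sqrt_nonneg (ρ * ε)
  refine ⟨-m, v, by linarith, ?_, hv, by simpa using hTv, fun η h0 h1 u => ?_⟩
  · have h3 := hf.norm_hessian_apply_le hL x v
    have h4 : hessian f x v = m • v := hTv
    rw [h4, norm_smul, hv, mul_one, mul_one] at h3
    exact (neg_le_abs m).trans h3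
  · rw [mul_neg, ← sub_eq_add_neg]
    exact hop η h0 h1 (by linarith) u

/-- If `ε` is large compared with the other parameters, every point is an `ε`-SOSP. -/
lemma isSOSP_of_large (hf : IsRegularObjective f fmax L ρ) (hL : 0 < L) (hε : 0 ≤ ε)
    (h1 : 2 * L * fmax ≤ ε ^ 2) (h2 : L ^ 2 ≤ ρ * ε) (x : Vec d) : IsSOSP f ρ ε x := by
  refine ⟨abs_le_of_sq_le_sq' ((hf.norm_gradient_sq_le hL x).trans h1) hε |>.2,
    fun lam hlam => ?_⟩
  obtain ⟨v, hv⟩ := hlam.exists_hasEigenvector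
  have h3 := hf.norm_hessian_apply_le hL.le x v
  have h4 : hessian f x v = lam • v := hv.apply_eq_smul
  rw [h4, norm_smul] at h3
  have h5 := le_of_mul_le_mul_right h3 (norm_pos_iff.2 hv.2)
  have h6 : L ≤ √(ρ * ε) := Real.le_sqrt_of_sq_le h2
  have := neg_abs_le lam
  rw [Real.norm_eq_abs] at h5
  linarith

end Objective

/-! ### The Gaussian noise: moments, reflection symmetry, anti-concentration -/

section Noise

variable {d : ℕ} {r : ℝ}

instance isProbabilityMeasure_noiseLaw : IsProbabilityMeasure (noiseLaw d r) :=
  Measure.isProbabilityMeasure_map (by fun_prop)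

instance isGaussian_noiseLaw : IsGaussian (noiseLaw d r) := by
  have : noiseLaw d r = (stdGaussian (Vec d)).map
      ((r / √(d : ℝ)) • ContinuousLinearMap.id ℝ (Vec d)) := rfl
  rw [this]
  infer_instance

lemma integrable_id_noiseLaw : Integrable (fun ξ => ξ) (noiseLaw d r) :=
  IsGaussian.integrable_id

lemma integrable_sq_norm_noiseLaw : Integrable (fun ξ => ‖ξ‖ ^ 2) (noiseLaw d r) :=
  (memLp_two_iff_integrable_sq_norm (by fun_prop)).1 IsGaussian.memLp_two_id

lemma integral_id_noiseLaw : ∫ ξ, ξ ∂(noiseLaw d r) = 0 := by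
  rw [noiseLaw, integral_map (by fun_prop) (by fun_prop), integral_smul, integral_id_stdGaussian,
    smul_zero]

lemma map_inner_noiseLaw {v : Vec d} (hv : ‖v‖ = 1) :
    (noiseLaw d r).map (fun ξ => ⟪v, ξ⟫) = gaussianReal 0 (r ^ 2 / d).toNNReal := by
  have h1 : (stdGaussian (Vec d)).map (innerSL ℝ v) = gaussianReal 0 1 := by
    rw [IsGaussian.map_eq_gaussianReal, integral_strongDual_stdGaussian, variance_dual_stdGaussian,
      innerSL_apply_norm, hv]
    simp
  rw [noiseLaw, Measure.map_map (by fun_prop) (by fun_prop)]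
  have h2 : ((fun ξ => ⟪v, ξ⟫) ∘ fun z : Vec d => (r / √(d : ℝ)) • z) =
      (fun x => (r / √(d : ℝ)) * x) ∘ (innerSL ℝ v) := by
    ext z
    simp [inner_smul_right]
  rw [h2, ← Measure.map_map (by fun_prop) (by fun_prop), h1, gaussianReal_map_const_mul]
  congr 1
  · simp
  · ext
    simp [div_pow, Real.coe_toNNReal _ (show (0 : ℝ) ≤ r ^ 2 / d by positivity)]

lemma integral_gaussianReal_sq (V : NNReal) : ∫ x, x ^ 2 ∂(gaussianReal 0 V) = V := by
  have h := variance_id_gaussianReal (μ := 0) (v := V)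
  rw [variance_eq_sub (memLp_id_gaussianReal 2)] at h
  simpa using h

lemma integral_inner_sq_noiseLaw {v : Vec d} (hv : ‖v‖ = 1) :
    ∫ ξ, ⟪v, ξ⟫ ^ 2 ∂(noiseLaw d r) = r ^ 2 / d := by
  have h := integral_gaussianReal_sq (r ^ 2 / d).toNNReal
  rw [← map_inner_noiseLaw hv, integral_map (by fun_prop) (by fun_prop)] at h
  rw [h, Real.coe_toNNReal _ (by positivity)]

lemma integral_sq_norm_noiseLaw (hd : 1 ≤ d) : ∫ ξ, ‖ξ‖ ^ 2 ∂(noiseLaw d r) = r ^ 2 := by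
  let b := EuclideanSpace.basisFun (Fin d) ℝ
  have h1 : ∀ ξ : Vec d, ‖ξ‖ ^ 2 = ∑ i, ⟪b i, ξ⟫ ^ 2 := fun ξ => (b.sum_sq_inner_right ξ).symm
  simp_rw [h1]
  rw [integral_finsetSum]
  · simp_rw [integral_inner_sq_noiseLaw (b.norm_eq_one _)]
    have : (d : ℝ) ≠ 0 := by positivity
    simp
    field_simp
  · intro i _
    refine integrable_sq_norm_noiseLaw.mono' (by fun_prop) (.of_forall fun ξ => ?_)
    rw [Real.norm_of_nonneg (by positivity), ← sq_abs]
    have := abs_real_inner_le_norm (b i) ξ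
    rw [b.norm_eq_one, one_mul] at this
    gcongr

/-- The reflection across the hyperplane orthogonal to the unit vector `v`. -/
noncomputable def hyperplaneReflection (v ξ : Vec d) : Vec d := ξ - (2 * ⟪v, ξ⟫) • v

lemma measurePreserving_hyperplaneReflection {v : Vec d} (hv : ‖v‖ = 1) :
    MeasurePreserving (hyperplaneReflection v) (noiseLaw d r) (noiseLaw d r) := by
  let R : Vec d ≃ₗᵢ[ℝ] Vec d := (ℝ ∙ v)ᗮ.reflection
  have hR : ∀ ξ, R ξ = hyperplaneReflection v ξ := by
    intro ξ
    simp only [R, Submodule.reflection_orthogonal_apply, Submodule.reflection_singleton_apply, hv,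
      hyperplaneReflection]
    rw [two_smul, ← add_smul, two_mul]
    simp [add_smul]
  have hR' : hyperplaneReflection v = R := by ext1 ξ; rw [hR]
  refine ⟨by unfold hyperplaneReflection; fun_prop, ?_⟩
  rw [hR', noiseLaw, Measure.map_map (by fun_prop) (by fun_prop)]
  have h2 : (R ∘ fun z : Vec d => (r / √(d : ℝ)) • z) =
      (fun z => (r / √(d : ℝ)) • z) ∘ R := by
    ext1 z
    simp
  rw [h2, ← Measure.map_map (by fun_prop) (by fun_prop), stdGaussian_map]

/-- Anti-concentration of a centred Gaussian at the scale of half its standard deviation. -/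
lemma gaussianReal_abs_lt_half_le {V : NNReal} (hV : V ≠ 0) :
    (gaussianReal 0 V).real {x | |x| < √V / 2} ≤ 2 / 5 := by
  have hV' : 0 < (V : ℝ) := by positivity
  have hs : 0 < √(V : ℝ) := Real.sqrt_pos.2 hV'
  have hset : {x : ℝ | |x| < √V / 2} = Set.Ioo (-(√V / 2)) (√V / 2) := by
    ext x; simp [abs_lt]
  have hbd : ∀ x, gaussianPDFReal 0 V x ≤ (√(2 * Real.pi * V))⁻¹ := by
    intro x
    rw [gaussianPDFReal]
    refine mul_le_of_le_one_right (by positivity) (Real.exp_le_one_iff.2 ?_)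
    have : 0 ≤ (x - 0) ^ 2 / (2 * V) := by positivity
    rw [neg_div]; linarith
  rw [measureReal_def, gaussianReal_apply_eq_integral _ hV, hset,
    ENNReal.toReal_ofReal (integral_nonneg fun x => gaussianPDFReal_nonneg _ _ _)]
  -- The density is at most 1 / √(2πV) and the interval has length √V, so the probability is at most
  -- 1 / √(2π), about 0.399.
  calc ∫ x in Set.Ioo (-(√V / 2)) (√(V : ℝ) / 2), gaussianPDFReal 0 V x
      ≤ ∫ _ in Set.Ioo (-(√V / 2)) (√(V : ℝ) / 2), (√(2 * Real.pi * V))⁻¹ := by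
        refine integral_mono (integrable_gaussianPDFReal _ _).integrableOn ?_ hbd
        exact integrable_const _
    _ = √V * (√(2 * Real.pi * V))⁻¹ := by
        rw [setIntegral_const, measureReal_def, Real.volume_Ioo, ENNReal.toReal_ofReal (by linarith)]
        simp
    _ = (√(2 * Real.pi))⁻¹ := by
        rw [Real.sqrt_mul (by positivity)]
        field_simp
    _ ≤ 2 / 5 := by
        rw [inv_le_comm₀ (by positivity) (by norm_num)]
        refine Real.le_sqrt_of_sq_le ?_
        have := Real.pi_gt_d2
        norm_num
        linarith

end Noise

/-! ### Markov chains driven by independent samples -/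

section Chain

open Function ENNReal

variable {S S' W : Type*} [MeasurableSpace S] [MeasurableSpace S'] [MeasurableSpace W]

/-- The law at time `t` of the Markov chain `s_{t+1} = Φ s_t w_t` driven by independent `w_t` of law
`ν` and started from the law `m`. -/
noncomputable def chainLaw (Φ : S → W → S) (ν : Measure W) (m : Measure S) : ℕ → Measure S
  | 0 => m
  | t + 1 => ((chainLaw Φ ν m t).prod ν).map (uncurry Φ)

/-- The transition operator of the chain `s_{t+1} = Φ s_t w_t`. -/
noncomputable def transitionOp (Φ : S → W → S) (ν : Measure W) (φ : S → ℝ≥0∞) (s : S) : ℝ≥0∞ :=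
  ∫⁻ w, φ (Φ s w) ∂ν

variable {Φ : S → W → S} {ν : Measure W} {m : Measure S}

lemma chainLaw_add (t u : ℕ) : chainLaw Φ ν (chainLaw Φ ν m t) u = chainLaw Φ ν m (t + u) := by
  induction u with
  | zero => rfl
  | succ u ih => rw [chainLaw, ih]; rfl

variable [IsProbabilityMeasure ν]

lemma isProbabilityMeasure_chainLaw (hΦ : Measurable (uncurry Φ)) [IsProbabilityMeasure m] (t : ℕ) :
    IsProbabilityMeasure (chainLaw Φ ν m t) := by
  induction t with
  | zero => simpa [chainLaw]
  | succ t ih => exact Measure.isProbabilityMeasure_map hΦ.aemeasurable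

lemma measurable_transitionOp (hΦ : Measurable (uncurry Φ)) {φ : S → ℝ≥0∞} (hφ : Measurable φ) :
    Measurable (transitionOp Φ ν φ) :=
  Measurable.lintegral_prod_right' (f := fun p => φ (uncurry Φ p)) (hφ.comp hΦ)

lemma measurable_transitionOp_iterate (hΦ : Measurable (uncurry Φ)) {φ : S → ℝ≥0∞}
    (hφ : Measurable φ) (t : ℕ) : Measurable ((transitionOp Φ ν)^[t] φ) := by
  induction t with
  | zero => simpa
  | succ t ih =>
    rw [iterate_succ_apply']
    exact measurable_transitionOp hΦ ih

lemma lintegral_chainLaw_succ (hΦ : Measurable (uncurry Φ)) {φ : S → ℝ≥0∞}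
    (hφ : Measurable φ) (t : ℕ) :
    ∫⁻ s, φ s ∂(chainLaw Φ ν m (t + 1)) = ∫⁻ s, transitionOp Φ ν φ s ∂(chainLaw Φ ν m t) := by
  rw [chainLaw, lintegral_map hφ hΦ, lintegral_prod (fun p => φ (uncurry Φ p)) (hφ.comp hΦ).aemeasurable]
  rfl

lemma lintegral_chainLaw (hΦ : Measurable (uncurry Φ)) {φ : S → ℝ≥0∞}
    (hφ : Measurable φ) (t : ℕ) :
    ∫⁻ s, φ s ∂(chainLaw Φ ν m t) = ∫⁻ s, (transitionOp Φ ν)^[t] φ s ∂m := by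
  induction t generalizing φ with
  | zero => rfl
  | succ t ih =>
    rw [lintegral_chainLaw_succ hΦ hφ, ih (measurable_transitionOp hΦ hφ), iterate_succ_apply]

lemma lintegral_chainLaw_dirac (hΦ : Measurable (uncurry Φ)) {φ : S → ℝ≥0∞}
    (hφ : Measurable φ) (t : ℕ) (s : S) :
    ∫⁻ s', φ s' ∂(chainLaw Φ ν (Measure.dirac s) t) = (transitionOp Φ ν)^[t] φ s := by
  rw [lintegral_chainLaw hΦ hφ, lintegral_dirac' _ (measurable_transitionOp_iterate hΦ hφ t)]

/-- Used to identify the marginals of the coupling: the second copy sees the samples through the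
measure-preserving map R, here a reflection of the noise. -/
lemma map_chainLaw_of_semiconj [SFinite m] {Ψ : S' → W → S'} (hΦ : Measurable (uncurry Φ))
    (hΨ : Measurable (uncurry Ψ)) {π : S → S'} (hπ : Measurable π) {R : W → W}
    (hR : MeasurePreserving R ν ν) (h : ∀ s w, π (Φ s w) = Ψ (π s) (R w)) (t : ℕ) :
    (chainLaw Φ ν m t).map π = chainLaw Ψ ν (m.map π) t := by
  have hs : ∀ t, SFinite (chainLaw Φ ν m t) := by
    intro t
    induction t with
    | zero => simpa [chainLaw]
    | succ t ih => rw [chainLaw]; infer_instance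
  induction t with
  | zero => rfl
  | succ t ih =>
    have := hs t
    rw [chainLaw, chainLaw, Measure.map_map hπ hΦ, ← ih]
    have h1 : π ∘ uncurry Φ = uncurry Ψ ∘ Prod.map π R := by
      ext1 ⟨s, w⟩
      exact h s w
    rw [h1, ← Measure.map_map hΨ (hπ.prodMap hR.measurable),
      ← Measure.map_prod_map _ _ hπ hR.measurable, hR.map_eq]

/-- A Lyapunov estimate valid at each state passes to laws. Integrability of φ after the step is
part of the conclusion, since φ is nonnegative and its conditional mean is dominated by ψ; this lets
inductions over time carry integrability along. -/
lemma integral_map_prod_le [SFinite m] (hΦ : Measurable (uncurry Φ)) {φ ψ : S → ℝ}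
    (hφ : Measurable φ) (hφ0 : ∀ s, 0 ≤ φ s) (hψ : Integrable ψ m)
    (hint : ∀ s, Integrable (fun w => φ (Φ s w)) ν) (hle : ∀ s, ∫ w, φ (Φ s w) ∂ν ≤ ψ s) :
    Integrable φ ((m.prod ν).map (uncurry Φ)) ∧
      ∫ s, φ s ∂((m.prod ν).map (uncurry Φ)) ≤ ∫ s, ψ s ∂m := by
  have hmeas : AEStronglyMeasurable (fun p => φ (uncurry Φ p)) (m.prod ν) :=
    (hφ.comp hΦ).aestronglyMeasurable
  have hm2 : AEStronglyMeasurable (fun s => ∫ w, φ (Φ s w) ∂ν) m :=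
    hmeas.integral_prod_right'
  have hdom : Integrable (fun s => ∫ w, φ (Φ s w) ∂ν) m :=
    hψ.mono' hm2 (.of_forall fun s => by
      rw [Real.norm_of_nonneg (integral_nonneg fun w => hφ0 _)]; exact hle s)
  have hi : Integrable (fun p => φ (uncurry Φ p)) (m.prod ν) := by
    refine (integrable_prod_iff hmeas).2 ⟨.of_forall hint, ?_⟩
    simpa [uncurry, abs_of_nonneg (hφ0 _)] using hdom
  refine ⟨(integrable_map_measure hφ.aestronglyMeasurable hΦ.aemeasurable).2 hi, ?_⟩
  rw [integral_map hΦ.aemeasurable hφ.aestronglyMeasurable, integral_prod _ hi]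
  exact integral_mono hdom hψ hle

/-- A recursively defined process driven by independent, identically distributed samples has the
laws of the chain. -/
lemma map_process_eq_chainLaw {Ω : Type*} [MeasurableSpace Ω] {P : Measure Ω}
    [IsProbabilityMeasure P] (hΦ : Measurable (uncurry Φ)) {w : ℕ → Ω → W}
    (hw : ∀ t, Measurable (w t)) (hlaw : ∀ t, P.map (w t) = ν) (hind : iIndepFun w P)
    {X : ℕ → Ω → S} {s₀ : S} (h0 : ∀ ω, X 0 ω = s₀) (hX : ∀ t ω, X (t + 1) ω = Φ (X t ω) (w t ω)) (t : ℕ) :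
    Measurable (X t) ∧ P.map (X t) = chainLaw Φ ν (Measure.dirac s₀) t := by
  -- The state at time t is a measurable function of the samples before t, hence independent of the
  -- sample at t.
  have hg : ∀ t, ∃ g : (Finset.range t → W) → S, Measurable g ∧
      ∀ ω, X t ω = g (fun i => w i ω) := by
    intro t
    induction t with
    | zero => exact ⟨fun _ => s₀, measurable_const, h0⟩
    | succ t ih =>
      obtain ⟨g, hgm, hg⟩ := ih
      refine ⟨fun u => Φ (g fun i => u ⟨i, Finset.mem_range.2
        ((Finset.mem_range.1 i.2).trans (Nat.lt_succ_self t))⟩)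
        (u ⟨t, Finset.self_mem_range_succ t⟩), ?_, ?_⟩
      · refine hΦ.comp (Measurable.prodMk (hgm.comp ?_) (measurable_pi_apply _))
        exact measurable_pi_lambda _ fun i => measurable_pi_apply _
      · intro ω
        rw [hX, hg]
  have hXm : ∀ t, Measurable (X t) := by
    intro t
    obtain ⟨g, hgm, hg⟩ := hg t
    have : X t = fun ω => g (fun i => w i ω) := funext hg
    rw [this]
    exact hgm.comp (measurable_pi_lambda _ fun i => hw _)
  refine ⟨hXm t, ?_⟩
  induction t with
  | zero =>
    have : X 0 = fun _ => s₀ := funext h0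
    rw [this, Measure.map_const, measure_univ, one_smul]; rfl
  | succ t ih =>
    have hi : IndepFun (X t) (w t) P := by
      obtain ⟨g, hgm, hg⟩ := hg t
      have h1 := hind.indepFun_finset (Finset.range t) {t} (by simp) (fun i => hw i)
      have h2 := h1.comp hgm (measurable_pi_apply (⟨t, Finset.mem_singleton_self t⟩ : ({t} : Finset ℕ)))
      have e1 : X t = g ∘ fun ω (i : Finset.range t) => w i ω := funext hg
      rw [e1]
      exact h2
    have e : X (t + 1) = uncurry Φ ∘ fun ω => (X t ω, w t ω) := funext (hX t)
    rw [e, ← Measure.map_map hΦ ((hXm t).prodMk (hw t)), chainLaw, ← ih, ← hlaw t,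
      (indepFun_iff_map_prod_eq_prod_map_map (hXm t).aemeasurable (hw t).aemeasurable).1 hi]

end Chain

/-! ### Centred random vectors and second moments -/

section Centered

variable {d : ℕ} {A : Type*} [MeasurableSpace A]

/-- `u` is a centred, square-integrable random vector. -/
structure IsCentered (u : A → Vec d) (m : Measure A) : Prop where
  measurable : Measurable u
  integrable : Integrable u m
  integral_eq_zero : ∫ a, u a ∂m = 0
  integrable_sq : Integrable (fun a => ‖u a‖ ^ 2) m

variable {m : Measure A} {u w : A → Vec d}

namespace IsCentered

lemma memLp (hu : IsCentered u m) : MemLp u 2 m :=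
  (memLp_two_iff_integrable_sq_norm hu.measurable.aestronglyMeasurable).2 hu.integrable_sq

lemma of_memLp (hm : Measurable u) [IsFiniteMeasure m] (h : MemLp u 2 m) (h0 : ∫ a, u a ∂m = 0) :
    IsCentered u m :=
  ⟨hm, h.integrable one_le_two, h0,
    (memLp_two_iff_integrable_sq_norm hm.aestronglyMeasurable).1 h⟩

lemma sub [IsFiniteMeasure m] (hu : IsCentered u m) (hw : IsCentered w m) :
    IsCentered (fun a => u a - w a) m :=
  of_memLp (hu.measurable.sub hw.measurable) (hu.memLp.sub hw.memLp) (by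
    rw [integral_sub hu.integrable hw.integrable, hu.integral_eq_zero, hw.integral_eq_zero, sub_zero])

lemma integral_norm_sub_sq_le [IsFiniteMeasure m] (hu : IsCentered u m) (hw : IsCentered w m) :
    ∫ a, ‖u a - w a‖ ^ 2 ∂m ≤ 2 * ∫ a, ‖u a‖ ^ 2 ∂m + 2 * ∫ a, ‖w a‖ ^ 2 ∂m := by
  rw [← integral_const_mul, ← integral_const_mul, ← integral_add (hu.integrable_sq.const_mul 2)
    (hw.integrable_sq.const_mul 2)]
  refine integral_mono (hu.sub hw).integrable_sq
    ((hu.integrable_sq.const_mul 2).add (hw.integrable_sq.const_mul 2)) fun a => ?_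
  have := parallelogram_law_with_norm ℝ (u a) (w a)
  simp only
  nlinarith [sq_nonneg ‖u a + w a‖]

lemma integral_norm_add_sq [IsProbabilityMeasure m] (hu : IsCentered u m) (b : Vec d) :
    Integrable (fun a => ‖b + u a‖ ^ 2) m ∧
      ∫ a, ‖b + u a‖ ^ 2 ∂m = ‖b‖ ^ 2 + ∫ a, ‖u a‖ ^ 2 ∂m := by
  have hin : Integrable (fun a => ⟪b, u a⟫) m := hu.integrable.const_inner b
  have h : ∀ a, ‖b + u a‖ ^ 2 = ‖b‖ ^ 2 + 2 * ⟪b, u a⟫ + ‖u a‖ ^ 2 :=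
    fun a => norm_add_sq_real b (u a)
  simp_rw [h]
  have h1 : Integrable (fun a => ‖b‖ ^ 2 + 2 * ⟪b, u a⟫) m :=
    (integrable_const _).add (hin.const_mul 2)
  refine ⟨h1.add hu.integrable_sq, ?_⟩
  rw [integral_add h1 hu.integrable_sq, integral_add (integrable_const _) (hin.const_mul 2),
    integral_const_mul, integral_inner hu.integrable, hu.integral_eq_zero]
  simp

lemma comp {B : Type*} [MeasurableSpace B] {m' : Measure B} [IsFiniteMeasure m'] {π : B → A}
    (hπ : MeasurePreserving π m' m) (hu : IsCentered u m) : IsCentered (fun b => u (π b)) m' := by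
  refine of_memLp (hu.measurable.comp hπ.measurable) (hu.memLp.comp_measurePreserving hπ) ?_
  rw [← hu.integral_eq_zero, ← hπ.map_eq, integral_map hπ.measurable.aemeasurable
    hu.measurable.aestronglyMeasurable]

/-- Independent centred vectors on the two factors of a product space are orthogonal. -/
lemma prod_add {B : Type*} [MeasurableSpace B] {m' : Measure B} [IsProbabilityMeasure m]
    [IsProbabilityMeasure m'] {w : B → Vec d} (hu : IsCentered u m) (hw : IsCentered w m') :
    IsCentered (fun p : A × B => u p.1 + w p.2) (m.prod m') ∧
      ∫ p, ‖u p.1 + w p.2‖ ^ 2 ∂(m.prod m') = ∫ a, ‖u a‖ ^ 2 ∂m + ∫ b, ‖w b‖ ^ 2 ∂m' := by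
  have h1 := hu.comp (measurePreserving_fst (μ := m) (ν := m'))
  have h2 := hw.comp (measurePreserving_snd (μ := m) (ν := m'))
  have h : IsCentered (fun p : A × B => u p.1 + w p.2) (m.prod m') := by
    refine of_memLp (h1.measurable.add h2.measurable) (h1.memLp.add h2.memLp) ?_
    rw [integral_add h1.integrable h2.integrable, h1.integral_eq_zero, h2.integral_eq_zero, add_zero]
  refine ⟨h, ?_⟩
  rw [integral_prod _ h.integrable_sq]
  simp only [(hw.integral_norm_add_sq _).2]
  rw [integral_add hu.integrable_sq (integrable_const _)]
  simp

end IsCentered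

lemma isCentered_id_noiseLaw {r : ℝ} : IsCentered (fun ξ : Vec d => ξ) (noiseLaw d r) :=
  ⟨measurable_id, integrable_id_noiseLaw, integral_id_noiseLaw, integrable_sq_norm_noiseLaw⟩

/-- The second moment of the error of a compressor applied to a random vector. -/
lemma IsCompressor.integral_error_le {Θ' : Type*} [MeasurableSpace Θ'] {D' : Measure Θ'}
    [IsProbabilityMeasure D'] {Cmp : Vec d → Θ' → Vec d} {μ : ℝ} (hC : IsCompressor Cmp D' μ)
    [SFinite m] {Y : A → Vec d} (hY : Measurable Y) (hY2 : Integrable (fun a => ‖Y a‖ ^ 2) m) :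
    Integrable (fun p : A × Θ' => ‖Y p.1 - Cmp (Y p.1) p.2‖ ^ 2) (m.prod D') ∧
      ∫ p, ‖Y p.1 - Cmp (Y p.1) p.2‖ ^ 2 ∂(m.prod D') ≤ (1 - μ) * ∫ a, ‖Y a‖ ^ 2 ∂m := by
  have hC1 : Measurable (fun p : A × Θ' => Cmp (Y p.1) p.2) :=
    hC.measurable.comp ((hY.comp measurable_fst).prodMk measurable_snd)
  have hmeas : AEStronglyMeasurable (fun p : A × Θ' => ‖Y p.1 - Cmp (Y p.1) p.2‖ ^ 2)
      (m.prod D') :=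
    (((hY.comp measurable_fst).sub hC1).norm.pow_const 2).aestronglyMeasurable
  have hnn : ∀ a, 0 ≤ ∫ θ, ‖Y a - Cmp (Y a) θ‖ ^ 2 ∂D' :=
    fun a => integral_nonneg fun _ => sq_nonneg _
  have hm2 : AEStronglyMeasurable (fun a => ∫ θ, ‖Y a - Cmp (Y a) θ‖ ^ 2 ∂D') m :=
    hmeas.integral_prod_right'
  have h2 : Integrable (fun a => ∫ θ, ‖Y a - Cmp (Y a) θ‖ ^ 2 ∂D') m := by
    refine (hY2.const_mul (1 - μ)).mono' hm2 (.of_forall fun a => ?_)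
    rw [Real.norm_of_nonneg (hnn a)]
    exact hC.error_le (Y a)
  have hi : Integrable (fun p : A × Θ' => ‖Y p.1 - Cmp (Y p.1) p.2‖ ^ 2) (m.prod D') := by
    refine (integrable_prod_iff hmeas).2 ⟨.of_forall fun a => hC.integrable_sq (Y a), ?_⟩
    simp_rw [norm_pow, norm_norm]
    exact h2
  refine ⟨hi, ?_⟩
  rw [integral_prod _ hi, ← integral_const_mul]
  exact integral_mono h2 (hY2.const_mul _) fun a => hC.error_le (Y a)

end Centered

/-! ### One step of the algorithm -/

section Step

variable {d : ℕ} {Θ Θ' : Type*} [MeasurableSpace Θ] [MeasurableSpace Θ']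

/-- One iteration of compressed SGD with error feedback, on the pair `(x, e)`. -/
def sgdStep (η : ℝ) (G : Vec d → Θ → Vec d) (Cmp : Vec d → Θ' → Vec d) (s : Vec d × Vec d)
    (w : Vec d × Θ × Θ') : Vec d × Vec d :=
  (s.1 - η • Cmp (s.2 + G s.1 w.2.1 + w.1) w.2.2,
    s.2 + G s.1 w.2.1 + w.1 - Cmp (s.2 + G s.1 w.2.1 + w.1) w.2.2)

/-- The law of the randomness `(ξ, θ, θ')` of one iteration. -/
noncomputable def sampleLaw (d : ℕ) (r : ℝ) (D : Measure Θ) (D' : Measure Θ') :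
    Measure (Vec d × Θ × Θ') :=
  (noiseLaw d r).prod (D.prod D')

/-- The corrected iterate `x - η e`. -/
def corrected (η : ℝ) (s : Vec d × Vec d) : Vec d := s.1 - η • s.2

variable {η r σ μ : ℝ} {D : Measure Θ} {D' : Measure Θ'} [IsProbabilityMeasure D]
  [IsProbabilityMeasure D'] {f : Vec d → ℝ} {G : Vec d → Θ → Vec d} {Cmp : Vec d → Θ' → Vec d}

instance : IsProbabilityMeasure (sampleLaw d r D D') := by
  unfold sampleLaw; infer_instance

lemma measurable_corrected : Measurable (corrected (d := d) η) := by
  unfold corrected; fun_prop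

lemma measurable_sgdStep (hG : Measurable (Function.uncurry G))
    (hC : Measurable (Function.uncurry Cmp)) :
    Measurable (Function.uncurry (sgdStep η G Cmp)) := by
  have h1 : Measurable (fun p : (Vec d × Vec d) × (Vec d × Θ × Θ') =>
      p.1.2 + G p.1.1 p.2.2.1 + p.2.1) := by
    have : Measurable (fun p : (Vec d × Vec d) × (Vec d × Θ × Θ') => G p.1.1 p.2.2.1) :=
      hG.comp (g := Function.uncurry G) (f := fun p : (Vec d × Vec d) × (Vec d × Θ × Θ') =>
        (p.1.1, p.2.2.1)) (by fun_prop)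
    fun_prop
  have h2 : Measurable (fun p : (Vec d × Vec d) × (Vec d × Θ × Θ') =>
      Cmp (p.1.2 + G p.1.1 p.2.2.1 + p.2.1) p.2.2.2) :=
    hC.comp (g := Function.uncurry Cmp) (h1.prodMk (by fun_prop))
  exact (Measurable.sub (by fun_prop) (h2.const_smul η)).prodMk (h1.sub h2)

lemma IsStochasticGradient.isCentered (hG : IsStochasticGradient f G D σ) (x : Vec d) :
    IsCentered (fun θ => G x θ - ∇ f x) D where
  measurable := (hG.measurable.comp measurable_prodMk_left).sub_const _
  integrable := (hG.integrable x).sub (integrable_const _)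
  integral_eq_zero := by
    rw [integral_sub (hG.integrable x) (integrable_const _), hG.unbiased]
    simp
  integrable_sq := hG.integrable_sq x

lemma measurePreserving_sampleLaw_fst :
    MeasurePreserving (fun w : Vec d × Θ × Θ' => (w.1, w.2.1)) (sampleLaw d r D D')
      ((noiseLaw d r).prod D) :=
  (MeasurePreserving.id _).prod measurePreserving_fst

section TwoSources

variable {g : Vec d → Vec d} {ζ : Θ → Vec d}

lemma IsCentered.sample (hg : IsCentered g (noiseLaw d r)) (hζ : IsCentered ζ D) :
    IsCentered (fun w : Vec d × Θ × Θ' => g w.1 + ζ w.2.1) (sampleLaw d r D D') ∧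
      ∫ w, ‖g w.1 + ζ w.2.1‖ ^ 2 ∂(sampleLaw d r D D') =
        ∫ ξ, ‖g ξ‖ ^ 2 ∂(noiseLaw d r) + ∫ θ, ‖ζ θ‖ ^ 2 ∂D := by
  have h := hg.prod_add hζ
  have hmp := measurePreserving_sampleLaw_fst (d := d) (r := r) (D := D) (D' := D')
  refine ⟨IsCentered.comp (u := fun p : Vec d × Θ => g p.1 + ζ p.2)
    (π := fun w : Vec d × Θ × Θ' => (w.1, w.2.1)) hmp h.1, ?_⟩
  rw [← h.2, ← hmp.map_eq, integral_map hmp.measurable.aemeasurable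
    (h.1.measurable.norm.pow_const 2).aestronglyMeasurable]

lemma IsCompressor.sample_error_le (hC : IsCompressor Cmp D' μ)
    (hg : IsCentered g (noiseLaw d r)) (hζ : IsCentered ζ D) (b : Vec d) :
    Integrable (fun w : Vec d × Θ × Θ' => ‖b + (g w.1 + ζ w.2.1) -
        Cmp (b + (g w.1 + ζ w.2.1)) w.2.2‖ ^ 2) (sampleLaw d r D D') ∧
      ∫ w, ‖b + (g w.1 + ζ w.2.1) - Cmp (b + (g w.1 + ζ w.2.1)) w.2.2‖ ^ 2 ∂(sampleLaw d r D D') ≤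
        (1 - μ) * (‖b‖ ^ 2 + (∫ ξ, ‖g ξ‖ ^ 2 ∂(noiseLaw d r) + ∫ θ, ‖ζ θ‖ ^ 2 ∂D)) := by
  have h := hg.prod_add hζ
  have h2 := h.1.integral_norm_add_sq b
  have hY : Measurable (fun p : Vec d × Θ => b + (g p.1 + ζ p.2)) := h.1.measurable.const_add b
  have h3 := hC.integral_error_le hY h2.1
  -- Reassociating the product groups the noise with the stochastic gradient, so that the compressor
  -- acts with independent randomness on a random vector.
  have hmp : MeasurePreserving (MeasurableEquiv.prodAssoc (α := Vec d) (β := Θ) (γ := Θ')).symm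
      (sampleLaw d r D D') (((noiseLaw d r).prod D).prod D') :=
    (measurePreserving_prodAssoc (noiseLaw d r) D D').symm
  have e := hmp.integral_comp' (fun p : (Vec d × Θ) × Θ' => ‖b + (g p.1.1 + ζ p.1.2) -
        Cmp (b + (g p.1.1 + ζ p.1.2)) p.2‖ ^ 2)
  refine ⟨?_, ?_⟩
  · exact (hmp.integrable_comp_emb (MeasurableEquiv.measurableEmbedding _)).2 h3.1
  · rw [h2.2, h.2] at h3
    exact (le_of_eq e).trans h3.2

end TwoSources

end Step

/-! ### Elementary inequalities -/

lemma norm_add_sq_le_young {d : ℕ} {c : ℝ} (hc : 0 < c) (a b : Vec d) :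
    ‖a + b‖ ^ 2 ≤ (1 + c) * ‖a‖ ^ 2 + (1 + 1 / c) * ‖b‖ ^ 2 := by
  have h3 : ‖a + b‖ ^ 2 ≤ (‖a‖ + ‖b‖) ^ 2 := by gcongr; exact norm_add_le a b
  have h4 : 0 ≤ (c * ‖a‖ - ‖b‖) ^ 2 / c := by positivity
  have h5 : (c * ‖a‖ - ‖b‖) ^ 2 / c = c * ‖a‖ ^ 2 - 2 * ‖a‖ * ‖b‖ + 1 / c * ‖b‖ ^ 2 := by
    field_simp
    ring
  linarith

/-- Young's inequality with weight μ/2 spends half of the contraction of the compressor on absorbing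
the new term b. -/
lemma one_sub_mul_norm_add_sq_le {d : ℕ} {μ : ℝ} (hμ : 0 < μ) (hμ1 : μ ≤ 1) (a b : Vec d) :
    (1 - μ) * ‖a + b‖ ^ 2 ≤ (1 - μ / 2) * ‖a‖ ^ 2 + 2 / μ * ‖b‖ ^ 2 := by
  have h1 := norm_add_sq_le_young (half_pos hμ) a b
  have e1 : (1 - μ) * (1 + μ / 2) ≤ 1 - μ / 2 := by nlinarith
  have e2 : (1 - μ) * (1 + 1 / (μ / 2)) ≤ 2 / μ := by
    have : (1 - μ) * (1 + 1 / (μ / 2)) = 2 / μ - 1 - μ := by field_simp; ring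
    linarith
  calc (1 - μ) * ‖a + b‖ ^ 2
      ≤ (1 - μ) * ((1 + μ / 2) * ‖a‖ ^ 2 + (1 + 1 / (μ / 2)) * ‖b‖ ^ 2) :=
        mul_le_mul_of_nonneg_left h1 (by linarith)
    _ = ((1 - μ) * (1 + μ / 2)) * ‖a‖ ^ 2 + ((1 - μ) * (1 + 1 / (μ / 2))) * ‖b‖ ^ 2 := by ring
    _ ≤ _ := by gcongr

lemma pow_one_add_inv_le {I i : ℕ} (hi : i ≤ I) : (1 + 1 / (I : ℝ)) ^ i ≤ 3 := by
  rcases Nat.eq_zero_or_pos I with rfl | hI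
  · obtain rfl : i = 0 := by omega
    norm_num
  have hI' : (0 : ℝ) < I := by exact_mod_cast hI
  calc (1 + 1 / (I : ℝ)) ^ i ≤ (Real.exp (1 / I)) ^ i := by
        gcongr
        rw [add_comm]
        exact Real.add_one_le_exp _
    _ = Real.exp (i / I) := by rw [← Real.exp_nat_mul]; ring_nf
    _ ≤ Real.exp 1 := Real.exp_le_exp.2 ((div_le_one hI').2 (by exact_mod_cast hi))
    _ ≤ 3 := Real.exp_one_lt_d9.le.trans (by norm_num)

/-! ### Recursions of the corrected iterate and of the compression error -/

section StepIdentities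

variable {d : ℕ} {Θ Θ' : Type*} {η : ℝ} {G : Vec d → Θ → Vec d} {Cmp : Vec d → Θ' → Vec d}

/-- The compressed vector is subtracted from x with factor η and from e with factor 1, so it cancels
in x - η e. -/
lemma corrected_sgdStep (f : Vec d → ℝ) (s : Vec d × Vec d) (w : Vec d × Θ × Θ') :
    corrected η (sgdStep η G Cmp s w) =
      corrected η s - η • (∇ f s.1 + (w.1 + (G s.1 w.2.1 - ∇ f s.1))) := by
  simp only [corrected, sgdStep]
  module

lemma sgdStep_snd (f : Vec d → ℝ) (s : Vec d × Vec d) (w : Vec d × Θ × Θ') :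
    (sgdStep η G Cmp s w).2 =
      (s.2 + ∇ f s.1) + (w.1 + (G s.1 w.2.1 - ∇ f s.1)) -
        Cmp ((s.2 + ∇ f s.1) + (w.1 + (G s.1 w.2.1 - ∇ f s.1))) w.2.2 := by
  have : (s.2 + ∇ f s.1) + (w.1 + (G s.1 w.2.1 - ∇ f s.1)) = s.2 + G s.1 w.2.1 + w.1 := by abel
  rw [this]
  rfl

end StepIdentities

/-! ### Energy decrease along the chain -/

section MainChain

variable {d : ℕ} {Θ Θ' : Type*} [MeasurableSpace Θ] [MeasurableSpace Θ']
  {η r σ μ fmax L ρ : ℝ} {D : Measure Θ} {D' : Measure Θ'} [IsProbabilityMeasure D]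
  [IsProbabilityMeasure D'] {f : Vec d → ℝ} {G : Vec d → Θ → Vec d} {Cmp : Vec d → Θ' → Vec d}

lemma isCentered_stepNoise (hd : 1 ≤ d) (hG : IsStochasticGradient f G D σ) (x : Vec d) :
    IsCentered (fun w : Vec d × Θ × Θ' => w.1 + (G x w.2.1 - ∇ f x)) (sampleLaw d r D D') ∧
      ∫ w, ‖w.1 + (G x w.2.1 - ∇ f x)‖ ^ 2 ∂(sampleLaw d r D D') ≤ σ ^ 2 + r ^ 2 := by
  have h := isCentered_id_noiseLaw.sample (r := r) (D' := D') (hG.isCentered x)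
  refine ⟨h.1, ?_⟩
  rw [h.2, integral_sq_norm_noiseLaw hd]
  linarith [hG.variance_le x]

/-- The compression error contracts. -/
lemma integral_sq_norm_sgdStep_snd_le (hd : 1 ≤ d) (hG : IsStochasticGradient f G D σ)
    (hC : IsCompressor Cmp D' μ) (hμ : 0 < μ) (hμ1 : μ ≤ 1) (s : Vec d × Vec d) :
    Integrable (fun w => ‖(sgdStep η G Cmp s w).2‖ ^ 2) (sampleLaw d r D D') ∧
      ∫ w, ‖(sgdStep η G Cmp s w).2‖ ^ 2 ∂(sampleLaw d r D D') ≤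
        (1 - μ / 2) * ‖s.2‖ ^ 2 + 2 / μ * ‖∇ f s.1‖ ^ 2 + (σ ^ 2 + r ^ 2) := by
  have h := hC.sample_error_le (r := r) isCentered_id_noiseLaw (hG.isCentered s.1) (s.2 + ∇ f s.1)
  simp_rw [sgdStep_snd f]
  refine ⟨h.1, h.2.trans ?_⟩
  rw [integral_sq_norm_noiseLaw hd]
  have h6 := hG.variance_le s.1
  have h7 : (1 - μ) * (r ^ 2 + ∫ θ, ‖G s.1 θ - ∇ f s.1‖ ^ 2 ∂D) ≤ σ ^ 2 + r ^ 2 := by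
    have : 0 ≤ ∫ θ, ‖G s.1 θ - ∇ f s.1‖ ^ 2 ∂D := integral_nonneg fun _ => sq_nonneg _
    nlinarith [sq_nonneg r]
  have h8 := one_sub_mul_norm_add_sq_le hμ hμ1 s.2 (∇ f s.1)
  linarith

/-- The decrease of the objective along the corrected iterates. -/
lemma integral_corrected_sgdStep_le (hd : 1 ≤ d) (hf : IsRegularObjective f fmax L ρ)
    (hG : IsStochasticGradient f G D σ) (hCm : Measurable (Function.uncurry Cmp)) (hη : 0 ≤ η)
    (hL : 0 ≤ L) (hηL : η * L ≤ 1 / 2) (s : Vec d × Vec d) :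
    Integrable (fun w => f (corrected η (sgdStep η G Cmp s w))) (sampleLaw d r D D') ∧
      ∫ w, f (corrected η (sgdStep η G Cmp s w)) ∂(sampleLaw d r D D') ≤
        f (corrected η s) - η / 4 * ‖∇ f s.1‖ ^ 2 + η / 2 * L ^ 2 * ‖η • s.2‖ ^ 2 +
          L * η ^ 2 / 2 * (σ ^ 2 + r ^ 2) := by
  obtain ⟨hu, hu2⟩ := isCentered_stepNoise (r := r) (D' := D') hd hG s.1
  have hq := hu.integral_norm_add_sq (∇ f s.1)
  set y := corrected η s with hy
  set u : Vec d × Θ × Θ' → Vec d := fun w => w.1 + (G s.1 w.2.1 - ∇ f s.1) with hudef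
  have hpt : ∀ w, f (corrected η (sgdStep η G Cmp s w)) ≤
      f y - η * (⟪∇ f y, ∇ f s.1⟫ + ⟪∇ f y, u w⟫) + L * η ^ 2 / 2 * ‖∇ f s.1 + u w‖ ^ 2 := by
    intro w
    have h := hf.le_quadratic y (-(η • (∇ f s.1 + u w)))
    rw [corrected_sgdStep f, sub_eq_add_neg]
    rw [inner_neg_right, inner_smul_right, inner_add_right, norm_neg, norm_smul, mul_pow,
      Real.norm_eq_abs, sq_abs] at h
    linarith
  have hmeas : Measurable (fun w => f (corrected η (sgdStep η G Cmp s w))) :=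
    hf.differentiable.continuous.measurable.comp (measurable_corrected.comp
      ((measurable_sgdStep hG.measurable hCm).comp measurable_prodMk_left))
  have hint : Integrable (fun w => f (corrected η (sgdStep η G Cmp s w))) (sampleLaw d r D D') := by
    refine Integrable.of_bound hmeas.aestronglyMeasurable (|f y| + fmax) (.of_forall fun w => ?_)
    have h1 := hf.bounded (corrected η (sgdStep η G Cmp s w)) y
    have h2 := abs_sub_abs_le_abs_sub (f (corrected η (sgdStep η G Cmp s w))) (f y)
    rw [Real.norm_eq_abs]
    linarith
  refine ⟨hint, ?_⟩
  have hin : Integrable (fun w => ⟪∇ f y, u w⟫) (sampleLaw d r D D') :=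
    hu.integrable.const_inner _
  have hi0 : Integrable (fun w => η * (⟪∇ f y, ∇ f s.1⟫ + ⟪∇ f y, u w⟫))
      (sampleLaw d r D D') := ((integrable_const _).add hin).const_mul η
  have hi1 : Integrable (fun w => f y - η * (⟪∇ f y, ∇ f s.1⟫ + ⟪∇ f y, u w⟫))
      (sampleLaw d r D D') := (integrable_const _).sub hi0
  have h1 := integral_mono hint (hi1.add (hq.1.const_mul (L * η ^ 2 / 2))) hpt
  refine h1.trans ?_
  simp only [Pi.add_apply]
  rw [integral_add hi1 (hq.1.const_mul _), integral_sub (integrable_const _) hi0, integral_const_mul, integral_const_mul,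
    integral_add (integrable_const _) hin, integral_inner hu.integrable, hu.integral_eq_zero, hq.2]
  simp only [integral_const, probReal_univ, one_smul, inner_zero_right, add_zero]
  -- Polarisation, dropping ‖∇f(y)‖²; the gradients at y and x differ by at most L ‖η e‖ because y -
  -- x = -η e.
  have h2 : -⟪∇ f y, ∇ f s.1⟫ ≤ -(‖∇ f s.1‖ ^ 2 / 2) + L ^ 2 / 2 * ‖η • s.2‖ ^ 2 := by
    have h3 := norm_sub_sq_real (∇ f y) (∇ f s.1)
    have h4 := hf.smooth y s.1
    have h5 : y - s.1 = -(η • s.2) := by simp [hy, corrected]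
    rw [h5, norm_neg] at h4
    have h6 : ‖∇ f y - ∇ f s.1‖ ^ 2 ≤ (L * ‖η • s.2‖) ^ 2 := by gcongr
    rw [mul_pow] at h6
    nlinarith [sq_nonneg ‖∇ f y‖]
  have h7 : η * -⟪∇ f y, ∇ f s.1⟫ ≤ η * (-(‖∇ f s.1‖ ^ 2 / 2) + L ^ 2 / 2 * ‖η • s.2‖ ^ 2) :=
    mul_le_mul_of_nonneg_left h2 hη
  have h8 : L * η ^ 2 / 2 * ‖∇ f s.1‖ ^ 2 ≤ η / 4 * ‖∇ f s.1‖ ^ 2 := by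
    refine mul_le_mul_of_nonneg_right ?_ (sq_nonneg _)
    nlinarith
  have h9 : L * η ^ 2 / 2 * ∫ w, ‖u w‖ ^ 2 ∂(sampleLaw d r D D') ≤
      L * η ^ 2 / 2 * (σ ^ 2 + r ^ 2) := mul_le_mul_of_nonneg_left hu2 (by positivity)
  linarith

/-- The quantity whose time average controls the failure of stationarity: the squared norm of the
gradient plus the squared norm of the scaled compression error. -/
noncomputable def defect (f : Vec d → ℝ) (η : ℝ) (s : Vec d × Vec d) : ℝ :=
  ‖∇ f s.1‖ ^ 2 + ‖η • s.2‖ ^ 2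

lemma defect_nonneg (s : Vec d × Vec d) : 0 ≤ defect f η s := by
  unfold defect; positivity

lemma measurable_defect (hf : IsRegularObjective f fmax L ρ) : Measurable (defect f η) := by
  have := hf.continuous_gradient
  unfold defect
  fun_prop

/-- The noise floor of the mean defect. -/
noncomputable def noiseFloor (η r σ μ L : ℝ) : ℝ :=
  (L * η / 2 + (L ^ 2 + 1) / μ * η ^ 2) * (σ ^ 2 + r ^ 2)

/-- The chain of the pairs `(x_t, e_t)` started at `(x₀, e₀)`. -/
noncomputable def sgdLaw (η r : ℝ) (G : Vec d → Θ → Vec d) (Cmp : Vec d → Θ' → Vec d)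
    (D : Measure Θ) (D' : Measure Θ') (s : Vec d × Vec d) (t : ℕ) : Measure (Vec d × Vec d) :=
  chainLaw (sgdStep η G Cmp) (sampleLaw d r D D') (Measure.dirac s) t

lemma isProbabilityMeasure_sgdLaw (hG : IsStochasticGradient f G D σ)
    (hC : IsCompressor Cmp D' μ) (s : Vec d × Vec d) (t : ℕ) :
    IsProbabilityMeasure (sgdLaw η r G Cmp D D' s t) :=
  isProbabilityMeasure_chainLaw (measurable_sgdStep hG.measurable hC.measurable) t

/-- The sum of the expected defects is controlled by the range of the objective. -/
theorem sum_integral_defect_le (hd : 1 ≤ d) (hf : IsRegularObjective f fmax L ρ)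
    (hG : IsStochasticGradient f G D σ) (hC : IsCompressor Cmp D' μ) (hη : 0 < η)
    (hL : 0 ≤ L) (hηL : η * L ≤ 1 / 2) (hμ : 0 < μ) (hμ1 : μ ≤ 1)
    (hημ : 16 * η ^ 2 * (L ^ 2 + 1) ≤ μ ^ 2) (x₀ : Vec d) :
    (∀ t, Integrable (defect f η) (sgdLaw η r G Cmp D D' (x₀, 0) t)) ∧
      ∀ T : ℕ, ∑ t ∈ Finset.range T, ∫ s, defect f η s ∂(sgdLaw η r G Cmp D D' (x₀, 0) t) ≤
        8 / η * (fmax + T * (η * noiseFloor η r σ μ L)) := by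
  have hΦ := measurable_sgdStep (η := η) hG.measurable hC.measurable
  -- With this weight the contraction gains bμ/2 = η (L² + 1) / 2, which pays for the error term of
  -- the descent estimate and leaves more than the η/8 needed for the defect.
  set b := η * (L ^ 2 + 1) / μ with hb
  have hb0 : 0 ≤ b := by positivity
  let U : Vec d × Vec d → ℝ := fun s => (f (corrected η s) - f x₀ + fmax) + b * ‖η • s.2‖ ^ 2
  have hfm := hf.differentiable.continuous.measurable
  have hU : Measurable U := by
    have : Measurable (fun s => f (corrected η s)) :=
      hfm.comp (measurable_corrected (η := η) (d := d))
    exact ((this.sub_const _).add_const _).add (by fun_prop)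
  have hU0 : ∀ s, 0 ≤ U s := fun s => by
    have := (abs_le.1 (hf.bounded (corrected η s) x₀)).1
    have : 0 ≤ b * ‖η • s.2‖ ^ 2 := by positivity
    simp only [U]; linarith
  have hstep : ∀ s, Integrable (fun w => U (sgdStep η G Cmp s w)) (sampleLaw d r D D') ∧
      ∫ w, U (sgdStep η G Cmp s w) ∂(sampleLaw d r D D') ≤
        U s - η / 8 * defect f η s + η * noiseFloor η r σ μ L := by
    intro s
    have h1 := integral_corrected_sgdStep_le (r := r) (D' := D') hd hf hG hC.measurable hη.le hL
      hηL s
    have h2 := integral_sq_norm_sgdStep_snd_le (η := η) (r := r) hd hG hC hμ hμ1 s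
    have hn : ∀ e : Vec d, ‖η • e‖ ^ 2 = η ^ 2 * ‖e‖ ^ 2 := fun e => by
      rw [norm_smul, mul_pow, Real.norm_eq_abs, sq_abs]
    have hi2 : Integrable (fun w => b * ‖η • (sgdStep η G Cmp s w).2‖ ^ 2) (sampleLaw d r D D') := by
      simp_rw [hn]
      exact (h2.1.const_mul _).const_mul _
    have hi0 : Integrable (fun w => f (corrected η (sgdStep η G Cmp s w)) - f x₀)
        (sampleLaw d r D D') := h1.1.sub (integrable_const _)
    have hi1 : Integrable (fun w => f (corrected η (sgdStep η G Cmp s w)) - f x₀ + fmax)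
        (sampleLaw d r D D') := hi0.add (integrable_const _)
    refine ⟨hi1.add hi2, ?_⟩
    simp only [U]
    rw [integral_add hi1 hi2, integral_add hi0 (integrable_const _),
      integral_sub h1.1 (integrable_const _)]
    simp only [integral_const, probReal_univ, one_smul, hn, integral_const_mul, defect]
    have h3 := mul_le_mul_of_nonneg_left h2.2 (show 0 ≤ b * η ^ 2 by positivity)
    have h1' := h1.2
    rw [hn] at h1'
    have c1 : η / 2 * L ^ 2 + b * (1 - μ / 2) ≤ b - η / 8 := by
      have : b * (μ / 2) = η * (L ^ 2 + 1) / 2 := by rw [hb]; field_simp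
      linarith
    have c2 : b * η ^ 2 * (2 / μ) ≤ η / 8 := by
      have : b * η ^ 2 * (2 / μ) = η / 8 * (16 * η ^ 2 * (L ^ 2 + 1) / μ ^ 2) := by
        rw [hb]; field_simp; ring
      rw [this]
      exact mul_le_of_le_one_right (by positivity) ((div_le_one (by positivity)).2 hημ)
    have c3 : L * η ^ 2 / 2 * (σ ^ 2 + r ^ 2) + b * η ^ 2 * (σ ^ 2 + r ^ 2) =
        η * noiseFloor η r σ μ L := by
      rw [hb, noiseFloor]; field_simp
    have c1' := mul_le_mul_of_nonneg_right c1 (show 0 ≤ η ^ 2 * ‖s.2‖ ^ 2 by positivity)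
    have c2' := mul_le_mul_of_nonneg_right c2 (show 0 ≤ ‖∇ f s.1‖ ^ 2 by positivity)
    linarith
  have hdm := measurable_defect (η := η) hf
  -- The next expected value of the nonnegative U is nonnegative, so the decrease itself dominates
  -- the defect by U. Integrability of the defect follows from that of U.
  have hν0 : ∀ s, η / 8 * defect f η s ≤ U s + η * noiseFloor η r σ μ L := fun s => by
    have h1 := (hstep s).2
    have h2 : 0 ≤ ∫ w, U (sgdStep η G Cmp s w) ∂(sampleLaw d r D D') :=
      integral_nonneg fun w => hU0 _
    linarith
  have hprob := isProbabilityMeasure_sgdLaw (η := η) (r := r) hG hC (x₀, 0)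
  have hdi : ∀ t, Integrable U (sgdLaw η r G Cmp D D' (x₀, 0) t) →
      Integrable (defect f η) (sgdLaw η r G Cmp D D' (x₀, 0) t) := by
    intro t ht
    have := hprob t
    refine ((ht.add (integrable_const (η * noiseFloor η r σ μ L))).const_mul (8 / η)).mono'
      hdm.aestronglyMeasurable (.of_forall fun s => ?_)
    rw [Real.norm_of_nonneg (defect_nonneg s)]
    have h1 : defect f η s = 8 / η * (η / 8 * defect f η s) := by field_simp
    rw [h1]
    exact mul_le_mul_of_nonneg_left (hν0 s) (by positivity)
  have hmain : ∀ T : ℕ, Integrable U (sgdLaw η r G Cmp D D' (x₀, 0) T) ∧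
      ∫ s, U s ∂(sgdLaw η r G Cmp D D' (x₀, 0) T) + η / 8 *
        ∑ t ∈ Finset.range T, ∫ s, defect f η s ∂(sgdLaw η r G Cmp D D' (x₀, 0) t) ≤
        fmax + T * (η * noiseFloor η r σ μ L) := by
    intro T
    induction T with
    | zero =>
      have h0 : sgdLaw η r G Cmp D D' (x₀, 0) 0 = Measure.dirac (x₀, 0) := rfl
      rw [h0]
      refine ⟨integrable_dirac (by simp), ?_⟩
      rw [integral_dirac]
      simp [U, corrected]
    | succ T ih =>
      obtain ⟨hi, hle⟩ := ih
      have := hprob T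
      have hψ0 : Integrable (fun s => U s - η / 8 * defect f η s)
          (sgdLaw η r G Cmp D D' (x₀, 0) T) := hi.sub ((hdi T hi).const_mul _)
      have hψ : Integrable (fun s => U s - η / 8 * defect f η s + η * noiseFloor η r σ μ L)
          (sgdLaw η r G Cmp D D' (x₀, 0) T) := hψ0.add (integrable_const _)
      have h := integral_map_prod_le hΦ hU hU0 hψ (fun s => (hstep s).1) (fun s => (hstep s).2)
      refine ⟨h.1, ?_⟩
      have h2 := h.2
      rw [integral_add hψ0 (integrable_const _),
        integral_sub hi ((hdi T hi).const_mul _), integral_const_mul] at h2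
      simp only [integral_const, probReal_univ, one_smul] at h2
      change ∫ s, U s ∂(sgdLaw η r G Cmp D D' (x₀, 0) (T + 1)) ≤ _ at h2
      rw [Finset.sum_range_succ, mul_add]
      push_cast
      linarith
  refine ⟨fun t => hdi t (hmain t).1, fun T => ?_⟩
  have h1 := (hmain T).2
  have h2 : 0 ≤ ∫ s, U s ∂(sgdLaw η r G Cmp D D' (x₀, 0) T) := integral_nonneg fun s => hU0 s
  rw [div_mul_eq_mul_div, le_div_iff₀ hη]
  linarith

lemma IsCentered.const_smul {A : Type*} [MeasurableSpace A] {m : Measure A} {u : A → Vec d}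
    (hu : IsCentered u m) (c : ℝ) : IsCentered (fun a => c • u a) m where
  measurable := hu.measurable.const_smul c
  integrable := hu.integrable.smul c
  integral_eq_zero := by rw [integral_smul, hu.integral_eq_zero, smul_zero]
  integrable_sq := by
    simp_rw [norm_smul, mul_pow]
    exact hu.integrable_sq.const_mul _

lemma norm_smul_sq (c : ℝ) (u : Vec d) : ‖c • u‖ ^ 2 = c ^ 2 * ‖u‖ ^ 2 := by
  rw [norm_smul, mul_pow, Real.norm_eq_abs, sq_abs]

lemma integrable_sq_norm_gradient {m : Measure (Vec d × Vec d)} [IsFiniteMeasure m]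
    (hf : IsRegularObjective f fmax L ρ) (hL : 0 < L) :
    Integrable (fun s => ‖∇ f s.1‖ ^ 2) m := by
  have := hf.continuous_gradient
  refine Integrable.of_bound (by fun_prop) (2 * L * fmax) (.of_forall fun s => ?_)
  rw [Real.norm_of_nonneg (sq_nonneg _)]
  exact hf.norm_gradient_sq_le hL s.1

lemma integrable_sq_norm_snd_sgdLaw (hd : 1 ≤ d) (hf : IsRegularObjective f fmax L ρ) (hL : 0 < L)
    (hG : IsStochasticGradient f G D σ) (hC : IsCompressor Cmp D' μ) (hμ : 0 < μ) (hμ1 : μ ≤ 1)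
    (s₀ : Vec d × Vec d) (t : ℕ) :
    Integrable (fun s => ‖s.2‖ ^ 2) (sgdLaw η r G Cmp D D' s₀ t) := by
  induction t with
  | zero => exact integrable_dirac (by simp)
  | succ t ih =>
    have := isProbabilityMeasure_sgdLaw (η := η) (r := r) hG hC s₀ t
    have hψ : Integrable (fun s => (1 - μ / 2) * ‖s.2‖ ^ 2 + 2 / μ * ‖∇ f s.1‖ ^ 2 +
        (σ ^ 2 + r ^ 2)) (sgdLaw η r G Cmp D D' s₀ t) :=
      ((ih.const_mul _).add ((integrable_sq_norm_gradient hf hL).const_mul _)).add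
        (integrable_const _)
    exact (integral_map_prod_le (measurable_sgdStep hG.measurable hC.measurable)
      (by fun_prop) (fun s => sq_nonneg _) hψ
      (fun s => (integral_sq_norm_sgdStep_snd_le hd hG hC hμ hμ1 s).1)
      (fun s => (integral_sq_norm_sgdStep_snd_le hd hG hC hμ hμ1 s).2)).1

lemma integrable_defect_sgdLaw (hd : 1 ≤ d) (hf : IsRegularObjective f fmax L ρ) (hL : 0 < L)
    (hG : IsStochasticGradient f G D σ) (hC : IsCompressor Cmp D' μ) (hμ : 0 < μ) (hμ1 : μ ≤ 1)
    (s₀ : Vec d × Vec d) (t : ℕ) :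
    Integrable (defect f η) (sgdLaw η r G Cmp D D' s₀ t) := by
  have := isProbabilityMeasure_sgdLaw (η := η) (r := r) hG hC s₀ t
  have h := integrable_sq_norm_snd_sgdLaw (η := η) (r := r) hd hf hL hG hC hμ hμ1 s₀ t
  refine (integrable_sq_norm_gradient hf hL).add ?_
  simp_rw [norm_smul_sq]
  exact h.const_mul _

/-- The corrected iterates stay close to their starting point as long as the gradients are small. -/
lemma integral_sq_dist_corrected_le (hd : 1 ≤ d) (hf : IsRegularObjective f fmax L ρ) (hL : 0 < L)
    (hG : IsStochasticGradient f G D σ) (hC : IsCompressor Cmp D' μ)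
    (s₀ : Vec d × Vec d) {I : ℕ} (hI : 0 < I) {i : ℕ} (hi : i ≤ I) :
    Integrable (fun s => ‖corrected η s - corrected η s₀‖ ^ 2) (sgdLaw η r G Cmp D D' s₀ i) ∧
      ∫ s, ‖corrected η s - corrected η s₀‖ ^ 2 ∂(sgdLaw η r G Cmp D D' s₀ i) ≤
        3 * (2 * I * η ^ 2 * ∑ j ∈ Finset.range I,
          ∫ s, ‖∇ f s.1‖ ^ 2 ∂(sgdLaw η r G Cmp D D' s₀ j) + I * η ^ 2 * (σ ^ 2 + r ^ 2)) := by
  have hI0 : (0 : ℝ) < I := by exact_mod_cast hI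
  have hI1 : (1 : ℝ) ≤ I := by exact_mod_cast hI
  set z := corrected η s₀ with hz
  set g : ℕ → ℝ := fun j => ∫ s, ‖∇ f s.1‖ ^ 2 ∂(sgdLaw η r G Cmp D D' s₀ j) with hg
  have hg0 : ∀ j, 0 ≤ g j := fun j => integral_nonneg fun _ => sq_nonneg _
  have hΦ := measurable_sgdStep (η := η) hG.measurable hC.measurable
  have hφ : Measurable (fun s : Vec d × Vec d => ‖corrected η s - z‖ ^ 2) :=
    ((measurable_corrected.sub_const _).norm.pow_const 2)
  have hstep : ∀ s, Integrable (fun w => ‖corrected η (sgdStep η G Cmp s w) - z‖ ^ 2)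
      (sampleLaw d r D D') ∧
      ∫ w, ‖corrected η (sgdStep η G Cmp s w) - z‖ ^ 2 ∂(sampleLaw d r D D') ≤
        (1 + 1 / I) * ‖corrected η s - z‖ ^ 2 + (1 + I) * η ^ 2 * ‖∇ f s.1‖ ^ 2 +
          η ^ 2 * (σ ^ 2 + r ^ 2) := by
    intro s
    obtain ⟨hu, hu2⟩ := isCentered_stepNoise (r := r) (D' := D') hd hG s.1
    have h := (hu.const_smul (-η)).integral_norm_add_sq (corrected η s - z + -η • ∇ f s.1)
    have e : ∀ w : Vec d × Θ × Θ', corrected η (sgdStep η G Cmp s w) - z =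
        corrected η s - z + -η • ∇ f s.1 + -η • (w.1 + (G s.1 w.2.1 - ∇ f s.1)) := by
      intro w
      rw [corrected_sgdStep f]
      module
    simp_rw [e]
    refine ⟨h.1, ?_⟩
    rw [h.2]
    simp_rw [norm_smul_sq]
    rw [integral_const_mul]
    -- The weight 1/I makes the growth over I steps at most (1 + 1/I)^I ≤ 3.
    have h1 := norm_add_sq_le_young (c := 1 / (I : ℝ)) (by positivity) (corrected η s - z)
      (-η • ∇ f s.1)
    rw [one_div_one_div, norm_smul_sq] at h1
    have h2 := mul_le_mul_of_nonneg_left hu2 (sq_nonneg (-η))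
    rw [neg_sq] at h1 h2 ⊢
    linarith
  have hmain : ∀ i : ℕ, Integrable (fun s => ‖corrected η s - z‖ ^ 2) (sgdLaw η r G Cmp D D' s₀ i) ∧
      ∫ s, ‖corrected η s - z‖ ^ 2 ∂(sgdLaw η r G Cmp D D' s₀ i) ≤ (1 + 1 / (I : ℝ)) ^ i *
        ((1 + I) * η ^ 2 * ∑ j ∈ Finset.range i, g j + i * η ^ 2 * (σ ^ 2 + r ^ 2)) := by
    intro i
    induction i with
    | zero =>
      have h0 : sgdLaw η r G Cmp D D' s₀ 0 = Measure.dirac s₀ := rfl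
      rw [h0]
      refine ⟨integrable_dirac (by simp), ?_⟩
      rw [integral_dirac]
      simp [hz]
    | succ i ih =>
      have := isProbabilityMeasure_sgdLaw (η := η) (r := r) hG hC s₀ i
      have hgi : Integrable (fun s => ‖∇ f s.1‖ ^ 2) (sgdLaw η r G Cmp D D' s₀ i) :=
        integrable_sq_norm_gradient hf hL
      have hψ0 : Integrable (fun s => (1 + 1 / (I : ℝ)) * ‖corrected η s - z‖ ^ 2 +
          (1 + I) * η ^ 2 * ‖∇ f s.1‖ ^ 2) (sgdLaw η r G Cmp D D' s₀ i) :=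
        (ih.1.const_mul _).add (hgi.const_mul _)
      have h := integral_map_prod_le hΦ hφ (fun s => sq_nonneg _)
        (hψ0.add (integrable_const (η ^ 2 * (σ ^ 2 + r ^ 2))))
        (fun s => (hstep s).1) (fun s => (hstep s).2)
      refine ⟨h.1, h.2.trans ?_⟩
      simp only [Pi.add_apply]
      rw [integral_add hψ0 (integrable_const _), integral_add (ih.1.const_mul _) (hgi.const_mul _),
        integral_const_mul, integral_const_mul, integral_const, probReal_univ, one_smul,
        Finset.sum_range_succ, pow_succ (1 + 1 / (I : ℝ)) i]
      have h1 := mul_le_mul_of_nonneg_left ih.2 (show (0 : ℝ) ≤ 1 + 1 / I by positivity)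
      have h2 : (1 : ℝ) ≤ (1 + 1 / (I : ℝ)) ^ i * (1 + 1 / I) := by
        rw [← pow_succ]
        exact one_le_pow₀ (le_add_of_nonneg_right (by positivity))
      have h3 : 0 ≤ (1 + I) * η ^ 2 * g i + η ^ 2 * (σ ^ 2 + r ^ 2) := by
        have := hg0 i
        positivity
      have h4 := mul_le_mul_of_nonneg_right h2 h3
      push_cast
      change _ + (1 + I) * η ^ 2 * g i + _ ≤ _
      generalize 1 + 1 / (I : ℝ) = κ at h1 h4 ⊢
      linarith
  refine ⟨(hmain i).1, (hmain i).2.trans ?_⟩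
  have hsum : ∑ j ∈ Finset.range i, g j ≤ ∑ j ∈ Finset.range I, g j :=
    Finset.sum_le_sum_of_subset_of_nonneg (Finset.range_mono hi) fun j _ _ => hg0 j
  have hsum0 : 0 ≤ ∑ j ∈ Finset.range i, g j := Finset.sum_nonneg fun j _ => hg0 j
  have hiI : (i : ℝ) ≤ I := by exact_mod_cast hi
  refine mul_le_mul (pow_one_add_inv_le hi) ?_ (by positivity) (by norm_num)
  gcongr
  linarith

end MainChain

/-- The deterministic inequality behind the one-step estimate of the coupled chains. -/
lemma gap_energy_scalar {u n e K X A q s μ lam j : ℝ} (hu : 0 ≤ u) (he : 0 ≤ e)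
    (hK : 0 ≤ K) (hX0 : 0 ≤ X) (hA0 : 0 ≤ A) (hq : 1 ≤ q) (hs : 0 < s) (hs1 : s ≤ 1) (hμ : 0 < μ)
    (hμ1 : μ ≤ 1) (hlam0 : 0 ≤ lam) (hj0 : 0 ≤ j) (hlam : 30000 * lam ^ 2 ≤ s * μ)
    (hj : 120000 * j ≤ s) (hX : X ≤ u + n + e) (hA : A ≤ q * u + lam * e + K * X) :
    Real.exp (-(350 * K)) * (A ^ 2 + 1 / 5000 * ((1 - μ / 2) * e ^ 2 + 2 / μ * lam ^ 2 * X ^ 2 +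
      q ^ 2 * n ^ 2) + (1 + 1 / 5000) * j * X ^ 2) ≤
      (1 + s) * q ^ 2 * (u ^ 2 + 1 / 5000 * (e ^ 2 + n ^ 2)) := by
  set p := q * u + lam * e with hp
  set W := u ^ 2 + 1 / 5000 * (e ^ 2 + n ^ 2) with hW
  set Γ := p ^ 2 + 1 / 5000 * ((1 - μ / 2) * e ^ 2 + q ^ 2 * n ^ 2) with hΓ
  have hW0 : 0 ≤ W := by positivity
  have hq2 : 1 ≤ q ^ 2 := one_le_pow₀ hq
  have hle : 0 ≤ lam * e := mul_nonneg hlam0 he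
  have hup : u ≤ p := by
    have : u ≤ q * u := le_mul_of_one_le_left hu hq
    linarith
  have hp0 : 0 ≤ p := hu.trans hup
  have hup2 : u ^ 2 ≤ p ^ 2 := pow_le_pow_left₀ hu hup 2
  have hqn : n ^ 2 ≤ q ^ 2 * n ^ 2 := le_mul_of_one_le_left (sq_nonneg n) hq2
  have hme : e ^ 2 / 2 ≤ (1 - μ / 2) * e ^ 2 := by
    have := mul_nonneg (sub_nonneg.2 hμ1) (sq_nonneg e)
    linarith
  have hX2 : X ^ 2 ≤ 3 * (u ^ 2 + n ^ 2 + e ^ 2) := by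
    have h1 : X ^ 2 ≤ (u + n + e) ^ 2 := pow_le_pow_left₀ hX0 hX 2
    linarith [sq_nonneg (u - n), sq_nonneg (u - e), sq_nonneg (n - e)]
  -- Here p is the linear part of the bound for A, and Γ the energy with A replaced by p. The
  -- constant is 3 · 5000 · 2: three summands in X, the weight 1/5000, and the factor 1 - μ/2 ≥ 1/2.
  have hXΓ : X ^ 2 ≤ 30000 * Γ := by
    have := sq_nonneg p
    have := sq_nonneg n
    linarith
  have hΓ0 : 0 ≤ Γ := by linarith [sq_nonneg X]
  have hpΓ : p ^ 2 ≤ Γ := by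
    have := sq_nonneg e
    have := sq_nonneg n
    linarith
  have hXW : X ^ 2 ≤ 15000 * W := by
    have := sq_nonneg u
    linarith
  -- 175² exceeds 30000. The drift thus multiplies the energy by at most (1 + 175 K)² ≤ exp(350 K),
  -- which is the origin of the exponent 350 in `gapEnergy`.
  have hpX : p * X ≤ 175 * Γ := by
    refine abs_le_of_sq_le_sq' ?_ (by positivity) |>.2
    rw [mul_pow]
    calc p ^ 2 * X ^ 2 ≤ Γ * (30000 * Γ) := mul_le_mul hpΓ hXΓ (sq_nonneg _) hΓ0
      _ ≤ (175 * Γ) ^ 2 := by linarith [sq_nonneg Γ]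
  have hmain : A ^ 2 + 1 / 5000 * ((1 - μ / 2) * e ^ 2 + q ^ 2 * n ^ 2) ≤ (1 + 175 * K) ^ 2 * Γ := by
    have h1 : A ^ 2 ≤ (p + K * X) ^ 2 := pow_le_pow_left₀ hA0 hA 2
    have h2 : K * (p * X) ≤ K * (175 * Γ) := mul_le_mul_of_nonneg_left hpX hK
    have h3 : K ^ 2 * X ^ 2 ≤ K ^ 2 * (30000 * Γ) := mul_le_mul_of_nonneg_left hXΓ (sq_nonneg K)
    have h4 : 0 ≤ K ^ 2 * Γ := by positivity
    linarith
  have hexp : Real.exp (-(350 * K)) * (1 + 175 * K) ^ 2 ≤ 1 := by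
    have h1 : (1 + 175 * K) ^ 2 ≤ Real.exp (350 * K) := by
      calc (1 + 175 * K) ^ 2 ≤ Real.exp (175 * K) ^ 2 := by
            gcongr
            rw [add_comm]
            exact Real.add_one_le_exp _
        _ = Real.exp (350 * K) := by rw [← Real.exp_nat_mul]; ring_nf
    rw [Real.exp_neg, inv_mul_le_iff₀ (Real.exp_pos _), mul_one]
    exact h1
  have hexp1 : Real.exp (-(350 * K)) ≤ 1 := Real.exp_le_one_iff.2 (by linarith)
  have hexp0 := Real.exp_pos (-(350 * K))
  have hpart1 : Real.exp (-(350 * K)) *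
      (A ^ 2 + 1 / 5000 * ((1 - μ / 2) * e ^ 2 + q ^ 2 * n ^ 2)) ≤ Γ := by
    calc _ ≤ Real.exp (-(350 * K)) * ((1 + 175 * K) ^ 2 * Γ) :=
          mul_le_mul_of_nonneg_left hmain hexp0.le
      _ = (Real.exp (-(350 * K)) * (1 + 175 * K) ^ 2) * Γ := by ring
      _ ≤ Γ := mul_le_of_le_one_left hΓ0 hexp
  have hlμ : lam ^ 2 / μ ≤ s / 30000 := by
    rw [div_le_div_iff₀ hμ (by norm_num)]
    linarith
  have hpart2 : Real.exp (-(350 * K)) *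
      (1 / 5000 * (2 / μ * lam ^ 2 * X ^ 2) + (1 + 1 / 5000) * j * X ^ 2) ≤ s / 2 * W := by
    have h0 : 0 ≤ 1 / 5000 * (2 / μ * lam ^ 2 * X ^ 2) + (1 + 1 / 5000) * j * X ^ 2 := by
      positivity
    refine (mul_le_of_le_one_left h0 hexp1).trans ?_
    have h1 : lam ^ 2 / μ * X ^ 2 ≤ s / 30000 * (15000 * W) :=
      mul_le_mul hlμ hXW (sq_nonneg _) (by positivity)
    have h2 : j * X ^ 2 ≤ s / 120000 * (15000 * W) :=
      mul_le_mul (by linarith) hXW (sq_nonneg _) (by positivity)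
    have h3 : 2 / μ * lam ^ 2 * X ^ 2 = 2 * (lam ^ 2 / μ * X ^ 2) := by ring
    have h4 : 0 ≤ s * W := by positivity
    rw [h3]
    linarith
  have hΓW : Γ ≤ (1 + s / 2) * q ^ 2 * W := by
    -- Young's inequality with weight s/2. The large factor 1 + 2/s falls on lam² e², which the
    -- smallness of lam² relative to sμ lets the lost contraction μ/2 of e² absorb.
    have h1 : p ^ 2 ≤ (1 + s / 2) * (q ^ 2 * u ^ 2) + (1 + 2 / s) * (lam ^ 2 * e ^ 2) := by
      have h2 : 0 ≤ (s * (q * u) - 2 * (lam * e)) ^ 2 / (2 * s) := by positivity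
      have h3 : (s * (q * u) - 2 * (lam * e)) ^ 2 / (2 * s) =
          s / 2 * (q * u) ^ 2 - 2 * (q * u) * (lam * e) + 2 / s * (lam * e) ^ 2 := by
        field_simp
        ring
      have h4 : p ^ 2 = (q * u) ^ 2 + 2 * (q * u) * (lam * e) + (lam * e) ^ 2 := by
        rw [hp]; ring
      rw [mul_pow, mul_pow] at *
      linarith
    have h2 : (1 + 2 / s) * lam ^ 2 ≤ μ / 10000 := by
      have h3 : (1 + 2 / s) ≤ 3 / s := by
        rw [le_div_iff₀ hs, add_mul, div_mul_cancel₀ _ hs.ne']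
        linarith
      calc (1 + 2 / s) * lam ^ 2 ≤ 3 / s * (s * μ / 30000) :=
            mul_le_mul h3 (by linarith) (sq_nonneg _) (by positivity)
        _ = μ / 10000 := by field_simp; norm_num
    have h3 := mul_le_mul_of_nonneg_right h2 (sq_nonneg e)
    have h4 : e ^ 2 ≤ (1 + s / 2) * q ^ 2 * e ^ 2 :=
      le_mul_of_one_le_left (sq_nonneg e) (one_le_mul_of_one_le_of_one_le (by linarith) hq2)
    have h5 : q ^ 2 * n ^ 2 ≤ (1 + s / 2) * (q ^ 2 * n ^ 2) :=
      le_mul_of_one_le_left (by positivity) (by linarith)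
    rw [hW, hΓ]
    linarith
  have hfin : (1 + s / 2) * q ^ 2 * W + s / 2 * W ≤ (1 + s) * q ^ 2 * W := by
    have : W ≤ q ^ 2 * W := le_mul_of_one_le_left hW0 hq2
    have := mul_le_mul_of_nonneg_left this (half_pos hs).le
    linarith
  linarith

/-! ### The reflection coupling -/

section Coupling

variable {d : ℕ} {Θ Θ' : Type*}

/-- The state `((x, e), (x', e'), N, P)` of two coupled copies of the chain: `N` is the component
of their distance created by the noise alone, `P` accumulates the distances to the reference
point. -/
abbrev CoupledState (d : ℕ) : Type := (Vec d × Vec d) × (Vec d × Vec d) × ℝ × ℝ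

/-- The distance of both chains to the reference point `z`, in the scale of the curvature. -/
noncomputable def drift (η ρ : ℝ) (z : Vec d) (S : CoupledState d) : ℝ :=
  η * ρ * (‖S.1.1 - z‖ + ‖S.2.1.1 - z‖)

/-- One step of the coupled chains: the second one receives the noise reflected along `v`. -/
noncomputable def coupledStep (η γ ρ : ℝ) (v z : Vec d) (G : Vec d → Θ → Vec d)
    (Cmp : Vec d → Θ' → Vec d) (S : CoupledState d) (w : Vec d × Θ × Θ') : CoupledState d :=
  (sgdStep η G Cmp S.1 w, sgdStep η G Cmp S.2.1 (hyperplaneReflection v w.1, w.2),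
    (1 + η * γ) * S.2.2.1 - 2 * η * ⟪v, w.1⟫, |S.2.2.2| + drift η ρ z S)

/-- The part of the distance of the corrected iterates that is not created by the noise alone. -/
noncomputable def gapRemainder (η : ℝ) (v : Vec d) (S : CoupledState d) : Vec d :=
  corrected η S.1 - corrected η S.2.1 - S.2.2.1 • v

/-- The energy of the coupled chains. -/
noncomputable def gapEnergy (η : ℝ) (v : Vec d) (S : CoupledState d) : ℝ :=
  Real.exp (-(350 * |S.2.2.2|)) * (‖gapRemainder η v S‖ ^ 2 +
    1 / 5000 * (‖η • (S.1.2 - S.2.1.2)‖ ^ 2 + S.2.2.1 ^ 2))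

variable {η γ ρ : ℝ} {v z : Vec d} {G : Vec d → Θ → Vec d} {Cmp : Vec d → Θ' → Vec d}

lemma drift_nonneg (hη : 0 ≤ η) (hρ : 0 ≤ ρ) (S : CoupledState d) : 0 ≤ drift η ρ z S := by
  unfold drift; positivity

lemma gapEnergy_nonneg (S : CoupledState d) : 0 ≤ gapEnergy η v S := by
  unfold gapEnergy; positivity

/-- The two noises differ by 2⟪v, ξ⟫ v, exactly what the recursion of N removes. So the artificial
noise disappears from the remainder, and only the difference of the stochastic gradient errors at
the two points is left as a random term. -/
lemma gapRemainder_coupledStep (f : Vec d → ℝ) (S : CoupledState d) (w : Vec d × Θ × Θ') :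
    gapRemainder η v (coupledStep η γ ρ v z G Cmp S w) =
      (corrected η S.1 - corrected η S.2.1 - η • (∇ f S.1.1 - ∇ f S.2.1.1) -
        ((1 + η * γ) * S.2.2.1) • v) +
      -η • ((G S.1.1 w.2.1 - ∇ f S.1.1) - (G S.2.1.1 w.2.1 - ∇ f S.2.1.1)) := by
  simp only [gapRemainder, coupledStep, corrected_sgdStep f, hyperplaneReflection]
  module

/-- The two copies share the randomness of the linear compressor, so the difference of the
compressed vectors is the compression of the difference, and the error gap is again a compression
error. -/
lemma errorGap_coupledStep (hC : IsLinearCompressor Cmp) (f : Vec d → ℝ) (S : CoupledState d)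
    (w : Vec d × Θ × Θ') :
    (coupledStep η γ ρ v z G Cmp S w).1.2 - (coupledStep η γ ρ v z G Cmp S w).2.1.2 =
      (S.1.2 - S.2.1.2 + (∇ f S.1.1 - ∇ f S.2.1.1)) + ((2 * ⟪v, w.1⟫) • v +
        ((G S.1.1 w.2.1 - ∇ f S.1.1) - (G S.2.1.1 w.2.1 - ∇ f S.2.1.1))) -
      Cmp ((S.1.2 - S.2.1.2 + (∇ f S.1.1 - ∇ f S.2.1.1)) + ((2 * ⟪v, w.1⟫) • v +
        ((G S.1.1 w.2.1 - ∇ f S.1.1) - (G S.2.1.1 w.2.1 - ∇ f S.2.1.1)))) w.2.2 := by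
  have e : (S.1.2 - S.2.1.2 + (∇ f S.1.1 - ∇ f S.2.1.1)) + ((2 * ⟪v, w.1⟫) • v +
        ((G S.1.1 w.2.1 - ∇ f S.1.1) - (G S.2.1.1 w.2.1 - ∇ f S.2.1.1))) =
      (S.1.2 + G S.1.1 w.2.1 + w.1) - (S.2.1.2 + G S.2.1.1 w.2.1 + hyperplaneReflection v w.1) := by
    simp only [hyperplaneReflection]
    module
  rw [e, (hC w.2.2).map_sub]
  simp only [coupledStep, sgdStep]
  abel

lemma measurable_coupledStep [MeasurableSpace Θ] [MeasurableSpace Θ']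
    (hG : Measurable (Function.uncurry G)) (hC : Measurable (Function.uncurry Cmp)) :
    Measurable (Function.uncurry (coupledStep η γ ρ v z G Cmp)) := by
  have h := measurable_sgdStep (η := η) hG hC
  have h1 : Measurable (fun p : CoupledState d × (Vec d × Θ × Θ') => sgdStep η G Cmp p.1.1 p.2) :=
    h.comp (g := Function.uncurry (sgdStep η G Cmp))
      (f := fun p : CoupledState d × (Vec d × Θ × Θ') => (p.1.1, p.2)) (by fun_prop)
  have h2 : Measurable (fun p : CoupledState d × (Vec d × Θ × Θ') =>
      sgdStep η G Cmp p.1.2.1 (hyperplaneReflection v p.2.1, p.2.2)) := by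
    refine h.comp (g := Function.uncurry (sgdStep η G Cmp))
      (f := fun p : CoupledState d × (Vec d × Θ × Θ') =>
        (p.1.2.1, (hyperplaneReflection v p.2.1, p.2.2))) ?_
    unfold hyperplaneReflection
    fun_prop
  refine h1.prodMk (h2.prodMk (Measurable.prodMk (by fun_prop) ?_))
  have h3 : Measurable (fun p : CoupledState d × (Vec d × Θ × Θ') => |p.1.2.2.2|) :=
    measurable_norm.comp (f := fun p : CoupledState d × (Vec d × Θ × Θ') => p.1.2.2.2) (by fun_prop)
  unfold drift
  fun_prop

lemma measurable_gapEnergy : Measurable (gapEnergy (d := d) η v) := by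
  have h3 : Measurable (fun S : CoupledState d => |S.2.2.2|) :=
    measurable_norm.comp (f := fun S : CoupledState d => S.2.2.2) (by fun_prop)
  unfold gapEnergy gapRemainder corrected
  fun_prop

end Coupling

/-! ### One-step growth of the coupling energy -/

section GapEnergy

variable {d : ℕ} {Θ Θ' : Type*} [MeasurableSpace Θ] [MeasurableSpace Θ']
  {η γ r σ μ fmax L ρ a b s : ℝ} {v z : Vec d} {D : Measure Θ} {D' : Measure Θ'}
  [IsProbabilityMeasure D] [IsProbabilityMeasure D'] {f : Vec d → ℝ} {G : Vec d → Θ → Vec d}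
  {Cmp : Vec d → Θ' → Vec d}

lemma isCentered_directional {v : Vec d} (hv : ‖v‖ = 1) :
    IsCentered (fun ξ : Vec d => (2 * ⟪v, ξ⟫) • v) (noiseLaw d r) ∧
      ∫ ξ, ‖(2 * ⟪v, ξ⟫) • v‖ ^ 2 ∂(noiseLaw d r) = 4 * (r ^ 2 / d) := by
  have hn : ∀ ξ : Vec d, ‖(2 * ⟪v, ξ⟫) • v‖ ^ 2 = 4 * ⟪v, ξ⟫ ^ 2 := fun ξ => by
    rw [norm_smul_sq, hv]; ring
  have hin : Integrable (fun ξ => ⟪v, ξ⟫) (noiseLaw d r) :=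
    integrable_id_noiseLaw.const_inner v
  refine ⟨⟨by fun_prop, (hin.const_mul 2).smul_const v, ?_, ?_⟩, ?_⟩
  · rw [integral_smul_const, integral_const_mul, integral_inner integrable_id_noiseLaw,
      integral_id_noiseLaw, inner_zero_right, mul_zero, zero_smul]
  · simp_rw [hn]
    refine (integrable_sq_norm_noiseLaw.mono' (by fun_prop) (.of_forall fun ξ => ?_)).const_mul 4
    rw [Real.norm_of_nonneg (sq_nonneg _), ← sq_abs]
    have h := abs_real_inner_le_norm v ξ
    rw [hv, one_mul] at h
    gcongr
  · simp_rw [hn]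
    rw [integral_const_mul, integral_inner_sq_noiseLaw hv]

lemma IsCentered.integral_norm_add_smul_comp_sq {A B : Type*} [MeasurableSpace A]
    [MeasurableSpace B] {m : Measure A} {m' : Measure B} [IsProbabilityMeasure m'] {u : A → Vec d}
    (hu : IsCentered u m) {π : B → A} (hπ : MeasurePreserving π m' m) (c : ℝ) (x : Vec d) :
    Integrable (fun p => ‖x + c • u (π p)‖ ^ 2) m' ∧
      ∫ p, ‖x + c • u (π p)‖ ^ 2 ∂m' = ‖x‖ ^ 2 + c ^ 2 * ∫ p, ‖u p‖ ^ 2 ∂m := by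
  have h := ((hu.comp hπ).const_smul c).integral_norm_add_sq x
  refine ⟨h.1, h.2.trans ?_⟩
  simp_rw [norm_smul_sq]
  rw [integral_const_mul, ← hπ.map_eq, integral_map hπ.measurable.aemeasurable
    (hu.measurable.norm.pow_const 2).aestronglyMeasurable]

/-- The gradient difference is replaced by the Hessian at z applied to x - x' = R + N v + η E, at
the cost of the drift term. The Hessian acts on N v exactly through the eigenvalue, which cancels
the recursion of N; on R it is bounded by `hop`, on η E by L. -/
lemma norm_gapRemainder_drift_le (hf : IsRegularObjective f fmax L ρ) (hL : 0 ≤ L) (hρ : 0 ≤ ρ)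
    (hη : 0 ≤ η) (hHv : hessian f z v = -γ • v)
    (hop : ∀ u, ‖u - η • hessian f z u‖ ≤ (1 + η * γ) * ‖u‖) (S : CoupledState d) :
    ‖corrected η S.1 - corrected η S.2.1 - η • (∇ f S.1.1 - ∇ f S.2.1.1) -
        ((1 + η * γ) * S.2.2.1) • v‖ ≤
      (1 + η * γ) * ‖gapRemainder η v S‖ + η * L * ‖η • (S.1.2 - S.2.1.2)‖ +
        drift η ρ z S * ‖S.1.1 - S.2.1.1‖ := by
  set H := hessian f z with hH
  set R := gapRemainder η v S with hR
  set E := S.1.2 - S.2.1.2 with hE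
  set h := ∇ f S.1.1 - ∇ f S.2.1.1 with hh
  set N := S.2.2.1
  have hΔ : corrected η S.1 - corrected η S.2.1 = R + N • v := by
    simp only [hR, gapRemainder]; abel
  have hX : S.1.1 - S.2.1.1 = R + N • v + η • E := by
    rw [← hΔ, hE]
    simp only [corrected]
    module
  have hHX : H (S.1.1 - S.2.1.1) = H R + N • (-γ • v) + H (η • E) := by
    rw [hX, map_add, map_add, map_smul, hHv]
  have key : corrected η S.1 - corrected η S.2.1 - η • h - ((1 + η * γ) * N) • v =
      (R - η • H R) - η • H (η • E) - η • (h - H (S.1.1 - S.2.1.1)) := by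
    rw [hHX, hΔ]
    module
  rw [key]
  have h1 := hop R
  have h2 : ‖η • H (η • E)‖ ≤ η * L * ‖η • E‖ := by
    rw [norm_smul, Real.norm_of_nonneg hη, mul_assoc]
    exact mul_le_mul_of_nonneg_left (hf.norm_hessian_apply_le hL z _) hη
  have h3 : ‖η • (h - H (S.1.1 - S.2.1.1))‖ ≤ drift η ρ z S * ‖S.1.1 - S.2.1.1‖ := by
    rw [norm_smul, Real.norm_of_nonneg hη]
    have := mul_le_mul_of_nonneg_left (hf.norm_gradient_sub_hessian_le hρ z S.1.1 S.2.1.1) hη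
    refine this.trans (le_of_eq ?_)
    rw [drift]; ring
  have h4 := norm_sub_le (R - η • H R - η • H (η • E)) (η • (h - H (S.1.1 - S.2.1.1)))
  have h5 := norm_sub_le (R - η • H R) (η • H (η • E))
  linarith

lemma integral_nested_add {A : Type*} [MeasurableSpace A] {m : Measure A} {u₁ u₂ u₃ : A → ℝ}
    (h₁ : Integrable u₁ m) (h₂ : Integrable u₂ m) (h₃ : Integrable u₃ m) (x y : ℝ) :
    Integrable (fun w => u₁ w + x * (y * u₂ w + u₃ w)) m ∧
      ∫ w, (u₁ w + x * (y * u₂ w + u₃ w)) ∂m =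
        ∫ w, u₁ w ∂m + x * (y * ∫ w, u₂ w ∂m + ∫ w, u₃ w ∂m) := by
  have h23 : Integrable (fun w => y * u₂ w + u₃ w) m := (h₂.const_mul y).add h₃
  refine ⟨h₁.add (h23.const_mul x), ?_⟩
  rw [integral_add h₁ (h23.const_mul x), integral_const_mul, integral_add (h₂.const_mul y) h₃,
    integral_const_mul]

/-- The one-step estimate of the energy of the coupled chains. -/
lemma integral_gapEnergy_coupledStep_le (hf : IsRegularObjective f fmax L ρ) (hL : 0 ≤ L)
    (hρ : 0 ≤ ρ) (hG : IsStochasticGradient f G D σ) (hC : IsCompressor Cmp D' μ)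
    (hlin : IsLinearCompressor Cmp) (hμ : 0 < μ) (hμ1 : μ ≤ 1) (hη : 0 ≤ η) (hγ : 0 ≤ γ)
    (hv : ‖v‖ = 1) (hHv : hessian f z v = -γ • v)
    (hop : ∀ u, ‖u - η • hessian f z u‖ ≤ (1 + η * γ) * ‖u‖) (ha : 0 ≤ a)
    (hgap : ∀ x x', ∫ θ, ‖(G x θ - ∇ f x) - (G x' θ - ∇ f x')‖ ^ 2 ∂D ≤ a * ‖x - x'‖ ^ 2 + b)
    (hs : 0 < s) (hs1 : s ≤ 1) (hsL : 30000 * (η * L) ^ 2 ≤ s * μ)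
    (hsa : 120000 * (η ^ 2 * a) ≤ s) (hb : 2 * b ≤ 1 / 5000 * (4 * (r ^ 2 / d)))
    (S : CoupledState d) :
    Integrable (fun w => gapEnergy η v (coupledStep η γ ρ v z G Cmp S w)) (sampleLaw d r D D') ∧
      ∫ w, gapEnergy η v (coupledStep η γ ρ v z G Cmp S w) ∂(sampleLaw d r D D') ≤
        (1 + s) * (1 + η * γ) ^ 2 * gapEnergy η v S +
          3 / 5000 * (4 * (r ^ 2 / d) * η ^ 2) := by
  set ζ : Θ → Vec d := fun θ => (G S.1.1 θ - ∇ f S.1.1) - (G S.2.1.1 θ - ∇ f S.2.1.1) with hζdef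
  set h := ∇ f S.1.1 - ∇ f S.2.1.1 with hh
  set E := S.1.2 - S.2.1.2 with hE
  set N := S.2.2.1 with hN
  set q := 1 + η * γ with hq
  set c := corrected η S.1 - corrected η S.2.1 - η • h - (q * N) • v with hc
  set K := drift η ρ z S with hK
  set n := 4 * (r ^ 2 / (d : ℝ)) with hn
  have hn0 : 0 ≤ n := by positivity
  have hK0 : 0 ≤ K := drift_nonneg hη hρ S
  have hζ : IsCentered ζ D := (hG.isCentered S.1.1).sub (hG.isCentered S.2.1.1)
  have hg := isCentered_directional (r := r) hv
  have hπ : MeasurePreserving (fun w : Vec d × Θ × Θ' => w.2.1) (sampleLaw d r D D') D :=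
    measurePreserving_fst.comp measurePreserving_snd
  have h1 := hζ.integral_norm_add_smul_comp_sq hπ (-η) c
  have h2 := hC.sample_error_le hg.1 hζ (E + h)
  have hπ₁ : MeasurePreserving (fun w : Vec d × Θ × Θ' => w.1) (sampleLaw d r D D')
      (noiseLaw d r) := measurePreserving_fst
  have h3 := hg.1.integral_norm_add_smul_comp_sq hπ₁ (-η) ((q * N) • v)
  rw [hg.2] at h2 h3
  set Z := ∫ θ, ‖ζ θ‖ ^ 2 ∂D with hZ
  have hZle : Z ≤ a * ‖S.1.1 - S.2.1.1‖ ^ 2 + b := hgap _ _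
  have hZ0 : 0 ≤ Z := integral_nonneg fun _ => sq_nonneg _
  have hN3 : ∀ w : Vec d × Θ × Θ', (q * N - 2 * η * ⟪v, w.1⟫) ^ 2 =
      ‖(q * N) • v + -η • (2 * ⟪v, w.1⟫) • v‖ ^ 2 := by
    intro w
    rw [smul_smul, ← add_smul, norm_smul_sq, hv]
    ring
  have hform : ∀ w : Vec d × Θ × Θ', gapEnergy η v (coupledStep η γ ρ v z G Cmp S w) =
      Real.exp (-(350 * (|S.2.2.2| + K))) * (‖c + -η • ζ w.2.1‖ ^ 2 + 1 / 5000 *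
        (η ^ 2 * ‖(E + h) + ((2 * ⟪v, w.1⟫) • v + ζ w.2.1) -
          Cmp ((E + h) + ((2 * ⟪v, w.1⟫) • v + ζ w.2.1)) w.2.2‖ ^ 2 +
          ‖(q * N) • v + -η • (2 * ⟪v, w.1⟫) • v‖ ^ 2)) := by
    intro w
    rw [gapEnergy, gapRemainder_coupledStep f, errorGap_coupledStep hlin f, ← hN3, norm_smul_sq]
    -- The estimate is stated at every state, including those with a negative accumulated drift; the
    -- absolute value in `coupledStep` makes the accumulation additive everywhere.
    have : |(coupledStep η γ ρ v z G Cmp S w).2.2.2| = |S.2.2.2| + K :=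
      abs_of_nonneg (add_nonneg (abs_nonneg _) hK0)
    rw [this]
    rfl
  simp_rw [hform]
  have hi := integral_nested_add h1.1 h2.1 h3.1 (1 / 5000) (η ^ 2)
  refine ⟨hi.1.const_mul _, ?_⟩
  rw [integral_const_mul]
  -- The additive 3/5000 collects three equal shares: the noise in N, the noise in the error gap,
  -- and the part b of the stochastic gradient gap, small by `hb`.
  have hint : ∫ w, (‖c + -η • ζ w.2.1‖ ^ 2 + 1 / 5000 *
        (η ^ 2 * ‖(E + h) + ((2 * ⟪v, w.1⟫) • v + ζ w.2.1) -
          Cmp ((E + h) + ((2 * ⟪v, w.1⟫) • v + ζ w.2.1)) w.2.2‖ ^ 2 +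
          ‖(q * N) • v + -η • (2 * ⟪v, w.1⟫) • v‖ ^ 2)) ∂(sampleLaw d r D D') ≤
      (‖c‖ ^ 2 + 1 / 5000 * ((1 - μ / 2) * ‖η • E‖ ^ 2 +
        2 / μ * (η * L) ^ 2 * ‖S.1.1 - S.2.1.1‖ ^ 2 + q ^ 2 * |N| ^ 2) +
        (1 + 1 / 5000) * (η ^ 2 * a) * ‖S.1.1 - S.2.1.1‖ ^ 2) + 3 / 5000 * (n * η ^ 2) := by
    refine hi.2.trans_le ?_
    rw [h1.2, h3.2, norm_smul_sq, hv]
    have i2 := mul_le_mul_of_nonneg_left h2.2 (sq_nonneg η)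
    have i4 := mul_le_mul_of_nonneg_left (one_sub_mul_norm_add_sq_le hμ hμ1 E h) (sq_nonneg η)
    have i5 : 2 / μ * ‖h‖ ^ 2 ≤ 2 / μ * (L * ‖S.1.1 - S.2.1.1‖) ^ 2 := by
      have := hf.smooth S.1.1 S.2.1.1
      gcongr
    have i6 := mul_le_mul_of_nonneg_left i5 (sq_nonneg η)
    have i7 : η ^ 2 * ((1 - μ) * (n + Z)) ≤ η ^ 2 * (n + Z) :=
      mul_le_mul_of_nonneg_left (mul_le_of_le_one_left (add_nonneg hn0 hZ0) (sub_le_self 1 hμ.le))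
        (sq_nonneg η)
    have i8 := mul_le_mul_of_nonneg_left hZle (sq_nonneg η)
    have i9 := mul_le_mul_of_nonneg_left hb (sq_nonneg η)
    have i10 : 0 ≤ n * η ^ 2 := mul_nonneg hn0 (sq_nonneg η)
    rw [norm_smul_sq, sq_abs]
    linarith
  have hXle : ‖S.1.1 - S.2.1.1‖ ≤ ‖gapRemainder η v S‖ + |N| + ‖η • E‖ := by
    have e : S.1.1 - S.2.1.1 = gapRemainder η v S + N • v + η • E := by
      simp only [gapRemainder, corrected, hE, hN]
      module
    rw [e]
    refine (norm_add_le _ _).trans ?_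
    have := norm_add_le (gapRemainder η v S) (N • v)
    rw [norm_smul, hv, mul_one, Real.norm_eq_abs] at this
    linarith
  have hscal := gap_energy_scalar (norm_nonneg (gapRemainder η v S)) (norm_nonneg (η • E)) hK0
    (norm_nonneg (S.1.1 - S.2.1.1)) (norm_nonneg c)
    (show 1 ≤ q by have := mul_nonneg hη hγ; linarith) hs hs1 hμ hμ1 (mul_nonneg hη hL)
    (show 0 ≤ η ^ 2 * a by positivity) hsL hsa hXle
    (norm_gapRemainder_drift_le hf hL hρ hη hHv hop S)
  have hexp : Real.exp (-(350 * (|S.2.2.2| + K))) =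
      Real.exp (-(350 * |S.2.2.2|)) * Real.exp (-(350 * K)) := by
    rw [← Real.exp_add]; ring_nf
  have hexp1 : Real.exp (-(350 * (|S.2.2.2| + K))) ≤ 1 := by
    refine Real.exp_le_one_iff.2 ?_
    have := abs_nonneg S.2.2.2
    linarith
  have hfin := mul_le_mul_of_nonneg_left hint (Real.exp_pos (-(350 * (|S.2.2.2| + K)))).le
  refine hfin.trans ?_
  rw [mul_add]
  have t1 : Real.exp (-(350 * (|S.2.2.2| + K))) * (3 / 5000 * (n * η ^ 2)) ≤
      3 / 5000 * (n * η ^ 2) := 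
    mul_le_of_le_one_left (mul_nonneg (by norm_num) (mul_nonneg hn0 (sq_nonneg η))) hexp1
  have t2 := mul_le_mul_of_nonneg_left hscal (Real.exp_pos (-(350 * |S.2.2.2|))).le
  rw [hexp] at t1 ⊢
  rw [sq_abs] at t2
  rw [gapEnergy]
  rw [sq_abs]
  linarith

end GapEnergy

/-! ### Laws of the coupled chains -/

/-- The variances of the process `N ↦ q N + noise` with noise of variance `c`. -/
noncomputable def noiseVar (q c : ℝ) : ℕ → ℝ
  | 0 => 0
  | t + 1 => q ^ 2 * noiseVar q c t + c

lemma noiseVar_nonneg {q c : ℝ} (hc : 0 ≤ c) (t : ℕ) : 0 ≤ noiseVar q c t := by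
  induction t with
  | zero => exact le_rfl
  | succ t ih => rw [noiseVar]; positivity

/-- Keeps only the contribution of the first noise, which has been amplified t times. -/
lemma pow_mul_le_noiseVar {q c : ℝ} (hc : 0 ≤ c) (t : ℕ) :
    (q ^ 2) ^ t * c ≤ noiseVar q c (t + 1) := by
  induction t with
  | zero => simp [noiseVar]
  | succ t ih =>
    rw [noiseVar, pow_succ, mul_comm _ (q ^ 2), mul_assoc]
    have := mul_le_mul_of_nonneg_left ih (sq_nonneg q)
    linarith

lemma integral_le_sqrt_integral_sq {A : Type*} [MeasurableSpace A] {m : Measure A}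
    [IsProbabilityMeasure m] {g : A → ℝ} (hg : Measurable g) (hg2 : Integrable (fun a => g a ^ 2) m) :
    Integrable g m ∧ (∫ a, g a ∂m) ^ 2 ≤ ∫ a, g a ^ 2 ∂m := by
  have h2 : MemLp g 2 m := (memLp_two_iff_integrable_sq hg.aestronglyMeasurable).2 hg2
  refine ⟨h2.integrable one_le_two, ?_⟩
  have h := variance_nonneg g m
  rw [variance_eq_sub h2] at h
  simpa using h

section CoupledLaw

variable {d : ℕ} {Θ Θ' : Type*} [MeasurableSpace Θ] [MeasurableSpace Θ']
  {η γ r σ μ fmax L ρ a b s ε : ℝ} {v z : Vec d} {D : Measure Θ} {D' : Measure Θ'}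
  [IsProbabilityMeasure D] [IsProbabilityMeasure D'] {f : Vec d → ℝ} {G : Vec d → Θ → Vec d}
  {Cmp : Vec d → Θ' → Vec d}

/-- The law of two coupled chains, both started at `s₀`. -/
noncomputable def coupledLaw (η γ ρ r : ℝ) (v : Vec d) (G : Vec d → Θ → Vec d)
    (Cmp : Vec d → Θ' → Vec d) (D : Measure Θ) (D' : Measure Θ') (s₀ : Vec d × Vec d) (t : ℕ) :
    Measure (CoupledState d) :=
  chainLaw (coupledStep η γ ρ v s₀.1 G Cmp) (sampleLaw d r D D')
    (Measure.dirac (s₀, s₀, 0, 0)) t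

lemma isProbabilityMeasure_coupledLaw (hG : Measurable (Function.uncurry G))
    (hC : Measurable (Function.uncurry Cmp)) (s₀ : Vec d × Vec d) (t : ℕ) :
    IsProbabilityMeasure (coupledLaw η γ ρ r v G Cmp D D' s₀ t) :=
  isProbabilityMeasure_chainLaw (measurable_coupledStep hG hC) t

lemma map_fst_coupledLaw (hG : Measurable (Function.uncurry G))
    (hC : Measurable (Function.uncurry Cmp)) (s₀ : Vec d × Vec d) (t : ℕ) :
    (coupledLaw η γ ρ r v G Cmp D D' s₀ t).map (fun S => S.1) = sgdLaw η r G Cmp D D' s₀ t := by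
  rw [coupledLaw, map_chainLaw_of_semiconj (measurable_coupledStep hG hC)
    (measurable_sgdStep (η := η) hG hC) measurable_fst (MeasurePreserving.id _) (fun _ _ => rfl),
    Measure.map_dirac' measurable_fst]
  rfl

lemma map_snd_coupledLaw (hG : Measurable (Function.uncurry G))
    (hC : Measurable (Function.uncurry Cmp)) (hv : ‖v‖ = 1) (s₀ : Vec d × Vec d) (t : ℕ) :
    (coupledLaw η γ ρ r v G Cmp D D' s₀ t).map (fun S => S.2.1) = sgdLaw η r G Cmp D D' s₀ t := by
  have hR : MeasurePreserving (fun w : Vec d × Θ × Θ' => (hyperplaneReflection v w.1, w.2))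
      (sampleLaw d r D D') (sampleLaw d r D D') :=
    (measurePreserving_hyperplaneReflection hv).prod (MeasurePreserving.id _)
  have hm : Measurable (fun S : CoupledState d => S.2.1) := by fun_prop
  rw [coupledLaw, map_chainLaw_of_semiconj (measurable_coupledStep hG hC)
    (measurable_sgdStep (η := η) hG hC) hm hR (fun _ _ => rfl), Measure.map_dirac' hm]
  rfl

/-- The recursion of N is linear with constant coefficients and does not involve the chains, so N is
exactly Gaussian. -/
lemma map_noise_coupledLaw (hG : Measurable (Function.uncurry G))
    (hC : Measurable (Function.uncurry Cmp)) (hv : ‖v‖ = 1) (s₀ : Vec d × Vec d) (t : ℕ) :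
    (coupledLaw η γ ρ r v G Cmp D D' s₀ t).map (fun S => S.2.2.1) =
      gaussianReal 0 (noiseVar (1 + η * γ) (4 * (r ^ 2 / d) * η ^ 2) t).toNNReal := by
  set q := 1 + η * γ
  have hm : Measurable (fun S : CoupledState d => S.2.2.1) := by fun_prop
  induction t with
  | zero =>
    rw [coupledLaw, chainLaw, Measure.map_dirac' hm]
    simp [noiseVar, gaussianReal_zero_var]
  | succ t ih =>
    have := isProbabilityMeasure_coupledLaw (η := η) (γ := γ) (ρ := ρ) (r := r) (v := v) (D := D)
      (D' := D') hG hC s₀ t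
    have hΦ := measurable_coupledStep (η := η) (γ := γ) (ρ := ρ) (v := v) (z := s₀.1) hG hC
    have h1 : (coupledLaw η γ ρ r v G Cmp D D' s₀ t).map (fun S => q * S.2.2.1) =
        gaussianReal 0 ((q ^ 2 * noiseVar q (4 * (r ^ 2 / d) * η ^ 2) t).toNNReal) := by
      have e : (fun S : CoupledState d => q * S.2.2.1) =
          (fun x => q * x) ∘ (fun S => S.2.2.1) := rfl
      rw [e, ← Measure.map_map (by fun_prop) hm, ih, gaussianReal_map_const_mul, mul_zero]
      congr 1
      ext
      simp [Real.coe_toNNReal _ (noiseVar_nonneg (q := q) (c := 4 * (r ^ 2 / d) * η ^ 2)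
        (by positivity) t), Real.coe_toNNReal _ (mul_nonneg (sq_nonneg q)
        (noiseVar_nonneg (q := q) (c := 4 * (r ^ 2 / d) * η ^ 2) (by positivity) t))]
    have h2 : (sampleLaw d r D D').map (fun w => -(2 * η) * ⟪v, w.1⟫) =
        gaussianReal 0 (4 * (r ^ 2 / d) * η ^ 2).toNNReal := by
      have e : (fun w : Vec d × Θ × Θ' => -(2 * η) * ⟪v, w.1⟫) =
          (fun x => -(2 * η) * x) ∘ ((fun ξ => ⟪v, ξ⟫) ∘ Prod.fst) := rfl
      have e2 : (sampleLaw d r D D').map Prod.fst = noiseLaw d r :=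
        (measurePreserving_fst (μ := noiseLaw d r) (ν := D.prod D')).map_eq
      rw [e, ← Measure.map_map (by fun_prop) (by fun_prop),
        ← Measure.map_map (by fun_prop) (by fun_prop), e2, map_inner_noiseLaw hv,
        gaussianReal_map_const_mul, mul_zero]
      congr 1
      ext
      simp [Real.coe_toNNReal _ (show (0 : ℝ) ≤ r ^ 2 / d by positivity),
        Real.coe_toNNReal _ (show (0 : ℝ) ≤ 4 * (r ^ 2 / d) * η ^ 2 by positivity)]
      ring
    have e : (fun S : CoupledState d => S.2.2.1) ∘
        (Function.uncurry (coupledStep η γ ρ v s₀.1 G Cmp)) =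
        (fun p : ℝ × ℝ => p.1 + p.2) ∘ (Prod.map (fun S : CoupledState d => q * S.2.2.1)
          (fun w : Vec d × Θ × Θ' => -(2 * η) * ⟪v, w.1⟫)) := by
      ext1 ⟨S, w⟩
      simp [coupledStep, q]
      ring
    change (((coupledLaw η γ ρ r v G Cmp D D' s₀ t).prod (sampleLaw d r D D')).map
      (Function.uncurry (coupledStep η γ ρ v s₀.1 G Cmp))).map (fun S => S.2.2.1) = _
    rw [Measure.map_map hm hΦ, e, ← Measure.map_map (by fun_prop) (by fun_prop),
      ← Measure.map_prod_map _ _ (by fun_prop) (by fun_prop), h1, h2]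
    have h3 := gaussianReal_conv_gaussianReal (m₁ := 0) (m₂ := 0)
      (v₁ := (q ^ 2 * noiseVar q (4 * (r ^ 2 / d) * η ^ 2) t).toNNReal)
      (v₂ := (4 * (r ^ 2 / d) * η ^ 2).toNNReal)
    rw [Measure.conv] at h3
    rw [h3, add_zero, noiseVar, Real.toNNReal_add (mul_nonneg (sq_nonneg q)
      (noiseVar_nonneg (by positivity) t)) (by positivity)]

/-- The energy obeys the recursion of `noiseVar` up to a factor 1 + s per step, with a source term
that is only 3/5000 of the noise. Both copies start together, so it starts at 0. -/
lemma integral_gapEnergy_coupledLaw_le (hf : IsRegularObjective f fmax L ρ) (hL : 0 ≤ L)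
    (hρ : 0 ≤ ρ) (hG : IsStochasticGradient f G D σ) (hC : IsCompressor Cmp D' μ)
    (hlin : IsLinearCompressor Cmp) (hμ : 0 < μ) (hμ1 : μ ≤ 1) (hη : 0 ≤ η) (hγ : 0 ≤ γ)
    (s₀ : Vec d × Vec d) (hv : ‖v‖ = 1) (hHv : hessian f s₀.1 v = -γ • v)
    (hop : ∀ u, ‖u - η • hessian f s₀.1 u‖ ≤ (1 + η * γ) * ‖u‖) (ha : 0 ≤ a)
    (hgap : ∀ x x', ∫ θ, ‖(G x θ - ∇ f x) - (G x' θ - ∇ f x')‖ ^ 2 ∂D ≤ a * ‖x - x'‖ ^ 2 + b)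
    (hs : 0 < s) (hs1 : s ≤ 1) (hsL : 30000 * (η * L) ^ 2 ≤ s * μ)
    (hsa : 120000 * (η ^ 2 * a) ≤ s) (hb : 2 * b ≤ 1 / 5000 * (4 * (r ^ 2 / d))) (t : ℕ) :
    Integrable (gapEnergy η v) (coupledLaw η γ ρ r v G Cmp D D' s₀ t) ∧
      ∫ S, gapEnergy η v S ∂(coupledLaw η γ ρ r v G Cmp D D' s₀ t) ≤
        (1 + s) ^ t * (3 / 5000 * noiseVar (1 + η * γ) (4 * (r ^ 2 / d) * η ^ 2) t) := by
  set c := 4 * (r ^ 2 / d) * η ^ 2 with hc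
  have hc0 : 0 ≤ c := by positivity
  induction t with
  | zero =>
    rw [coupledLaw, chainLaw]
    have hm := (measurable_gapEnergy (d := d) (η := η) (v := v)).stronglyMeasurable
    refine ⟨integrable_dirac' hm (by simp), ?_⟩
    rw [integral_dirac' _ _ hm]
    simp [gapEnergy, gapRemainder, noiseVar]
  | succ t ih =>
    have := isProbabilityMeasure_coupledLaw (η := η) (γ := γ) (ρ := ρ) (r := r) (v := v) (D := D)
      (D' := D') hG.measurable hC.measurable s₀ t
    have hstep := integral_gapEnergy_coupledStep_le (r := r) hf hL hρ hG hC hlin hμ hμ1 hη hγ hv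
      hHv hop ha hgap hs hs1 hsL hsa hb
    have hψ := (ih.1.const_mul ((1 + s) * (1 + η * γ) ^ 2)).add
      (integrable_const (μ := coupledLaw η γ ρ r v G Cmp D D' s₀ t) (3 / 5000 * c))
    have h := integral_map_prod_le (measurable_coupledStep hG.measurable hC.measurable)
      measurable_gapEnergy gapEnergy_nonneg hψ (fun S => (hstep S).1) (fun S => (hstep S).2)
    refine ⟨h.1, h.2.trans ?_⟩
    simp only [Pi.add_apply]
    rw [integral_add (ih.1.const_mul _) (integrable_const _), integral_const_mul, integral_const,
      probReal_univ, one_smul, noiseVar, pow_succ (1 + s) t]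
    have h1 := mul_le_mul_of_nonneg_left ih.2
      (show 0 ≤ (1 + s) * (1 + η * γ) ^ 2 by positivity)
    have h2 : 3 / 5000 * c ≤ (1 + s) ^ t * (1 + s) * (3 / 5000 * c) := by
      rw [← pow_succ]
      exact le_mul_of_one_le_left (by positivity) (one_le_pow₀ (by linarith))
    linarith

lemma integral_drift_coupledLaw (hG : IsStochasticGradient f G D σ) (hC : IsCompressor Cmp D' μ) (hv : ‖v‖ = 1)
    (s₀ : Vec d × Vec d) (t : ℕ)
    (hi : Integrable (fun s => ‖s.1 - s₀.1‖) (sgdLaw η r G Cmp D D' s₀ t)) :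
    Integrable (drift η ρ s₀.1) (coupledLaw η γ ρ r v G Cmp D D' s₀ t) ∧
      ∫ S, drift η ρ s₀.1 S ∂(coupledLaw η γ ρ r v G Cmp D D' s₀ t) =
        2 * η * ρ * ∫ s, ‖s.1 - s₀.1‖ ∂(sgdLaw η r G Cmp D D' s₀ t) := by
  have e1 := map_fst_coupledLaw (η := η) (γ := γ) (ρ := ρ) (r := r) (v := v) (D := D)
    (D' := D') hG.measurable hC.measurable s₀ t
  have e2 := map_snd_coupledLaw (η := η) (γ := γ) (ρ := ρ) (r := r) (v := v) (D := D)
    (D' := D') hG.measurable hC.measurable hv s₀ t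
  have hm1 : Measurable (fun S : CoupledState d => S.1) := by fun_prop
  have hm2 : Measurable (fun S : CoupledState d => S.2.1) := by fun_prop
  have hg : Measurable (fun s : Vec d × Vec d => ‖s.1 - s₀.1‖) := by fun_prop
  have i1 : Integrable (fun S : CoupledState d => ‖S.1.1 - s₀.1‖)
      (coupledLaw η γ ρ r v G Cmp D D' s₀ t) := by
    rw [← e1] at hi
    exact (integrable_map_measure hg.aestronglyMeasurable hm1.aemeasurable).1 hi
  have i2 : Integrable (fun S : CoupledState d => ‖S.2.1.1 - s₀.1‖)
      (coupledLaw η γ ρ r v G Cmp D D' s₀ t) := by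
    rw [← e2] at hi
    exact (integrable_map_measure hg.aestronglyMeasurable hm2.aemeasurable).1 hi
  refine ⟨(i1.add i2).const_mul (η * ρ), ?_⟩
  have j1 : ∫ S, ‖S.1.1 - s₀.1‖ ∂(coupledLaw η γ ρ r v G Cmp D D' s₀ t) =
      ∫ s, ‖s.1 - s₀.1‖ ∂(sgdLaw η r G Cmp D D' s₀ t) := by
    rw [← e1, integral_map hm1.aemeasurable hg.aestronglyMeasurable]
  have j2 : ∫ S, ‖S.2.1.1 - s₀.1‖ ∂(coupledLaw η γ ρ r v G Cmp D D' s₀ t) =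
      ∫ s, ‖s.1 - s₀.1‖ ∂(sgdLaw η r G Cmp D D' s₀ t) := by
    rw [← e2, integral_map hm2.aemeasurable hg.aestronglyMeasurable]
  simp only [drift]
  rw [integral_const_mul, integral_add i1 i2, j1, j2]
  ring

/-- Each of the two copies has the law of the single chain, whence the factor 2. Only first moments
of the distances are needed. -/
lemma integral_abs_accumulated_le (hρ : 0 ≤ ρ) (hη : 0 ≤ η)
    (hG : IsStochasticGradient f G D σ) (hC : IsCompressor Cmp D' μ) (hv : ‖v‖ = 1)
    (s₀ : Vec d × Vec d) (I : ℕ)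
    (hi : ∀ t < I, Integrable (fun s => ‖s.1 - s₀.1‖) (sgdLaw η r G Cmp D D' s₀ t)) :
    Integrable (fun S : CoupledState d => |S.2.2.2|) (coupledLaw η γ ρ r v G Cmp D D' s₀ I) ∧
      ∫ S, |S.2.2.2| ∂(coupledLaw η γ ρ r v G Cmp D D' s₀ I) ≤
        2 * η * ρ * ∑ t ∈ Finset.range I, ∫ s, ‖s.1 - s₀.1‖ ∂(sgdLaw η r G Cmp D D' s₀ t) := by
  have hm : Measurable (fun S : CoupledState d => |S.2.2.2|) :=
    measurable_norm.comp (f := fun S : CoupledState d => S.2.2.2) (by fun_prop)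
  induction I with
  | zero =>
    rw [coupledLaw, chainLaw]
    refine ⟨integrable_dirac' hm.stronglyMeasurable (by simp), ?_⟩
    rw [integral_dirac' _ _ hm.stronglyMeasurable]
    simp
  | succ t ih =>
    have := isProbabilityMeasure_coupledLaw (η := η) (γ := γ) (ρ := ρ) (r := r) (v := v) (D := D)
      (D' := D') hG.measurable hC.measurable s₀ t
    obtain ⟨ih1, ih2⟩ := ih fun t ht => hi t (ht.trans (Nat.lt_succ_self _))
    obtain ⟨h1, h2⟩ := integral_drift_coupledLaw (γ := γ) (ρ := ρ) (v := v) hG hC hv s₀ t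
      (hi t (Nat.lt_succ_self t))
    have hpt : ∀ S w, |(coupledStep η γ ρ v s₀.1 G Cmp S w).2.2.2| =
        |S.2.2.2| + drift η ρ s₀.1 S := fun S w =>
      abs_of_nonneg (add_nonneg (abs_nonneg _) (drift_nonneg hη hρ S))
    have h := integral_map_prod_le (ν := sampleLaw d r D D')
      (measurable_coupledStep (η := η) (γ := γ) (ρ := ρ) (v := v)
      (z := s₀.1) hG.measurable hC.measurable) hm (fun S => abs_nonneg _) (ih1.add h1)
      (fun S => by simp_rw [hpt]; exact integrable_const _)
      (fun S => by simp_rw [hpt]; simp)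
    refine ⟨h.1, h.2.trans ?_⟩
    simp only [Pi.add_apply]
    rw [integral_add ih1 h1, h2, Finset.sum_range_succ, mul_add]
    linarith

end CoupledLaw

/-! ### Escape from saddle points -/

section Escape

variable {d : ℕ} {Θ Θ' : Type*} [MeasurableSpace Θ] [MeasurableSpace Θ']
  {η r σ μ fmax L ρ a b ε β Y : ℝ} {D : Measure Θ} {D' : Measure Θ'}
  [IsProbabilityMeasure D] [IsProbabilityMeasure D'] {f : Vec d → ℝ} {G : Vec d → Θ → Vec d}
  {Cmp : Vec d → Θ' → Vec d}

lemma integral_sq_dist_corrected_le_of_defect (hd : 1 ≤ d) (hf : IsRegularObjective f fmax L ρ)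
    (hL : 0 < L) (hG : IsStochasticGradient f G D σ) (hC : IsCompressor Cmp D' μ) (hμ : 0 < μ)
    (hμ1 : μ ≤ 1) {I : ℕ} (hI : 0 < I)
    (hY : 3 * (2 * I * η ^ 2 * β + I * η ^ 2 * (σ ^ 2 + r ^ 2)) ≤ Y) (s₀ : Vec d × Vec d)
    (hdef : ∑ i ∈ Finset.range I, ∫ s, defect f η s ∂(sgdLaw η r G Cmp D D' s₀ i) ≤ β)
    {t : ℕ} (ht : t ≤ I) :
    Integrable (fun s => ‖corrected η s - corrected η s₀‖ ^ 2) (sgdLaw η r G Cmp D D' s₀ t) ∧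
      ∫ s, ‖corrected η s - corrected η s₀‖ ^ 2 ∂(sgdLaw η r G Cmp D D' s₀ t) ≤ Y := by
  have h := integral_sq_dist_corrected_le (η := η) (r := r) hd hf hL hG hC s₀ hI ht
  refine ⟨h.1, h.2.trans (le_trans ?_ hY)⟩
  have h1 : ∑ j ∈ Finset.range I, ∫ s, ‖∇ f s.1‖ ^ 2 ∂(sgdLaw η r G Cmp D D' s₀ j) ≤ β := by
    refine le_trans (Finset.sum_le_sum fun i _ => ?_) hdef
    have := isProbabilityMeasure_sgdLaw (η := η) (r := r) hG hC s₀ i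
    exact integral_mono (integrable_sq_norm_gradient hf hL)
      (integrable_defect_sgdLaw hd hf hL hG hC hμ hμ1 s₀ i)
      fun s => le_add_of_nonneg_right (sq_nonneg _)
  gcongr

/-- x - x₀ is the displacement of the corrected iterate plus η e - η e₀. Cauchy–Schwarz in time
bounds the sum of ‖η e‖ by the defects, and the constant ‖η e₀‖ is why I ‖η e₀‖² enters the
hypothesis. -/
lemma sum_integral_dist_le_of_defect (hd : 1 ≤ d) (hf : IsRegularObjective f fmax L ρ)
    (hL : 0 < L) (hG : IsStochasticGradient f G D σ) (hC : IsCompressor Cmp D' μ) (hμ : 0 < μ)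
    (hμ1 : μ ≤ 1) {I : ℕ} (hI : 0 < I)
    (hY : 3 * (2 * I * η ^ 2 * β + I * η ^ 2 * (σ ^ 2 + r ^ 2)) ≤ Y) (s₀ : Vec d × Vec d)
    (hdef : ∑ i ∈ Finset.range I, ∫ s, defect f η s ∂(sgdLaw η r G Cmp D D' s₀ i) +
      I * ‖η • s₀.2‖ ^ 2 ≤ β) :
    (∀ t < I, Integrable (fun s => ‖s.1 - s₀.1‖) (sgdLaw η r G Cmp D D' s₀ t)) ∧
      ∑ t ∈ Finset.range I, ∫ s, ‖s.1 - s₀.1‖ ∂(sgdLaw η r G Cmp D D' s₀ t) ≤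
        I * √Y + 2 * √(I * β) := by
  have hprob := isProbabilityMeasure_sgdLaw (η := η) (r := r) hG hC s₀
  have hdef0 : ∀ i, 0 ≤ ∫ s, defect f η s ∂(sgdLaw η r G Cmp D D' s₀ i) :=
    fun i => integral_nonneg fun s => defect_nonneg s
  have hsum0 : 0 ≤ ∑ i ∈ Finset.range I, ∫ s, defect f η s ∂(sgdLaw η r G Cmp D D' s₀ i) :=
    Finset.sum_nonneg fun i _ => hdef0 i
  have he0 : 0 ≤ I * ‖η • s₀.2‖ ^ 2 := by positivity
  have hI0 : (0 : ℝ) ≤ I := Nat.cast_nonneg I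
  have hloc := fun (t : ℕ) (ht : t ≤ I) => integral_sq_dist_corrected_le_of_defect hd hf hL hG hC
    hμ hμ1 hI hY s₀ (by linarith) (t := t) ht
  have hy := fun (t : ℕ) (ht : t < I) =>
    have := hprob t
    integral_le_sqrt_integral_sq (g := fun s => ‖corrected η s - corrected η s₀‖)
      ((measurable_corrected.sub_const _).norm) (hloc t ht.le).1
  have hei : ∀ t, Integrable (fun s : Vec d × Vec d => ‖η • s.2‖ ^ 2)
      (sgdLaw η r G Cmp D D' s₀ t) := fun t => by
    simp_rw [norm_smul_sq]
    exact (integrable_sq_norm_snd_sgdLaw hd hf hL hG hC hμ hμ1 s₀ t).const_mul _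
  have he := fun (t : ℕ) =>
    have := hprob t
    integral_le_sqrt_integral_sq (m := sgdLaw η r G Cmp D D' s₀ t)
      (g := fun s : Vec d × Vec d => ‖η • s.2‖) (by fun_prop) (hei t)
  have hpt : ∀ s : Vec d × Vec d, ‖s.1 - s₀.1‖ ≤
      ‖corrected η s - corrected η s₀‖ + ‖η • s.2‖ + ‖η • s₀.2‖ := by
    intro s
    have e : s.1 - s₀.1 = (corrected η s - corrected η s₀) + η • s.2 - η • s₀.2 := by
      simp only [corrected]; abel
    rw [e]
    refine (norm_sub_le _ _).trans ?_
    gcongr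
    exact norm_add_le _ _
  have hdom : ∀ t < I, Integrable (fun s => ‖corrected η s - corrected η s₀‖ + ‖η • s.2‖)
      (sgdLaw η r G Cmp D D' s₀ t) := fun t ht => (hy t ht).1.add (he t).1
  have hint : ∀ t < I, Integrable (fun s => ‖s.1 - s₀.1‖) (sgdLaw η r G Cmp D D' s₀ t) := by
    intro t ht
    have := hprob t
    refine ((hdom t ht).add (integrable_const ‖η • s₀.2‖)).mono' (by fun_prop)
      (.of_forall fun s => ?_)
    rw [norm_norm]
    exact hpt s
  refine ⟨hint, ?_⟩
  have hstep : ∀ t ∈ Finset.range I, ∫ s, ‖s.1 - s₀.1‖ ∂(sgdLaw η r G Cmp D D' s₀ t) ≤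
      √Y + ∫ s, ‖η • s.2‖ ∂(sgdLaw η r G Cmp D D' s₀ t) + ‖η • s₀.2‖ := by
    intro t ht
    have ht' := Finset.mem_range.1 ht
    have := hprob t
    have h1 := integral_mono (hint t ht') ((hdom t ht').add (integrable_const ‖η • s₀.2‖)) hpt
    simp only [Pi.add_apply] at h1
    rw [integral_add (hdom t ht') (integrable_const _), integral_add (hy t ht').1 (he t).1,
      integral_const, probReal_univ, one_smul] at h1
    have h2 : ∫ s, ‖corrected η s - corrected η s₀‖ ∂(sgdLaw η r G Cmp D D' s₀ t) ≤ √Y :=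
      Real.le_sqrt_of_sq_le ((hy t ht').2.trans (hloc t ht'.le).2)
    linarith
  refine (Finset.sum_le_sum hstep).trans ?_
  rw [Finset.sum_add_distrib, Finset.sum_add_distrib, Finset.sum_const, Finset.sum_const,
    Finset.card_range, nsmul_eq_mul, nsmul_eq_mul]
  have h3 : ∑ t ∈ Finset.range I, ∫ s, ‖η • s.2‖ ∂(sgdLaw η r G Cmp D D' s₀ t) ≤ √(I * β) := by
    refine Real.le_sqrt_of_sq_le ?_
    refine sq_sum_le_card_mul_sum_sq.trans ?_
    rw [Finset.card_range]
    refine mul_le_mul_of_nonneg_left ?_ hI0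
    refine (Finset.sum_le_sum fun t _ => (he t).2.trans
      (integral_mono (hei t) (integrable_defect_sgdLaw hd hf hL hG hC hμ hμ1 s₀ t)
        fun s => le_add_of_nonneg_left (sq_nonneg _))).trans ?_
    linarith
  have h4 : I * ‖η • s₀.2‖ ≤ √(I * β) := by
    refine Real.le_sqrt_of_sq_le ?_
    rw [mul_pow, sq (I : ℝ), mul_assoc]
    refine mul_le_mul_of_nonneg_left ?_ hI0
    linarith
  linarith

/-- Near a saddle point the defect is large: otherwise two coupled chains would stay together,
although the noise drives them apart. -/
theorem le_sum_defect_of_not_isSOSP (hd : 1 ≤ d) (hf : IsRegularObjective f fmax L ρ)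
    (hL : 0 < L) (hρ : 0 ≤ ρ) (hG : IsStochasticGradient f G D σ) (hC : IsCompressor Cmp D' μ)
    (hlin : IsLinearCompressor Cmp) (hμ : 0 < μ) (hμ1 : μ ≤ 1) (hη : 0 < η) (hηL : η * L ≤ 1)
    (hr : 0 < r) (ha : 0 ≤ a)
    (hgap : ∀ x x', ∫ θ, ‖(G x θ - ∇ f x) - (G x' θ - ∇ f x')‖ ^ 2 ∂D ≤ a * ‖x - x'‖ ^ 2 + b)
    {I : ℕ} (hI : 0 < I) (hsL : 30000 * (η * L) ^ 2 ≤ 1 / I * μ)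
    (hsa : 120000 * (η ^ 2 * a) ≤ 1 / I) (hb : 2 * b ≤ 1 / 5000 * (4 * (r ^ 2 / d)))
    (hY : 3 * (2 * I * η ^ 2 * β + I * η ^ 2 * (σ ^ 2 + r ^ 2)) ≤ Y)
    (hloc : 2 * η * ρ * (I * √Y + 2 * √(I * β)) ≤ 1 / 3500)
    (hgrow : 640 * Y ≤ ((1 + η * √(ρ * ε)) ^ 2) ^ (I - 1) * (4 * (r ^ 2 / d) * η ^ 2))
    {s₀ : Vec d × Vec d} (hx : ‖∇ f s₀.1‖ ≤ ε) (hns : ¬ IsSOSP f ρ ε s₀.1) :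
    β ≤ ∑ i ∈ Finset.range I, ∫ s, defect f η s ∂(sgdLaw η r G Cmp D D' s₀ i) +
      I * ‖η • s₀.2‖ ^ 2 := by
  by_contra! hdef
  obtain ⟨γ, v, hγ, -, hv, hHv, hop'⟩ := exists_escape_direction hf hL.le hx hns
  have hop := hop' η hη.le hηL
  have hγ0 : 0 ≤ γ := (Real.sqrt_nonneg _).trans hγ
  have hI1 : (1 : ℝ) ≤ I := by exact_mod_cast hI
  set m := coupledLaw η γ ρ r v G Cmp D D' s₀ I with hm
  have hprob : IsProbabilityMeasure m :=
    isProbabilityMeasure_coupledLaw hG.measurable hC.measurable s₀ I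
  set c := 4 * (r ^ 2 / d) * η ^ 2 with hc
  have hc0 : 0 < c := by
    have : (0 : ℝ) < d := by exact_mod_cast hd
    positivity
  set V := noiseVar (1 + η * γ) c I with hV
  -- The exponent is I - 1 because the first noise is amplified only from the second step on.
  have hVlow : ((1 + η * √(ρ * ε)) ^ 2) ^ (I - 1) * c ≤ V := by
    obtain ⟨k, rfl⟩ := Nat.exists_eq_succ_of_ne_zero hI.ne'
    refine le_trans ?_ (pow_mul_le_noiseVar hc0.le k)
    simp only [Nat.succ_eq_add_one, Nat.add_sub_cancel]
    gcongr
  have hV0 : 0 < V := lt_of_lt_of_le (by positivity) hVlow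
  have hYV : 640 * Y ≤ V := hgrow.trans hVlow
  -- the accumulated distance is small
  have hsum := sum_integral_dist_le_of_defect hd hf hL hG hC hμ hμ1 hI hY s₀ hdef.le
  have hP := integral_abs_accumulated_le (γ := γ) hρ hη.le hG hC hv s₀ I hsum.1
  have hP2 : ∫ S, |S.2.2.2| ∂m ≤ 1 / 3500 := by
    refine hP.2.trans (le_trans ?_ hloc)
    exact mul_le_mul_of_nonneg_left hsum.2 (by positivity)
  have hA1 := mul_meas_ge_le_integral_of_nonneg
    (.of_forall fun S : CoupledState d => abs_nonneg S.2.2.2) hP.1 (1 / 350)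
  -- the corrected iterates are close
  have he0 : 0 ≤ I * ‖η • s₀.2‖ ^ 2 := by positivity
  have hdist := integral_sq_dist_corrected_le_of_defect hd hf hL hG hC hμ hμ1 hI hY s₀
    (by linarith) le_rfl
  have hg : Measurable (fun s : Vec d × Vec d => ‖corrected η s - corrected η s₀‖ ^ 2) :=
    (measurable_corrected.sub_const _).norm.pow_const 2
  have hm1 : Measurable (fun S : CoupledState d => S.1) := by fun_prop
  have hm2 : Measurable (fun S : CoupledState d => S.2.1) := by fun_prop
  have e1 := map_fst_coupledLaw (η := η) (γ := γ) (ρ := ρ) (r := r) (v := v) (D := D)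
    (D' := D') hG.measurable hC.measurable s₀ I
  have e2 := map_snd_coupledLaw (η := η) (γ := γ) (ρ := ρ) (r := r) (v := v) (D := D)
    (D' := D') hG.measurable hC.measurable hv s₀ I
  have d1 : Integrable (fun S : CoupledState d => ‖corrected η S.1 - corrected η s₀‖ ^ 2) m ∧
      ∫ S, ‖corrected η S.1 - corrected η s₀‖ ^ 2 ∂m ≤ Y := by
    have h := hdist
    rw [← e1, integrable_map_measure hg.aestronglyMeasurable hm1.aemeasurable,
      integral_map hm1.aemeasurable hg.aestronglyMeasurable] at h
    exact h
  have d2 : Integrable (fun S : CoupledState d => ‖corrected η S.2.1 - corrected η s₀‖ ^ 2) m ∧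
      ∫ S, ‖corrected η S.2.1 - corrected η s₀‖ ^ 2 ∂m ≤ Y := by
    have h := hdist
    rw [← e2, integrable_map_measure hg.aestronglyMeasurable hm2.aemeasurable,
      integral_map hm2.aemeasurable hg.aestronglyMeasurable] at h
    exact h
  have hsum2 : Integrable (fun S : CoupledState d => ‖corrected η S.1 - corrected η s₀‖ ^ 2 +
      ‖corrected η S.2.1 - corrected η s₀‖ ^ 2) m := d1.1.add d2.1
  have hA2 := mul_meas_ge_le_integral_of_nonneg
    (.of_forall fun S : CoupledState d => by positivity) hsum2 (V / 32)
  rw [integral_add d1.1 d2.1] at hA2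
  -- the energy is small
  have hE := integral_gapEnergy_coupledLaw_le (r := r) (ρ := ρ) hf hL.le hρ hG hC hlin hμ hμ1
    hη.le hγ0 s₀ hv hHv hop ha hgap (s := 1 / I) (by positivity) ((div_le_one (by positivity)).2 hI1)
    hsL hsa hb I
  have hE2 : ∫ S, gapEnergy η v S ∂m ≤ 9 / 5000 * V := by
    refine hE.2.trans ?_
    have h1 := mul_le_mul_of_nonneg_right (pow_one_add_inv_le (le_refl I))
      (show 0 ≤ 3 / 5000 * V by positivity)
    linarith
  have hA3 := mul_meas_ge_le_integral_of_nonneg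
    (.of_forall fun S : CoupledState d => gapEnergy_nonneg S) hE.1 (V / 48)
  -- the noise component is large
  have hN := map_noise_coupledLaw (η := η) (γ := γ) (ρ := ρ) (r := r) (v := v) (D := D)
    (D' := D') hG.measurable hC.measurable hv s₀ I
  have hm3 : Measurable (fun S : CoupledState d => S.2.2.1) := by fun_prop
  have hA4 : m.real {S | |S.2.2.1| < √V / 2} ≤ 2 / 5 := by
    have h := gaussianReal_abs_lt_half_le (V := V.toNNReal) (by simpa using hV0)
    rw [← hN, map_measureReal_apply hm3 (measurableSet_lt (by fun_prop) measurable_const),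
      Real.coe_toNNReal _ hV0.le] at h
    exact h
  set A1 := {S : CoupledState d | 1 / 350 ≤ |S.2.2.2|}
  set A2 := {S : CoupledState d | V / 32 ≤ ‖corrected η S.1 - corrected η s₀‖ ^ 2 +
      ‖corrected η S.2.1 - corrected η s₀‖ ^ 2}
  set A3 := {S : CoupledState d | V / 48 ≤ gapEnergy η v S}
  set A4 := {S : CoupledState d | |S.2.2.1| < √V / 2}
  have hB1 : m.real A1 ≤ 1 / 10 := by linarith
  have hB2 : m.real A2 ≤ 1 / 10 := by
    have h : V / 32 * m.real A2 ≤ V / 32 * (1 / 10) := by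
      refine hA2.trans ?_
      linarith [d1.2, d2.2]
    exact le_of_mul_le_mul_left h (by positivity)
  have hB3 : m.real A3 ≤ 1 / 10 := by
    have h : V / 48 * m.real A3 ≤ V / 48 * (1 / 10) := by
      refine hA3.trans ?_
      linarith
    exact le_of_mul_le_mul_left h (by positivity)
  -- The bounds are three times 1/10 and once 2/5. Outside the four events, |N| ≥ √V / 2, while the
  -- remainder and the difference of the corrected iterates each have norm below √V / 4.
  have hunion : m.real (A1 ∪ A2 ∪ A3 ∪ A4) < 1 := by
    have u1 := measureReal_union_le (μ := m) (A1 ∪ A2 ∪ A3) A4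
    have u2 := measureReal_union_le (μ := m) (A1 ∪ A2) A3
    have u3 := measureReal_union_le (μ := m) A1 A2
    linarith
  obtain ⟨S, hS⟩ : ∃ S, S ∉ A1 ∪ A2 ∪ A3 ∪ A4 := by
    by_contra! hall
    rw [Set.eq_univ_of_forall hall, probReal_univ] at hunion
    exact lt_irrefl _ hunion
  simp only [A1, A2, A3, A4, Set.mem_union, Set.mem_ofPred_eq, not_or, not_le, not_lt] at hS
  obtain ⟨⟨⟨hS1, hS2⟩, hS3⟩, hS4⟩ := hS
  have hexp : 1 / 3 ≤ Real.exp (-(350 * |S.2.2.2|)) := by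
    have h1 : Real.exp (-1) ≤ Real.exp (-(350 * |S.2.2.2|)) := Real.exp_le_exp.2 (by linarith)
    have h2 : 1 / 3 ≤ Real.exp (-1) := by
      rw [Real.exp_neg, one_div]
      exact inv_anti₀ (Real.exp_pos 1) (Real.exp_one_lt_d9.le.trans (by norm_num))
    linarith
  have hR : ‖gapRemainder η v S‖ ^ 2 < V / 16 := by
    have h1 : 1 / 3 * ‖gapRemainder η v S‖ ^ 2 ≤ gapEnergy η v S := by
      rw [gapEnergy]
      refine mul_le_mul hexp (le_add_of_nonneg_right (by positivity)) (sq_nonneg _)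
        (Real.exp_pos _).le
    linarith
  have hsV : √V ^ 2 = V := Real.sq_sqrt hV0.le
  have hsV0 : 0 < √V := Real.sqrt_pos.2 hV0
  have hR' : ‖gapRemainder η v S‖ < √V / 4 := by
    refine lt_of_pow_lt_pow_left₀ 2 (by positivity) ?_
    rw [div_pow, hsV]
    linarith
  have hΔ : ‖corrected η S.1 - corrected η S.2.1‖ < √V / 4 := by
    refine lt_of_pow_lt_pow_left₀ 2 (by positivity) ?_
    rw [div_pow, hsV]
    have h1 := norm_add_sq_le_young one_pos (corrected η S.1 - corrected η s₀)
      (corrected η s₀ - corrected η S.2.1)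
    rw [sub_add_sub_cancel, norm_sub_rev (corrected η s₀)] at h1
    linarith
  have hNle : |S.2.2.1| ≤ ‖corrected η S.1 - corrected η S.2.1‖ + ‖gapRemainder η v S‖ := by
    have e : S.2.2.1 • v = corrected η S.1 - corrected η S.2.1 - gapRemainder η v S := by
      simp only [gapRemainder]; abel
    have h1 := norm_sub_le (corrected η S.1 - corrected η S.2.1) (gapRemainder η v S)
    rw [← e, norm_smul, hv, mul_one, Real.norm_eq_abs] at h1
    exact h1
  linarith

end Escape

/-! ### Counting the points that are not second-order stationary -/

section Counting

variable {d : ℕ} {Θ Θ' : Type*} [MeasurableSpace Θ] [MeasurableSpace Θ']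
  {η r σ μ fmax L ρ ε β : ℝ} {D : Measure Θ} {D' : Measure Θ'}
  [IsProbabilityMeasure D] [IsProbabilityMeasure D'] {f : Vec d → ℝ} {G : Vec d → Θ → Vec d}
  {Cmp : Vec d → Θ' → Vec d}

lemma measurableSet_saddle (hf : IsRegularObjective f fmax L ρ) (hL : 0 ≤ L) (hρ : 0 ≤ ρ) :
    MeasurableSet {s : Vec d × Vec d | ‖∇ f s.1‖ ≤ ε ∧ ¬ IsSOSP f ρ ε s.1} := by
  have h1 : MeasurableSet {x : Vec d | ‖∇ f x‖ ≤ ε} :=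
    measurableSet_le hf.continuous_gradient.norm.measurable measurable_const
  exact measurable_fst (h1.inter (measurableSet_isSOSP hf hL hρ).compl)

/-- The probability of a saddle point at time `t` is controlled by the defects from then on. -/
lemma mul_measureReal_saddle_le (hd : 1 ≤ d) (hf : IsRegularObjective f fmax L ρ)
    (hL : 0 < L) (hρ : 0 ≤ ρ) (hG : IsStochasticGradient f G D σ) (hC : IsCompressor Cmp D' μ)
    (hμ : 0 < μ) (hμ1 : μ ≤ 1) {I : ℕ} (hβ : 0 ≤ β)
    (hsaddle : ∀ s₀ : Vec d × Vec d, ‖∇ f s₀.1‖ ≤ ε → ¬ IsSOSP f ρ ε s₀.1 →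
      β ≤ ∑ i ∈ Finset.range I, ∫ s, defect f η s ∂(sgdLaw η r G Cmp D D' s₀ i) +
        I * ‖η • s₀.2‖ ^ 2) (z : Vec d × Vec d) (t : ℕ) :
    β * (sgdLaw η r G Cmp D D' z t).real {s | ‖∇ f s.1‖ ≤ ε ∧ ¬ IsSOSP f ρ ε s.1} ≤
      ∑ i ∈ Finset.range I, ∫ s, defect f η s ∂(sgdLaw η r G Cmp D D' z (t + i)) +
        I * ∫ s, defect f η s ∂(sgdLaw η r G Cmp D D' z t) := by
  set m := sgdLaw η r G Cmp D D' z t with hm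
  have hprob : IsProbabilityMeasure m := isProbabilityMeasure_sgdLaw hG hC z t
  set A := {s : Vec d × Vec d | ‖∇ f s.1‖ ≤ ε ∧ ¬ IsSOSP f ρ ε s.1} with hA
  have hAm : MeasurableSet A := measurableSet_saddle hf hL.le hρ
  have hΦ := measurable_sgdStep (η := η) hG.measurable hC.measurable
  have hφ : Measurable (fun s => ENNReal.ofReal (defect f η s)) :=
    (measurable_defect hf).ennreal_ofReal
  have hint := integrable_defect_sgdLaw (η := η) (r := r) hd hf hL hG hC hμ hμ1
  have hconv : ∀ s₀ i, ENNReal.ofReal (∫ s, defect f η s ∂(sgdLaw η r G Cmp D D' s₀ i)) =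
      ∫⁻ s, ENNReal.ofReal (defect f η s) ∂(sgdLaw η r G Cmp D D' s₀ i) := fun s₀ i =>
    ofReal_integral_eq_lintegral_ofReal (hint s₀ i) (.of_forall fun s => defect_nonneg s)
  set Op : ℕ → Vec d × Vec d → ENNReal := fun i =>
    (transitionOp (sgdStep η G Cmp) (sampleLaw d r D D'))^[i]
      (fun s => ENNReal.ofReal (defect f η s)) with hOp
  have hOpm : ∀ i, Measurable (Op i) := measurable_transitionOp_iterate hΦ hφ
  have hdirac : ∀ s₀ i, ∫⁻ s, ENNReal.ofReal (defect f η s) ∂(sgdLaw η r G Cmp D D' s₀ i) =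
      Op i s₀ := fun s₀ i => lintegral_chainLaw_dirac hΦ hφ i s₀
  have hadd : ∀ i, ∫⁻ s, Op i s ∂m =
      ENNReal.ofReal (∫ s, defect f η s ∂(sgdLaw η r G Cmp D D' z (t + i))) := by
    intro i
    rw [hconv, ← lintegral_chainLaw hΦ hφ i, hm, sgdLaw, sgdLaw, chainLaw_add]
  -- The saddle estimate, written with the transition operator, holds at every state; integrating it
  -- over the law at time t is the Markov property. Extended nonnegative integrals avoid
  -- integrability questions for the iterated operator.
  have hpt : ∀ s, A.indicator (fun _ => ENNReal.ofReal β) s ≤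
      ∑ i ∈ Finset.range I, Op i s + ENNReal.ofReal (I * defect f η s) := by
    intro s
    by_cases hs : s ∈ A
    · rw [Set.indicator_of_mem hs]
      refine (ENNReal.ofReal_le_ofReal (hsaddle s hs.1 hs.2)).trans ?_
      refine ENNReal.ofReal_add_le.trans (add_le_add (le_of_eq ?_) (ENNReal.ofReal_le_ofReal ?_))
      · rw [ENNReal.ofReal_sum_of_nonneg fun i _ => integral_nonneg fun s => defect_nonneg s]
        exact Finset.sum_congr rfl fun i _ => (hconv s i).trans (hdirac s i)
      · exact mul_le_mul_of_nonneg_left (le_add_of_nonneg_left (sq_nonneg _)) (Nat.cast_nonneg I)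
    · rw [Set.indicator_of_notMem hs]
      exact bot_le
  have h := lintegral_mono (μ := m) hpt
  rw [lintegral_indicator_const hAm, lintegral_add_left (Finset.measurable_sum _ fun i _ => hOpm i),
    lintegral_finsetSum _ fun i _ => hOpm i] at h
  simp_rw [hadd] at h
  have hnn : ∀ t, 0 ≤ ∫ s, defect f η s ∂(sgdLaw η r G Cmp D D' z t) :=
    fun t => integral_nonneg fun s => defect_nonneg s
  rw [← ofReal_integral_eq_lintegral_ofReal ((hint z t).const_mul _)
    (.of_forall fun s => mul_nonneg (Nat.cast_nonneg I) (defect_nonneg s)), integral_const_mul,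
    ← ENNReal.ofReal_sum_of_nonneg fun i _ => hnn _, ← ENNReal.ofReal_add
    (Finset.sum_nonneg fun i _ => hnn _) (mul_nonneg (Nat.cast_nonneg I) (hnn t)),
    ← ofReal_measureReal, ← ENNReal.ofReal_mul hβ] at h
  exact (ENNReal.ofReal_le_ofReal_iff (add_nonneg (Finset.sum_nonneg fun i _ => hnn _)
    (mul_nonneg (Nat.cast_nonneg I) (hnn t)))).1 h

/-- The expected number of points that are not second-order stationary. -/
theorem sum_measureReal_not_isSOSP_le (hd : 1 ≤ d) (hf : IsRegularObjective f fmax L ρ)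
    (hL : 0 < L) (hρ : 0 ≤ ρ) (hG : IsStochasticGradient f G D σ) (hC : IsCompressor Cmp D' μ)
    (hμ : 0 < μ) (hμ1 : μ ≤ 1) (hη : 0 < η) (hε : 0 < ε) {I : ℕ} (hβ : 0 < β)
    (hηL : η * L ≤ 1 / 2) (hημ : 16 * η ^ 2 * (L ^ 2 + 1) ≤ μ ^ 2)
    (hsaddle : ∀ s₀ : Vec d × Vec d, ‖∇ f s₀.1‖ ≤ ε → ¬ IsSOSP f ρ ε s₀.1 →
      β ≤ ∑ i ∈ Finset.range I, ∫ s, defect f η s ∂(sgdLaw η r G Cmp D D' s₀ i) +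
        I * ‖η • s₀.2‖ ^ 2) (x₀ : Vec d) (T : ℕ) :
    ∑ t ∈ Finset.range T, (sgdLaw η r G Cmp D D' (x₀, 0) t).real {s | ¬ IsSOSP f ρ ε s.1} ≤
      (1 / ε ^ 2 + 2 * I / β) *
        (8 / η * (fmax + (T + I) * (η * noiseFloor η r σ μ L))) := by
  obtain ⟨hint, hsum⟩ := sum_integral_defect_le (r := r) hd hf hG hC hη hL.le hηL hμ hμ1 hημ x₀
  have hsumTI := hsum (T + I)
  push_cast at hsumTI
  refine le_trans ?_ (mul_le_mul_of_nonneg_left hsumTI (by positivity))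
  set a : ℕ → ℝ := fun t => ∫ s, defect f η s ∂(sgdLaw η r G Cmp D D' (x₀, 0) t) with ha
  have ha0 : ∀ t, 0 ≤ a t := fun t => integral_nonneg fun s => defect_nonneg s
  have hprob := isProbabilityMeasure_sgdLaw (η := η) (r := r) hG hC (x₀, 0)
  have hpt : ∀ t, (sgdLaw η r G Cmp D D' (x₀, 0) t).real {s | ¬ IsSOSP f ρ ε s.1} ≤
      1 / ε ^ 2 * a t + 1 / β * (∑ i ∈ Finset.range I, a (t + i) + I * a t) := by
    intro t
    have := hprob t
    have h1 : (sgdLaw η r G Cmp D D' (x₀, 0) t).real {s | ε ^ 2 ≤ defect f η s} ≤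
        1 / ε ^ 2 * a t := by
      have h := mul_meas_ge_le_integral_of_nonneg
        (.of_forall fun s => defect_nonneg (f := f) (η := η) s) (hint t) (ε ^ 2)
      rw [one_div, le_inv_mul_iff₀ (by positivity)]
      exact h
    have h2 : (sgdLaw η r G Cmp D D' (x₀, 0) t).real
        {s | ‖∇ f s.1‖ ≤ ε ∧ ¬ IsSOSP f ρ ε s.1} ≤
        1 / β * (∑ i ∈ Finset.range I, a (t + i) + I * a t) := by
      rw [one_div, le_inv_mul_iff₀ hβ]
      exact mul_measureReal_saddle_le hd hf hL hρ hG hC hμ hμ1 hβ.le hsaddle (x₀, 0) t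
    refine le_trans (measureReal_mono ?_) ((measureReal_union_le _ _).trans (add_le_add h1 h2))
    intro s hs
    by_cases hx : ‖∇ f s.1‖ ≤ ε
    · exact Or.inr ⟨hx, hs⟩
    · left
      have h3 : ε ^ 2 ≤ ‖∇ f s.1‖ ^ 2 := pow_le_pow_left₀ hε.le (not_le.1 hx).le 2
      exact h3.trans (le_add_of_nonneg_right (sq_nonneg _))
  refine (Finset.sum_le_sum fun t _ => hpt t).trans ?_
  rw [Finset.sum_add_distrib, ← Finset.mul_sum, ← Finset.mul_sum, Finset.sum_add_distrib,
    ← Finset.mul_sum, Finset.sum_comm]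
  have h4 : ∑ t ∈ Finset.range T, a t ≤ ∑ t ∈ Finset.range (T + I), a t :=
    Finset.sum_le_sum_of_subset_of_nonneg (Finset.range_mono (Nat.le_add_right T I))
      fun t _ _ => ha0 t
  -- Each of the I shifted sums runs over times below T + I, so the defects of the windows are
  -- counted at most I times; the I defects at the starting points double this.
  have h5 : ∑ i ∈ Finset.range I, ∑ t ∈ Finset.range T, a (t + i) ≤
      I * ∑ t ∈ Finset.range (T + I), a t := by
    have : ∀ i ∈ Finset.range I, ∑ t ∈ Finset.range T, a (t + i) ≤
        ∑ t ∈ Finset.range (T + I), a t := by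
      intro i hi
      have hi' := Finset.mem_range.1 hi
      calc ∑ t ∈ Finset.range T, a (t + i)
          = ∑ t ∈ (Finset.range T).map (addRightEmbedding i), a t := by
            rw [Finset.sum_map]; rfl
        _ ≤ _ := by
            refine Finset.sum_le_sum_of_subset_of_nonneg (fun t ht => ?_) fun t _ _ => ha0 t
            simp only [Finset.mem_map, Finset.mem_range, addRightEmbedding_apply] at ht ⊢
            omega
    refine (Finset.sum_le_sum this).trans ?_
    rw [Finset.sum_const, Finset.card_range, nsmul_eq_mul]
  have h6 : 1 / ε ^ 2 * ∑ t ∈ Finset.range T, a t ≤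
      1 / ε ^ 2 * ∑ t ∈ Finset.range (T + I), a t := by gcongr
  have h7 : 1 / β * (∑ i ∈ Finset.range I, ∑ t ∈ Finset.range T, a (t + i) +
      I * ∑ t ∈ Finset.range T, a t) ≤
      1 / β * (I * ∑ t ∈ Finset.range (T + I), a t + I * ∑ t ∈ Finset.range (T + I), a t) := by
    gcongr
  refine (add_le_add h6 h7).trans (le_of_eq ?_)
  ring

/-- The visited points have the laws of the chain. -/
lemma map_compressedSGD {Ω : Type*} [MeasurableSpace Ω] {P : Measure Ω} [IsProbabilityMeasure P]
    (hG : Measurable (Function.uncurry G)) (hC : Measurable (Function.uncurry Cmp))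
    {ξ : ℕ → Ω → Vec d} {θ : ℕ → Ω → Θ} {θ' : ℕ → Ω → Θ'} (hs : AreSamples P r D D' ξ θ θ')
    (x₀ : Vec d) (t : ℕ) :
    Measurable (fun ω => compressedSGD η G Cmp x₀ (fun s => ξ s ω) (fun s => θ s ω)
        (fun s => θ' s ω) t) ∧
      P.map (fun ω => compressedSGD η G Cmp x₀ (fun s => ξ s ω) (fun s => θ s ω)
        (fun s => θ' s ω) t) = sgdLaw η r G Cmp D D' (x₀, 0) t :=
  map_process_eq_chainLaw (measurable_sgdStep hG hC)
    (w := fun t ω => (ξ t ω, θ t ω, θ' t ω))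
    (X := fun t ω => compressedSGD η G Cmp x₀ (fun s => ξ s ω) (fun s => θ s ω)
        (fun s => θ' s ω) t)
    (fun t => (hs.measurable_noise t).prodMk
      ((hs.measurable_gradient t).prodMk (hs.measurable_compressor t)))
    hs.law hs.indep (fun _ => rfl) (fun _ _ => rfl) t

open Classical in
lemma sospCount_eq_sum (T : ℕ) (x : ℕ → Vec d) :
    (sospCount f ρ ε T x : ℝ) = ∑ t ∈ Finset.range T, if IsSOSP f ρ ε (x t) then 1 else 0 := by
  have : {t : ℕ | t < T ∧ IsSOSP f ρ ε (x t)} =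
      ((Finset.range T).filter fun t => IsSOSP f ρ ε (x t) : Finset ℕ) := by
    ext t; simp
  rw [sospCount, this, Set.ncard_coe_finset, Finset.card_filter]
  push_cast
  rfl

/-- From the expected number of points that are not second-order stationary to the conclusions in
expectation and with high probability. -/
lemma sospCount_of_sum_le {Ω : Type*} [MeasurableSpace Ω] {P : Measure Ω} [IsProbabilityMeasure P]
    (hf : IsRegularObjective f fmax L ρ) (hL : 0 ≤ L) (hρ : 0 ≤ ρ)
    {X : ℕ → Ω → Vec d} (hX : ∀ t, Measurable (X t)) {δ : ℝ} (hδ₀ : 0 < δ) (hδ₁ : δ < 1) {T : ℕ}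
    (hsum : ∑ t ∈ Finset.range T, P.real {ω | ¬ IsSOSP f ρ ε (X t ω)} ≤ δ / 2 * T) :
    (T : ℝ) / 2 ≤ ∫ ω, (sospCount f ρ ε T (fun t => X t ω) : ℝ) ∂P ∧
      1 - δ ≤ P.real {ω | (T : ℝ) / 2 ≤ (sospCount f ρ ε T (fun t => X t ω) : ℝ)} := by
  classical
  have hset : ∀ t, MeasurableSet {ω | IsSOSP f ρ ε (X t ω)} := fun t =>
    hX t (measurableSet_isSOSP hf hL hρ)
  have hind : ∀ t, (fun ω => if IsSOSP f ρ ε (X t ω) then (1 : ℝ) else 0) =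
      {ω | IsSOSP f ρ ε (X t ω)}.indicator 1 := fun t => by
    ext ω; simp [Set.indicator_apply]
  have hi : ∀ t, Integrable (fun ω => if IsSOSP f ρ ε (X t ω) then (1 : ℝ) else 0) P := fun t => by
    rw [hind]
    exact (integrable_const (1 : ℝ)).indicator (hset t)
  have hN : Integrable (fun ω => (sospCount f ρ ε T (fun t => X t ω) : ℝ)) P := by
    simp_rw [sospCount_eq_sum]
    exact integrable_finsetSum _ fun t _ => hi t
  have hE : ∫ ω, (sospCount f ρ ε T (fun t => X t ω) : ℝ) ∂P =
      T - ∑ t ∈ Finset.range T, P.real {ω | ¬ IsSOSP f ρ ε (X t ω)} := by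
    simp_rw [sospCount_eq_sum]
    rw [integral_finsetSum _ fun t _ => hi t, eq_sub_iff_add_eq, ← Finset.sum_add_distrib]
    have : ∀ t ∈ Finset.range T, ∫ ω, (if IsSOSP f ρ ε (X t ω) then (1 : ℝ) else 0) ∂P +
        P.real {ω | ¬ IsSOSP f ρ ε (X t ω)} = 1 := by
      intro t _
      rw [hind, integral_indicator_one (hset t)]
      exact probReal_add_probReal_compl (hset t)
    rw [Finset.sum_congr rfl this]
    simp
  have hle : ∀ ω, (sospCount f ρ ε T (fun t => X t ω) : ℝ) ≤ T := fun ω => by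
    rw [sospCount_eq_sum]
    refine (Finset.sum_le_card_nsmul _ _ 1 fun t _ => ?_).trans (by simp)
    split_ifs <;> norm_num
  have hT0 : (0 : ℝ) ≤ T := Nat.cast_nonneg T
  refine ⟨?_, ?_⟩
  · rw [hE]
    nlinarith
  rcases Nat.eq_zero_or_pos T with rfl | hT
  · have : {ω | ((0 : ℕ) : ℝ) / 2 ≤ (sospCount f ρ ε 0 (fun t => X t ω) : ℝ)} = Set.univ := by
      ext ω; simp
    rw [this, probReal_univ]
    linarith
  have hT' : (0 : ℝ) < T := by exact_mod_cast hT
  have hmeas : Measurable (fun ω => (sospCount f ρ ε T (fun t => X t ω) : ℝ)) := by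
    simp_rw [sospCount_eq_sum]
    refine Finset.measurable_sum _ fun t _ => ?_
    rw [hind]
    exact measurable_one.indicator (hset t)
  have hgood : MeasurableSet {ω | (T : ℝ) / 2 ≤ (sospCount f ρ ε T (fun t => X t ω) : ℝ)} :=
    measurableSet_le measurable_const hmeas
  -- Markov's inequality at level T/2 for the number of bad points, whose mean is at most δT/2.
  have hM := mul_meas_ge_le_integral_of_nonneg (μ := P)
    (f := fun ω => (T : ℝ) - (sospCount f ρ ε T (fun t => X t ω) : ℝ))
    (.of_forall fun ω => sub_nonneg.2 (hle ω)) ((integrable_const _).sub hN) ((T : ℝ) / 2)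
  rw [integral_sub (integrable_const _) hN, hE] at hM
  simp only [integral_const, probReal_univ, one_smul, sub_sub_cancel] at hM
  have hbad : P.real {ω | (T : ℝ) / 2 ≤ (T : ℝ) - (sospCount f ρ ε T (fun t => X t ω) : ℝ)} ≤ δ := by
    refine le_of_mul_le_mul_left (hM.trans (hsum.trans (le_of_eq ?_))) (half_pos hT')
    ring
  have hcompl := probReal_add_probReal_compl (μ := P) hgood
  have hsub : P.real {ω | (T : ℝ) / 2 ≤ (sospCount f ρ ε T (fun t => X t ω) : ℝ)}ᶜ ≤
      P.real {ω | (T : ℝ) / 2 ≤ (T : ℝ) - (sospCount f ρ ε T (fun t => X t ω) : ℝ)} := by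
    refine measureReal_mono fun ω hω => ?_
    simp only [Set.mem_compl_iff, Set.mem_ofPred_eq, not_le] at hω ⊢
    linarith
  linarith

end Counting

/-! ### Bounds on the step size scale -/

section StepScale

variable {α μ ε : ℝ}

theorem stepScale_pos (hα : 0 < α) (hε : 0 < ε) : 0 < stepScale α μ ε :=
  inv_pos.2 (lt_max_of_lt_left (by positivity))

theorem stepScale_mul_le (hα : 0 < α) (hε : 0 < ε) : stepScale α μ ε * α ≤ ε ^ 2 := by
  have h0 : 0 < α / ε ^ 2 := by positivity
  have h : stepScale α μ ε ≤ (α / ε ^ 2)⁻¹ := inv_anti₀ h0 (le_max_left _ _)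
  rwa [inv_div, le_div_iff₀ hα] at h

/-- For μ ≤ 1/2 this is the second term of the minimum, as √(1 - μ) ≥ 1/2. For larger μ the first
term ε² suffices, as ε ≤ B and 2μ ≥ 1; this covers μ = 1, where the second term is infinite. -/
theorem stepScale_le_mul {B : ℝ} (hα : 1 ≤ α) (hε : 0 < ε) (hμ : 0 < μ)
    (hB1 : 1 ≤ B) (hB : ε ≤ B) : stepScale α μ ε ≤ 2 * μ * ε * B := by
  rcases le_total μ (1 / 2) with h | h
  · have hs : 1 / 2 ≤ √(1 - μ) := Real.le_sqrt_of_sq_le (by linarith)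
    have h0 : 0 < √(1 - μ) / (μ * ε) := by positivity
    have h1 : stepScale α μ ε ≤ (√(1 - μ) / (μ * ε))⁻¹ :=
      inv_anti₀ h0 ((le_max_left _ _).trans (le_max_right _ _))
    rw [inv_div] at h1
    refine h1.trans ((div_le_iff₀ (by linarith)).2 ?_)
    have h2 : 0 < μ * ε := by positivity
    have : μ * ε * 1 ≤ μ * ε * (2 * B * √(1 - μ)) := by
      refine mul_le_mul_of_nonneg_left ?_ h2.le
      nlinarith
    linarith
  · have h1 := stepScale_mul_le (μ := μ) (by linarith : 0 < α) hε
    have h0 := stepScale_pos (μ := μ) (by linarith : 0 < α) hε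
    have h2 : stepScale α μ ε ≤ ε ^ 2 := by nlinarith
    have h3 : ε * ε ≤ ε * (2 * μ * B) := mul_le_mul_of_nonneg_left (by nlinarith) hε.le
    nlinarith

/-- Makes 1/η polynomial in M, so that a window logarithmic in M, in units of the escape time, gives
enough exponential growth. -/
theorem inv_stepScale_le {M : ℝ} (hε : 0 < ε) (hμ : 0 < μ) (hM : 1 ≤ M)
    (hαM : α ≤ M) (hεM : 1 / ε ≤ M) (hμM : 1 / μ ≤ M) : (stepScale α μ ε)⁻¹ ≤ M ^ 3 := by
  have hi : 0 < 1 / ε := by positivity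
  have hj : 0 < 1 / μ := by positivity
  have hM0 : 0 < M := by linarith
  have hs0 := Real.sqrt_nonneg (1 - μ)
  have hs1 : √(1 - μ) ≤ 1 := Real.sqrt_le_one.2 (by linarith)
  rw [stepScale, inv_inv]
  refine max_le ?_ (max_le ?_ ?_)
  · calc α / ε ^ 2 = α * (1 / ε) ^ 2 := by field_simp
      _ ≤ M * M ^ 2 := by gcongr
      _ = M ^ 3 := by ring
  · calc √(1 - μ) / (μ * ε) = √(1 - μ) * ((1 / μ) * (1 / ε)) := by field_simp
      _ ≤ 1 * (M * M) := by gcongr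
      _ = M ^ 2 := by ring
      _ ≤ M ^ 3 := pow_le_pow_right₀ hM (by norm_num)
  · have h : 1 / √ε ≤ M := by
      rw [div_le_iff₀ (Real.sqrt_pos.2 hε)]
      have h1 : 1 ≤ M * ε := by rwa [div_le_iff₀ hε] at hεM
      rw [← Real.sqrt_sq hM0.le, ← Real.sqrt_mul (sq_nonneg M), Real.one_le_sqrt]
      nlinarith
    have hq : 0 ≤ 1 / √ε := by positivity
    calc (1 - μ) / (μ ^ 2 * √ε) = (1 - μ) * ((1 / μ) ^ 2 * (1 / √ε)) := by field_simp
      _ ≤ 1 * (M ^ 2 * M) := by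
        gcongr
        linarith
      _ = M ^ 3 := by ring

theorem inv_stepScale_div_le (hα : 0 < α) (hε : 0 < ε) (hμ : 0 < μ) (hμ1 : μ ≤ 1) :
    (stepScale α μ ε)⁻¹ / ε ^ 2 ≤ iterationScale α μ ε := by
  have h1 : 0 ≤ α / ε ^ 2 := by positivity
  have h2 : 0 ≤ √(1 - μ) / (μ * ε) := by positivity
  have h3 : 0 ≤ (1 - μ) / (μ ^ 2 * √ε) := div_nonneg (by linarith) (by positivity)
  have h : (stepScale α μ ε)⁻¹ ≤ α / ε ^ 2 + √(1 - μ) / (μ * ε) + (1 - μ) / (μ ^ 2 * √ε) := by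
    rw [stepScale, inv_inv]
    exact max_le (by linarith) (max_le (by linarith) (by linarith))
  have hε2 : 0 < ε ^ 2 := by positivity
  have hs : √ε ≠ 0 := (Real.sqrt_pos.2 hε).ne'
  rw [div_le_iff₀ hε2]
  refine h.trans (le_of_eq ?_)
  rw [iterationScale]
  field_simp

end StepScale

/-! ### Differences of stochastic gradient errors -/

section Gap

variable {d : ℕ} {Θ : Type*} [MeasurableSpace Θ] {D : Measure Θ} [IsProbabilityMeasure D]
  {f : Vec d → ℝ} {G : Vec d → Θ → Vec d} {σ ℓ : ℝ}

theorem IsStochasticGradient.integral_gap_le (hG : IsStochasticGradient f G D σ) (x x' : Vec d) :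
    ∫ θ, ‖(G x θ - ∇ f x) - (G x' θ - ∇ f x')‖ ^ 2 ∂D ≤ 4 * σ ^ 2 := by
  have h := (hG.isCentered x).integral_norm_sub_sq_le (hG.isCentered x')
  linarith [hG.variance_le x, hG.variance_le x']

/-- The centred difference has second moment at most that of the uncentred one, which is bounded
pointwise by the Lipschitz condition. -/
theorem IsStochasticGradient.integral_gap_le_of_lipschitz (hG : IsStochasticGradient f G D σ)
    (hl : IsLipschitzStochasticGradient G ℓ) (x x' : Vec d) :
    ∫ θ, ‖(G x θ - ∇ f x) - (G x' θ - ∇ f x')‖ ^ 2 ∂D ≤ ℓ ^ 2 * ‖x - x'‖ ^ 2 := by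
  obtain ⟨-, h⟩ := ((hG.isCentered x).sub (hG.isCentered x')).integral_norm_add_sq (∇ f x - ∇ f x')
  have he : ∀ θ, ∇ f x - ∇ f x' + ((G x θ - ∇ f x) - (G x' θ - ∇ f x')) = G x θ - G x' θ :=
    fun θ => by abel
  simp only [he] at h
  have hle : ∫ θ, ‖G x θ - G x' θ‖ ^ 2 ∂D ≤ ∫ _, (ℓ * ‖x - x'‖) ^ 2 ∂D :=
    integral_mono_of_nonneg (.of_forall fun θ => sq_nonneg _) (integrable_const _)
      (.of_forall fun θ => pow_le_pow_left₀ (norm_nonneg _) (hl x x' θ) 2)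
  simp only [integral_const, probReal_univ, one_smul, mul_pow] at hle
  linarith [sq_nonneg ‖∇ f x - ∇ f x'‖]

end Gap

/-! ### Consequences of the choice of parameters -/

section Parameters

variable {d : ℕ} {η r σ μ fmax L ρ a b ε α δ Y : ℝ}

/-- The parameters are admissible at the accuracy level `Y`. -/
structure IsAdmissible (d : ℕ) (Y δ η r α a b L ρ fmax σ μ ε : ℝ) (I : ℕ) : Prop where
  one_le_dim : 1 ≤ d
  large : 100000 ≤ Y
  L_pos : 0 < L
  L_le : L ≤ Y
  ρ_pos : 0 < ρ
  ρ_le : ρ ≤ Y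
  ρ_ge : 1 ≤ Y * ρ
  fmax_le : fmax ≤ Y
  σ_nonneg : 0 ≤ σ
  σ_le : σ ≤ Y
  δ_ge : 1 ≤ δ * Y
  μ_pos : 0 < μ
  μ_le : μ ≤ 1
  ε_pos : 0 < ε
  ε_le : ε ≤ Y ^ 3
  η_pos : 0 < η
  r_pos : 0 < r
  α_ge : 1 ≤ α
  a_nonneg : 0 ≤ a
  a_le : a ≤ Y ^ 2
  b_le : b * d ≤ 4 * σ ^ 2 * α
  η_mul_α_le : η * α * Y ^ 16 ≤ ε ^ 2
  η_mul_le : η * Y ^ 13 ≤ 2 * μ * ε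
  η_mul_sq : η * r ^ 2 * Y ^ 12 = ε ^ 2
  le_window : Y ≤ η * √(ρ * ε) * I
  window_le : η * √(ρ * ε) * I ≤ 2 * Y
  growth : 5760 * d * Y ^ 6 ≤ ((1 + η * √(ρ * ε)) ^ 2) ^ (I - 1) * (ρ * ε * η)

namespace IsAdmissible

variable {I : ℕ}

theorem Y_pos (h : IsAdmissible d Y δ η r α a b L ρ fmax σ μ ε I) : 0 < Y := by
  linarith [h.large]

theorem rate_pos (h : IsAdmissible d Y δ η r α a b L ρ fmax σ μ ε I) : 0 < √(ρ * ε) :=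
  Real.sqrt_pos.2 (mul_pos h.ρ_pos h.ε_pos)

theorem sq_rate (h : IsAdmissible d Y δ η r α a b L ρ fmax σ μ ε I) : √(ρ * ε) ^ 2 = ρ * ε :=
  Real.sq_sqrt (mul_pos h.ρ_pos h.ε_pos).le

theorem rate_le (h : IsAdmissible d Y δ η r α a b L ρ fmax σ μ ε I) : √(ρ * ε) ≤ Y ^ 2 := by
  have hY := h.Y_pos
  refine Real.sqrt_le_iff.2 ⟨by positivity, ?_⟩
  calc ρ * ε ≤ Y * Y ^ 3 := mul_le_mul h.ρ_le h.ε_le h.ε_pos.le hY.le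
    _ = (Y ^ 2) ^ 2 := by ring

theorem ε_le_rate (h : IsAdmissible d Y δ η r α a b L ρ fmax σ μ ε I) :
    ε ≤ Y ^ 2 * √(ρ * ε) := by
  have hY := h.Y_pos
  have h0 := h.ε_pos
  have h1 := h.rate_pos
  refine le_of_sq_le_sq ?_ (by positivity)
  rw [mul_pow, h.sq_rate]
  calc ε ^ 2 = ε * 1 * ε := by ring
    _ ≤ Y ^ 3 * (Y * ρ) * ε := by
      gcongr
      · exact h.ε_le
      · exact h.ρ_ge
    _ = (Y ^ 2) ^ 2 * (ρ * ε) := by ring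

theorem η_mul_pow_le (h : IsAdmissible d Y δ η r α a b L ρ fmax σ μ ε I) :
    η * Y ^ 10 ≤ 2 * μ := by
  have hY := h.Y_pos
  have h0 := h.η_pos
  have hμ := h.μ_pos
  refine le_of_mul_le_mul_right ?_ (pow_pos hY 3)
  calc η * Y ^ 10 * Y ^ 3 = η * Y ^ 13 := by ring
    _ ≤ 2 * μ * ε := h.η_mul_le
    _ ≤ 2 * μ * Y ^ 3 := by gcongr; exact h.ε_le

/-- A window has I ≈ Y / (η √(ρε)) steps, so η² I is of order ηY / √(ρε); the factor ε in the bound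
on η, with ε ≤ Y² √(ρε), compensates the root. The remaining power of Y absorbs all constants of the
one-step coupling estimate. -/
theorem sq_η_mul_I_le (h : IsAdmissible d Y δ η r α a b L ρ fmax σ μ ε I) :
    η ^ 2 * I * Y ^ 10 ≤ 4 * μ := by
  have hY := h.Y_pos
  have h0 := h.η_pos
  have hμ := h.μ_pos
  have hS := h.rate_pos
  have hI : (0 : ℝ) ≤ I := Nat.cast_nonneg I
  refine le_of_mul_le_mul_right ?_ (pow_pos hY 3)
  calc η ^ 2 * I * Y ^ 10 * Y ^ 3 = η * I * (η * Y ^ 13) := by ring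
    _ ≤ η * I * (2 * μ * (Y ^ 2 * √(ρ * ε))) := by
      refine mul_le_mul_of_nonneg_left (h.η_mul_le.trans ?_) (by positivity)
      gcongr
      exact h.ε_le_rate
    _ = 2 * μ * Y ^ 2 * (η * √(ρ * ε) * I) := by ring
    _ ≤ 2 * μ * Y ^ 2 * (2 * Y) := mul_le_mul_of_nonneg_left h.window_le (by positivity)
    _ = 4 * μ * Y ^ 3 := by ring

theorem I_pos (h : IsAdmissible d Y δ η r α a b L ρ fmax σ μ ε I) : 0 < I := by
  rcases Nat.eq_zero_or_pos I with rfl | hI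
  · have := h.le_window
    simp at this
    linarith [h.Y_pos]
  · exact hI

/-- The artificial noise dominates the stochastic gradient variance with a factor α to spare. For α
= d this keeps even the noise r²/d in the single direction v above σ², as `saddle_variance`
requires. -/
theorem sq_noise_ge (h : IsAdmissible d Y δ η r α a b L ρ fmax σ μ ε I) :
    α * Y ^ 4 ≤ r ^ 2 := by
  have hY := h.Y_pos
  have h0 := h.η_pos
  refine le_of_mul_le_mul_right ?_ (by positivity : 0 < η * Y ^ 12)
  calc α * Y ^ 4 * (η * Y ^ 12) = η * α * Y ^ 16 := by ring
    _ ≤ ε ^ 2 := h.η_mul_α_le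
    _ = r ^ 2 * (η * Y ^ 12) := by rw [← h.η_mul_sq]; ring

theorem variance_le_sq_noise (h : IsAdmissible d Y δ η r α a b L ρ fmax σ μ ε I) :
    σ ^ 2 ≤ r ^ 2 := by
  have hY := h.large
  calc σ ^ 2 ≤ 1 * Y ^ 2 := by
        rw [one_mul]; exact pow_le_pow_left₀ h.σ_nonneg h.σ_le 2
    _ ≤ α * Y ^ 4 :=
      mul_le_mul h.α_ge (pow_le_pow_right₀ (by linarith) (by norm_num)) (by positivity)
        (by linarith [h.α_ge])
    _ ≤ r ^ 2 := h.sq_noise_ge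

theorem saddle_smooth (h : IsAdmissible d Y δ η r α a b L ρ fmax σ μ ε I) :
    30000 * (η * L) ^ 2 ≤ 1 / I * μ := by
  have hY := h.large
  have hY0 := h.Y_pos
  have h0 := h.η_pos
  have hμ := h.μ_pos
  have hI : (0 : ℝ) < I := by exact_mod_cast h.I_pos
  rw [one_div_mul_eq_div, le_div_iff₀ hI]
  have h1 : (η * L) ^ 2 * I ≤ η ^ 2 * I * Y ^ 2 := by
    have : L ^ 2 ≤ Y ^ 2 := pow_le_pow_left₀ h.L_pos.le h.L_le 2
    calc (η * L) ^ 2 * I = η ^ 2 * I * L ^ 2 := by ring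
      _ ≤ η ^ 2 * I * Y ^ 2 := by gcongr
  have h2 : η ^ 2 * I * Y ^ 2 * Y ^ 8 ≤ 4 * μ := by linarith [h.sq_η_mul_I_le]
  have h3 : (120000 : ℝ) ≤ Y ^ 8 := by
    calc (120000 : ℝ) ≤ 100000 ^ 8 := by norm_num
      _ ≤ Y ^ 8 := by gcongr
  have h4 : η ^ 2 * I * Y ^ 2 * 120000 ≤ η ^ 2 * I * Y ^ 2 * Y ^ 8 := by gcongr
  linarith

theorem saddle_gap (h : IsAdmissible d Y δ η r α a b L ρ fmax σ μ ε I) :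
    120000 * (η ^ 2 * a) ≤ 1 / I := by
  have hY := h.large
  have hY0 := h.Y_pos
  have h0 := h.η_pos
  have hI : (0 : ℝ) < I := by exact_mod_cast h.I_pos
  rw [le_div_iff₀ hI]
  have h1 : η ^ 2 * a * I ≤ η ^ 2 * I * Y ^ 2 := by
    calc η ^ 2 * a * I = η ^ 2 * I * a := by ring
      _ ≤ η ^ 2 * I * Y ^ 2 := by gcongr; exact h.a_le
  have h2 : η ^ 2 * I * Y ^ 2 * Y ^ 8 ≤ 4 := by linarith [h.sq_η_mul_I_le, h.μ_le]
  have h3 : (480000 : ℝ) ≤ Y ^ 8 := by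
    calc (480000 : ℝ) ≤ 100000 ^ 8 := by norm_num
      _ ≤ Y ^ 8 := by gcongr
  have h4 : η ^ 2 * I * Y ^ 2 * 480000 ≤ η ^ 2 * I * Y ^ 2 * Y ^ 8 := by gcongr
  linarith

theorem saddle_variance (h : IsAdmissible d Y δ η r α a b L ρ fmax σ μ ε I) :
    2 * b ≤ 1 / 5000 * (4 * (r ^ 2 / d)) := by
  have hY := h.large
  have hY0 := h.Y_pos
  have hα := h.α_ge
  have hd : (0 : ℝ) < d := by exact_mod_cast h.one_le_dim
  have h1 : b * d ≤ 4 * (α * Y ^ 2) := by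
    have : σ ^ 2 ≤ Y ^ 2 := pow_le_pow_left₀ h.σ_nonneg h.σ_le 2
    have : σ ^ 2 * α ≤ Y ^ 2 * α := by gcongr
    linarith [h.b_le]
  have h2 : α * Y ^ 2 * 10000 ≤ r ^ 2 := by
    refine le_trans ?_ h.sq_noise_ge
    calc α * Y ^ 2 * 10000 ≤ α * Y ^ 2 * Y ^ 2 := by gcongr; nlinarith
      _ = α * Y ^ 4 := by ring
  have h3 : 2 * b = 2 * (b * d) / d := by field_simp
  have h4 : 1 / 5000 * (4 * (r ^ 2 / d)) = 1 / 1250 * r ^ 2 / d := by ring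
  rw [h3, h4]
  exact div_le_div_of_nonneg_right (by linarith) hd.le

/-- The lower bound β on the window defects is I ε² / Y^8. Gradient and noise contributions are each
at most 4 ε / (ρ Y^6) before the factors, and 36 = 3 · (2 · 4 + 4). -/
theorem saddle_distance (h : IsAdmissible d Y δ η r α a b L ρ fmax σ μ ε I) :
    3 * (2 * I * η ^ 2 * (I * ε ^ 2 / Y ^ 8) + I * η ^ 2 * (σ ^ 2 + r ^ 2)) ≤
      36 * ε / (ρ * Y ^ 6) := by
  have hY := h.large
  have hY0 := h.Y_pos
  have hε := h.ε_pos
  have hρ := h.ρ_pos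
  have hη := h.η_pos
  have hS := h.rate_pos
  have hI : (0 : ℝ) < I := by exact_mod_cast h.I_pos
  have h1 : (η * I) ^ 2 * (ρ * ε) ≤ 4 * Y ^ 2 := by
    calc (η * I) ^ 2 * (ρ * ε) = (η * √(ρ * ε) * I) ^ 2 := by
          rw [mul_pow (η * √(ρ * ε)), mul_pow η √(ρ * ε), h.sq_rate]; ring
      _ ≤ (2 * Y) ^ 2 := pow_le_pow_left₀ (by positivity) h.window_le 2
      _ = 4 * Y ^ 2 := by ring
  have h2 : I * η ^ 2 * (I * ε ^ 2 / Y ^ 8) ≤ 4 * (ε / (ρ * Y ^ 6)) := by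
    calc I * η ^ 2 * (I * ε ^ 2 / Y ^ 8) = (η * I) ^ 2 * (ρ * ε) * (ε / (ρ * Y ^ 8)) := by
          field_simp
      _ ≤ 4 * Y ^ 2 * (ε / (ρ * Y ^ 8)) := by gcongr
      _ = 4 * (ε / (ρ * Y ^ 6)) := by field_simp
  have h3 : I * η * ε ≤ 2 * Y ^ 3 := by
    calc I * η * ε ≤ I * η * (Y ^ 2 * √(ρ * ε)) := by gcongr; exact h.ε_le_rate
      _ = Y ^ 2 * (η * √(ρ * ε) * I) := by ring
      _ ≤ Y ^ 2 * (2 * Y) := mul_le_mul_of_nonneg_left h.window_le (by positivity)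
      _ = 2 * Y ^ 3 := by ring
  have h4 : I * η ^ 2 * (σ ^ 2 + r ^ 2) ≤ 4 * (ε / (ρ * Y ^ 6)) := by
    calc I * η ^ 2 * (σ ^ 2 + r ^ 2) ≤ I * η ^ 2 * (r ^ 2 + r ^ 2) :=
          mul_le_mul_of_nonneg_left (add_le_add_left h.variance_le_sq_noise _) (by positivity)
      _ = 2 * (I * η) * (η * r ^ 2 * Y ^ 12 / Y ^ 12) := by field_simp; ring
      _ = 2 * (I * η * ε) * (ε / Y ^ 12) := by rw [h.η_mul_sq]; ring
      _ ≤ 2 * (2 * Y ^ 3) * (ε / Y ^ 12) := by gcongr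
      _ = 4 * (ε / (Y ^ 3 * Y ^ 6)) := by field_simp; ring
      _ ≤ 4 * (ε / (ρ * Y ^ 6)) := by
        gcongr
        refine h.ρ_le.trans (le_self_pow₀ (by linarith) (by norm_num))
  have h5 : 36 * ε / (ρ * Y ^ 6) = 36 * (ε / (ρ * Y ^ 6)) := by ring
  rw [h5]
  linarith

/-- Localisation at scale 6 √(ε/ρ) / Y³ over a window of η √(ρε) I ≤ 2Y gives an accumulated drift
of order 1/Y, so the weight in `gapEnergy` costs only a constant. -/
theorem saddle_local (h : IsAdmissible d Y δ η r α a b L ρ fmax σ μ ε I) :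
    2 * η * ρ * (I * √(36 * ε / (ρ * Y ^ 6)) + 2 * √(I * (I * ε ^ 2 / Y ^ 8))) ≤ 1 / 3500 := by
  have hY := h.large
  have hY0 := h.Y_pos
  have hε := h.ε_pos
  have hρ := h.ρ_pos
  have hη := h.η_pos
  have hS := h.rate_pos
  have hI : (0 : ℝ) < I := by exact_mod_cast h.I_pos
  have e1 : √(36 * ε / (ρ * Y ^ 6)) = 6 * √(ρ * ε) / (ρ * Y ^ 3) := by
    rw [Real.sqrt_eq_iff_eq_sq (by positivity) (by positivity), div_pow, mul_pow, h.sq_rate]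
    field_simp
    ring
  have e2 : √(I * (I * ε ^ 2 / Y ^ 8)) = I * ε / Y ^ 4 := by
    rw [Real.sqrt_eq_iff_eq_sq (by positivity) (by positivity)]
    field_simp
  have h1 : η * √(ρ * ε) * I * √(ρ * ε) ≤ 2 * Y * Y ^ 2 :=
    mul_le_mul h.window_le h.rate_le hS.le (by positivity)
  rw [e1, e2]
  calc 2 * η * ρ * (I * (6 * √(ρ * ε) / (ρ * Y ^ 3)) + 2 * (I * ε / Y ^ 4))
      = 12 * (η * √(ρ * ε) * I) / Y ^ 3 + 4 * (η * (ρ * ε) * I) / Y ^ 4 := by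
        field_simp
        ring
    _ = 12 * (η * √(ρ * ε) * I) / Y ^ 3 + 4 * (η * √(ρ * ε) * I * √(ρ * ε)) / Y ^ 4 := by
        have : η * √(ρ * ε) * I * √(ρ * ε) = η * √(ρ * ε) ^ 2 * I := by ring
        rw [this, h.sq_rate]
    _ ≤ 12 * (2 * Y) / Y ^ 3 + 4 * (2 * Y * Y ^ 2) / Y ^ 4 := by
        refine add_le_add (div_le_div_of_nonneg_right ?_ (by positivity))
          (div_le_div_of_nonneg_right ?_ (by positivity))
        · linarith [h.window_le]
        · linarith
    _ = 24 / Y ^ 2 + 8 / Y := by field_simp; ring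
    _ ≤ 24 / 100000 ^ 2 + 8 / 100000 := by gcongr
    _ ≤ 1 / 3500 := by norm_num

theorem saddle_growth (h : IsAdmissible d Y δ η r α a b L ρ fmax σ μ ε I) :
    640 * (36 * ε / (ρ * Y ^ 6)) ≤
      ((1 + η * √(ρ * ε)) ^ 2) ^ (I - 1) * (4 * (r ^ 2 / d) * η ^ 2) := by
  have hY0 := h.Y_pos
  have hε := h.ε_pos
  have hρ := h.ρ_pos
  have hη := h.η_pos
  have hd : (0 : ℝ) < d := by exact_mod_cast h.one_le_dim
  have hg := h.growth
  generalize ((1 + η * √(ρ * ε)) ^ 2) ^ (I - 1) = E at hg ⊢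
  have e1 : 640 * (36 * ε / (ρ * Y ^ 6)) =
      5760 * d * Y ^ 6 * (4 * ε / (ρ * Y ^ 12 * d)) := by field_simp; ring
  have e2 : E * (4 * (r ^ 2 / d) * η ^ 2) = E * (ρ * ε * η) * (4 * ε / (ρ * Y ^ 12 * d)) := by
    have : r ^ 2 = ε ^ 2 / (η * Y ^ 12) := by
      rw [← h.η_mul_sq]; field_simp
    rw [this]
    field_simp
  rw [e1, e2]
  gcongr

theorem η_mul_L_le (h : IsAdmissible d Y δ η r α a b L ρ fmax σ μ ε I) : η * L ≤ 1 / 2 := by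
  have hY := h.large
  have hY0 := h.Y_pos
  have hη := h.η_pos
  have h1 := h.η_mul_pow_le
  have h2 := h.μ_le
  have h3 : Y * 4 ≤ Y ^ 10 := by
    calc Y * 4 ≤ Y * Y ^ 9 := by
          gcongr
          calc (4 : ℝ) ≤ 100000 ^ 9 := by norm_num
            _ ≤ Y ^ 9 := by gcongr
      _ = Y ^ 10 := by ring
  have h4 : η * (Y * 4) ≤ η * Y ^ 10 := by gcongr
  have h5 : η * L ≤ η * Y := by gcongr; exact h.L_le
  linarith

theorem sq_η_mul_le (h : IsAdmissible d Y δ η r α a b L ρ fmax σ μ ε I) :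
    16 * η ^ 2 * (L ^ 2 + 1) ≤ μ ^ 2 := by
  have hY := h.large
  have hY0 := h.Y_pos
  have hη := h.η_pos
  have hL := h.L_pos
  have hμ := h.μ_pos
  have h1 := h.η_mul_pow_le
  have h3 : 8 * (Y + 1) ≤ Y ^ 10 := by
    calc 8 * (Y + 1) ≤ Y * Y := by nlinarith
      _ = Y ^ 2 := by ring
      _ ≤ Y ^ 10 := pow_le_pow_right₀ (by linarith) (by norm_num)
  have h4 : η * (8 * (Y + 1)) ≤ η * Y ^ 10 := by gcongr
  have h5 : 4 * η * (L + 1) ≤ μ := by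
    have : η * L ≤ η * Y := by gcongr; exact h.L_le
    linarith
  calc 16 * η ^ 2 * (L ^ 2 + 1) ≤ 16 * η ^ 2 * (L + 1) ^ 2 := by
        gcongr
        nlinarith
    _ = (4 * η * (L + 1)) ^ 2 := by ring
    _ ≤ μ ^ 2 := by gcongr

/-- The noise level is chosen with η r² = ε² / Y^12, so the floor lies far enough below the average
defect ε² / Y^8 charged to a saddle point. -/
theorem noiseFloor_le (h : IsAdmissible d Y δ η r α a b L ρ fmax σ μ ε I) :
    noiseFloor η r σ μ L ≤ 2 * ε ^ 2 / Y ^ 11 := by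
  have hY := h.large
  have hY0 := h.Y_pos
  have hη := h.η_pos
  have hL := h.L_pos
  have hμ := h.μ_pos
  have h1 : (L ^ 2 + 1) / μ * η ≤ 1 / 2 := by
    have : L ^ 2 + 1 ≤ Y ^ 10 / 4 := by
      calc L ^ 2 + 1 ≤ Y ^ 2 + 1 := by gcongr; exact h.L_le
        _ ≤ Y * Y ^ 2 / 4 := by nlinarith [pow_pos hY0 2]
        _ = Y ^ 3 / 4 := by ring
        _ ≤ Y ^ 10 / 4 := by
          gcongr
          · linarith
          · norm_num
    rw [div_mul_eq_mul_div, div_le_iff₀ hμ]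
    calc (L ^ 2 + 1) * η ≤ Y ^ 10 / 4 * η := by gcongr
      _ ≤ 1 / 2 * μ := by linarith [h.η_mul_pow_le]
  calc noiseFloor η r σ μ L ≤ (L * η / 2 + (L ^ 2 + 1) / μ * η ^ 2) * (r ^ 2 + r ^ 2) := by
        rw [noiseFloor]
        exact mul_le_mul_of_nonneg_left (add_le_add_left h.variance_le_sq_noise _) (by positivity)
    _ = (L + 2 * ((L ^ 2 + 1) / μ * η)) * (η * r ^ 2 * Y ^ 12 / Y ^ 12) := by
        field_simp
        ring
    _ ≤ (Y + 2 * (1 / 2)) * (η * r ^ 2 * Y ^ 12 / Y ^ 12) := by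
        gcongr
        exact h.L_le
    _ ≤ (2 * Y) * (η * r ^ 2 * Y ^ 12 / Y ^ 12) := by
        gcongr
        linarith
    _ = 2 * ε ^ 2 / Y ^ 11 := by rw [h.η_mul_sq]; field_simp

theorem window_le_of_le (h : IsAdmissible d Y δ η r α a b L ρ fmax σ μ ε I) {T : ℕ}
    (hT : Y ^ 12 ≤ T * (ε ^ 2 * η)) : (I : ℝ) ≤ T := by
  have hY := h.large
  have hY0 := h.Y_pos
  have hη := h.η_pos
  have hε := h.ε_pos
  have hI : (0 : ℝ) < I := by exact_mod_cast h.I_pos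
  have hS := h.rate_pos
  refine le_of_mul_le_mul_right (le_trans ?_ hT) (by positivity : 0 < ε ^ 2 * η)
  calc I * (ε ^ 2 * η) = I * η * (ε * ε) := by ring
    _ ≤ I * η * (Y ^ 3 * (Y ^ 2 * √(ρ * ε))) := by
      gcongr
      · exact h.ε_le
      · exact h.ε_le_rate
    _ = Y ^ 5 * (η * √(ρ * ε) * I) := by ring
    _ ≤ Y ^ 5 * (2 * Y) := mul_le_mul_of_nonneg_left h.window_le (by positivity)
    _ = Y ^ 6 * 2 := by ring
    _ ≤ Y ^ 6 * Y ^ 6 := by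
      gcongr
      calc (2 : ℝ) ≤ 100000 ^ 6 := by norm_num
        _ ≤ Y ^ 6 := by gcongr
    _ = Y ^ 12 := by ring

/-- Both the range of f, divided by the number of steps, and the noise floor contribute O(1/Y³) to
the fraction of bad points. The count weight of a saddle is only Y^8 / ε² up to a constant, because
β is proportional to I. -/
theorem count_le (h : IsAdmissible d Y δ η r α a b L ρ fmax σ μ ε I) {T : ℕ}
    (hT : Y ^ 12 ≤ T * (ε ^ 2 * η)) :
    (1 / ε ^ 2 + 2 * I / (I * ε ^ 2 / Y ^ 8)) *
      (8 / η * (fmax + (T + I) * (η * noiseFloor η r σ μ L))) ≤ δ / 2 * T := by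
  have hY := h.large
  have hY0 := h.Y_pos
  have hη := h.η_pos
  have hε := h.ε_pos
  have hT0 : (0 : ℝ) ≤ T := Nat.cast_nonneg T
  have hI : (0 : ℝ) < I := by exact_mod_cast h.I_pos
  have h1 : 1 / ε ^ 2 + 2 * I / (I * ε ^ 2 / Y ^ 8) ≤ 3 * Y ^ 8 / ε ^ 2 := by
    have : 1 / ε ^ 2 + 2 * I / (I * ε ^ 2 / Y ^ 8) = (1 + 2 * Y ^ 8) / ε ^ 2 := by field_simp
    rw [this]
    gcongr
    have : 1 ≤ Y ^ 8 := one_le_pow₀ (by linarith)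
    linarith
  have h2 : fmax + (T + I) * (η * noiseFloor η r σ μ L) ≤
      Y + (T + T) * (η * (2 * ε ^ 2 / Y ^ 11)) := by
    have hnf : 0 ≤ noiseFloor η r σ μ L := by
      have := h.L_pos
      have := h.μ_pos
      rw [noiseFloor]
      positivity
    gcongr
    · exact h.fmax_le
    · exact_mod_cast h.window_le_of_le hT
    · exact h.noiseFloor_le
  have h3 : Y ^ 9 / (η * ε ^ 2) ≤ T / Y ^ 3 := by
    rw [div_le_div_iff₀ (by positivity) (by positivity)]
    linarith
  calc _ ≤ 3 * Y ^ 8 / ε ^ 2 * (8 / η * (Y + (T + T) * (η * (2 * ε ^ 2 / Y ^ 11)))) := by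
        refine (mul_le_mul_of_nonneg_left (mul_le_mul_of_nonneg_left h2 (by positivity))
          (by positivity)).trans (mul_le_mul_of_nonneg_right h1 (by positivity))
    _ = 24 * (Y ^ 9 / (η * ε ^ 2)) + 96 * (T / Y ^ 3) := by field_simp; ring
    _ ≤ 120 * (T / Y ^ 3) := by linarith
    _ = T * (120 / Y ^ 3) := by ring
    _ ≤ T * (δ / 2) := by
        refine mul_le_mul_of_nonneg_left ?_ hT0
        rw [div_le_iff₀ (by positivity)]
        have h4 : Y * 1 ≤ Y * (δ * Y) := mul_le_mul_of_nonneg_left h.δ_ge hY0.le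
        have h5 : Y * (Y * 1) ≤ Y * (Y * (δ * Y)) := mul_le_mul_of_nonneg_left h4 hY0.le
        nlinarith
    _ = δ / 2 * T := by ring

end IsAdmissible

variable {Θ Θ' : Type*} [MeasurableSpace Θ] [MeasurableSpace Θ'] {D : Measure Θ} {D' : Measure Θ'}
  [IsProbabilityMeasure D] [IsProbabilityMeasure D'] {f : Vec d → ℝ} {G : Vec d → Θ → Vec d}
  {Cmp : Vec d → Θ' → Vec d}

/-- With admissible parameters, few of the visited points fail to be second-order stationary. -/
theorem IsAdmissible.sum_measureReal_not_isSOSP_le {I : ℕ}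
    (h : IsAdmissible d Y δ η r α a b L ρ fmax σ μ ε I)
    (hf : IsRegularObjective f fmax L ρ) (hG : IsStochasticGradient f G D σ)
    (hC : IsCompressor Cmp D' μ) (hlin : IsLinearCompressor Cmp)
    (hgap : ∀ x x', ∫ θ, ‖(G x θ - ∇ f x) - (G x' θ - ∇ f x')‖ ^ 2 ∂D ≤ a * ‖x - x'‖ ^ 2 + b)
    {T : ℕ} (hT : Y ^ 12 ≤ T * (ε ^ 2 * η)) (x₀ : Vec d) :
    ∑ t ∈ Finset.range T, (sgdLaw η r G Cmp D D' (x₀, 0) t).real {s | ¬ IsSOSP f ρ ε s.1} ≤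
      δ / 2 * T := by
  have hI : (0 : ℝ) < I := by exact_mod_cast h.I_pos
  have hε := h.ε_pos
  have hY0 := h.Y_pos
  refine (_root_.sum_measureReal_not_isSOSP_le h.one_le_dim hf h.L_pos h.ρ_pos.le hG hC h.μ_pos
    h.μ_le h.η_pos hε (I := I) (β := I * ε ^ 2 / Y ^ 8) (by positivity) h.η_mul_L_le
    h.sq_η_mul_le (fun s₀ hx hns => ?_) x₀ T).trans (h.count_le hT)
  exact le_sum_defect_of_not_isSOSP h.one_le_dim hf h.L_pos h.ρ_pos.le hG hC hlin h.μ_pos h.μ_le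
    h.η_pos (h.η_mul_L_le.trans (by norm_num)) h.r_pos h.a_nonneg hgap h.I_pos h.saddle_smooth
    h.saddle_gap h.saddle_variance h.saddle_distance h.saddle_local h.saddle_growth hx hns

end Parameters

/-! ### Existence of admissible parameters -/

section Choice

variable {d : ℕ} {σ μ fmax L ρ a b ε α δ Y M : ℝ}

theorem exists_forall_pow_le_exp (δ : ℝ) :
    ∃ K : ℝ, 100000 ≤ K ∧ 1 / δ ≤ K ∧ ∀ Y, K ≤ Y → 5760 * Y ^ 23 ≤ Real.exp (Y / 2) := by
  have h := (isLittleO_pow_exp_pos_mul_atTop 23 (by norm_num : (0 : ℝ) < 1 / 2)).def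
    (by norm_num : (0 : ℝ) < 1 / 5760)
  obtain ⟨K, hK⟩ := Filter.eventually_atTop.1 h
  refine ⟨max K (max 100000 (1 / δ)), by simp, by simp, fun Y hY => ?_⟩
  have hY' : 100000 ≤ Y := (by simp : (100000 : ℝ) ≤ max K (max 100000 (1 / δ))).trans hY
  have := hK Y ((le_max_left _ _).trans hY)
  rw [Real.norm_of_nonneg (by positivity), Real.norm_of_nonneg (Real.exp_pos _).le] at this
  have e : 1 / 2 * Y = Y / 2 := by ring
  rw [e] at this
  linarith

/-- From exp(-u/2) ≥ 1 - u/2 and (1 + u)(1 - u/2) ≥ 1 on [0, 1]. It converts the discrete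
amplification into an exponential with no loss in the rate. -/
theorem exp_le_one_add_sq {u : ℝ} (hu : 0 ≤ u) (hu1 : u ≤ 1) : Real.exp u ≤ (1 + u) ^ 2 := by
  have h1 : 1 - u / 2 ≤ Real.exp (-(u / 2)) := by linarith [Real.add_one_le_exp (-(u / 2))]
  have h2 : Real.exp (u / 2) ≤ 1 + u := by
    have h3 : Real.exp (u / 2) * Real.exp (-(u / 2)) = 1 := by rw [← Real.exp_add]; simp
    have h4 : 1 ≤ (1 + u) * Real.exp (-(u / 2)) := by
      refine le_trans ?_ (mul_le_mul_of_nonneg_left h1 (by linarith))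
      nlinarith
    exact le_of_mul_le_mul_right (h3.le.trans h4) (Real.exp_pos _)
  calc Real.exp u = Real.exp (u / 2) ^ 2 := by rw [← Real.exp_nat_mul]; congr 1; push_cast; ring
    _ ≤ (1 + u) ^ 2 := pow_le_pow_left₀ (Real.exp_pos _).le h2 2

/-- The choice of the step size `stepScale α μ ε / Y ^ 16` and of the noise level. -/
theorem exists_isAdmissible (hd : 1 ≤ d) (hY : 100000 ≤ Y) (hL : 0 < L) (hLY : L ≤ Y)
    (hρ : 0 < ρ) (hρY : ρ ≤ Y) (hρY' : 1 ≤ Y * ρ) (hfmax : fmax ≤ Y) (hσ : 0 ≤ σ) (hσY : σ ≤ Y)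
    (hδ : 1 ≤ δ * Y) (hμ : 0 < μ) (hμ1 : μ ≤ 1) (hε : 0 < ε) (hεY : ε ≤ Y ^ 3) (hα : 1 ≤ α)
    (ha : 0 ≤ a) (haY : a ≤ Y ^ 2) (hb : b * d ≤ 4 * σ ^ 2 * α) (hM : 1 ≤ M) (hdM : d ≤ M)
    (hαM : α ≤ M) (hεM : 1 / ε ≤ M) (hμM : 1 / μ ≤ M) (hMY : M ^ 5 ≤ Real.exp (Y / 10))
    (hexp : 5760 * Y ^ 23 ≤ Real.exp (Y / 2)) :
    ∃ η r I, η = stepScale α μ ε / Y ^ 16 ∧ r = ε / √η / Y ^ 6 ∧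
      IsAdmissible d Y δ η r α a b L ρ fmax σ μ ε I := by
  have hY0 : 0 < Y := by linarith
  have hs : 0 < stepScale α μ ε := stepScale_pos (by linarith) hε
  obtain ⟨η, hη⟩ : ∃ η, η = stepScale α μ ε / Y ^ 16 := ⟨_, rfl⟩
  have hsη : stepScale α μ ε = η * Y ^ 16 := by rw [hη]; field_simp
  have hη0 : 0 < η := hη ▸ by positivity
  have hS0 : 0 < √(ρ * ε) := Real.sqrt_pos.2 (mul_pos hρ hε)
  -- Three of the sixteen powers of Y pay for the bound ε ≤ Y³ on the accuracy.
  have hηY : η * Y ^ 13 ≤ 2 * μ * ε := by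
    have h := stepScale_le_mul hα hε hμ (one_le_pow₀ (by linarith)) hεY
    rw [hsη] at h
    refine le_of_mul_le_mul_right ?_ (pow_pos hY0 3)
    calc η * Y ^ 13 * Y ^ 3 = η * Y ^ 16 := by ring
      _ ≤ _ := h
  set u := η * √(ρ * ε) with hu
  have hu0 : 0 < u := mul_pos hη0 hS0
  have hu1 : u ≤ 1 := by
    have h1 : √(ρ * ε) ≤ Y ^ 2 := by
      refine Real.sqrt_le_iff.2 ⟨by positivity, ?_⟩
      calc ρ * ε ≤ Y * Y ^ 3 := mul_le_mul hρY hεY hε.le hY0.le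
        _ = (Y ^ 2) ^ 2 := by ring
    have h2 : 2 ≤ Y ^ 8 := by
      calc (2 : ℝ) ≤ 100000 ^ 8 := by norm_num
        _ ≤ Y ^ 8 := by gcongr
    refine le_of_mul_le_mul_right ?_ (pow_pos hY0 13)
    calc u * Y ^ 13 = η * Y ^ 13 * √(ρ * ε) := by rw [hu]; ring
      _ ≤ 2 * μ * ε * Y ^ 2 := mul_le_mul hηY h1 hS0.le (by positivity)
      _ ≤ 2 * 1 * Y ^ 3 * Y ^ 2 := by gcongr
      _ = 2 * Y ^ 5 := by ring
      _ ≤ Y ^ 8 * Y ^ 5 := by gcongr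
      _ = 1 * Y ^ 13 := by ring
  -- Y times the escape time 1/u; rounding up overshoots the window by at most u ≤ 1.
  obtain ⟨I, hI⟩ : ∃ I, I = ⌈Y / u⌉₊ := ⟨_, rfl⟩
  have hIge : Y / u ≤ I := hI ▸ Nat.le_ceil _
  have hIlt : (I : ℝ) < Y / u + 1 := hI ▸ Nat.ceil_lt_add_one (by positivity)
  have hIpos : 1 ≤ I := by
    rw [hI]; exact Nat.ceil_pos.2 (by positivity)
  have hwin : Y ≤ u * I := by rw [div_le_iff₀ hu0] at hIge; linarith
  have hwin' : u * I ≤ Y + u := by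
    have := mul_le_mul_of_nonneg_left hIlt.le hu0.le
    rw [mul_add, mul_div_cancel₀ _ hu0.ne'] at this
    linarith
  refine ⟨η, ε / √η / Y ^ 6, I, hη, rfl, ?_⟩
  refine ⟨hd, hY, hL, hLY, hρ, hρY, hρY', hfmax, hσ, hσY, hδ, hμ, hμ1, hε, hεY, hη0, by positivity,
    hα, ha, haY, hb, ?_, hηY, ?_, hwin, by linarith, ?_⟩
  · have h := stepScale_mul_le (μ := μ) (by linarith : 0 < α) hε
    rw [hsη] at h
    linarith
  · rw [div_pow, div_pow, Real.sq_sqrt hη0.le]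
    field_simp
  · have hE : Real.exp (Y - 1) ≤ ((1 + u) ^ 2) ^ (I - 1) := by
      calc Real.exp (Y - 1) ≤ Real.exp (((I - 1 : ℕ) : ℝ) * u) := by
            rw [Nat.cast_sub hIpos, Real.exp_le_exp]
            push_cast
            linarith
        _ = Real.exp u ^ (I - 1) := Real.exp_nat_mul _ _
        _ ≤ _ := pow_le_pow_left₀ (Real.exp_pos _).le (exp_le_one_add_sq hu0.le hu1) _
    have h1 : (d : ℝ) ≤ M ^ 2 * ε := by
      have : 1 ≤ M * ε := by rwa [div_le_iff₀ hε] at hεM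
      calc (d : ℝ) ≤ M * 1 := by linarith
        _ ≤ M * (M * ε) := by gcongr
        _ = M ^ 2 * ε := by ring
    have h2 : 1 ≤ Y ^ 16 * M ^ 3 * η := by
      have h := inv_stepScale_le hε hμ hM hαM hεM hμM
      rw [hsη, inv_le_iff_one_le_mul₀ (by positivity)] at h
      linarith
    -- Half of the exponent beats the power of Y and a tenth beats M^5: M² comes from d ≤ M² ε and
    -- M³ from 1/η.
    have h3 : 5760 * Y ^ 23 * M ^ 5 ≤ Real.exp (Y - 1) := by
      calc 5760 * Y ^ 23 * M ^ 5 ≤ Real.exp (Y / 2) * Real.exp (Y / 10) := by gcongr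
        _ = Real.exp (Y / 2 + Y / 10) := (Real.exp_add _ _).symm
        _ ≤ Real.exp (Y - 1) := Real.exp_le_exp.2 (by linarith)
    calc 5760 * d * Y ^ 6 = 5760 * Y ^ 6 * (d * (1 * 1)) := by ring
      _ ≤ 5760 * Y ^ 6 * (M ^ 2 * ε * (Y * ρ * (Y ^ 16 * M ^ 3 * η))) := by gcongr
      _ = 5760 * Y ^ 23 * M ^ 5 * (ρ * ε * η) := by ring
      _ ≤ ((1 + u) ^ 2) ^ (I - 1) * (ρ * ε * η) := by
        gcongr
        exact h3.trans hE

theorem exists_iteration_bound {η : ℝ} (hY : 100000 ≤ Y) (hα : 1 ≤ α) (hε : 0 < ε)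
    (hεY : ε ≤ Y ^ 3) (hμ : 0 < μ) (hμ1 : μ ≤ 1) (hη : η = stepScale α μ ε / Y ^ 16) :
    ∃ T₀ : ℕ, Y ^ 12 ≤ T₀ * (ε ^ 2 * η) ∧ (T₀ : ℝ) ≤ Y ^ 30 * (1 / (ε ^ 2 * η)) ∧
      (T₀ : ℝ) ≤ Y ^ 30 * iterationScale α μ ε := by
  have hY0 : 0 < Y := by linarith
  have hα0 : 0 < α := by linarith
  have hs := stepScale_pos (μ := μ) hα0 hε
  have hη0 : 0 < η := hη ▸ by positivity
  have hsη : stepScale α μ ε = η * Y ^ 16 := by rw [hη]; field_simp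
  have h1 : 1 ≤ Y ^ 12 / (ε ^ 2 * η) := by
    rw [one_le_div (by positivity)]
    have h := stepScale_mul_le (μ := μ) hα0 hε
    rw [hsη] at h
    calc ε ^ 2 * η = ε ^ 2 * (η * 1 * 1) := by ring
      _ ≤ ε ^ 2 * (η * Y ^ 16 * α) := by
        gcongr
        exact one_le_pow₀ (by linarith)
      _ ≤ ε ^ 2 * ε ^ 2 := by gcongr
      _ = ε ^ 4 := by ring
      _ ≤ (Y ^ 3) ^ 4 := by gcongr
      _ = Y ^ 12 := by ring
  have h2 : (⌈Y ^ 12 / (ε ^ 2 * η)⌉₊ : ℝ) ≤ 2 * (Y ^ 12 / (ε ^ 2 * η)) := by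
    have := Nat.ceil_lt_add_one (by positivity : 0 ≤ Y ^ 12 / (ε ^ 2 * η))
    linarith
  have h3 : 2 ≤ Y ^ 2 := by nlinarith
  refine ⟨⌈Y ^ 12 / (ε ^ 2 * η)⌉₊, ?_, h2.trans ?_, h2.trans ?_⟩
  · rw [← div_le_iff₀ (by positivity)]
    exact Nat.le_ceil _
  · calc 2 * (Y ^ 12 / (ε ^ 2 * η)) ≤ Y ^ 18 * (Y ^ 12 / (ε ^ 2 * η)) := by
          gcongr
          exact h3.trans (pow_le_pow_right₀ (by linarith) (by norm_num))
      _ = Y ^ 30 * (1 / (ε ^ 2 * η)) := by ring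
  · calc 2 * (Y ^ 12 / (ε ^ 2 * η)) ≤ Y ^ 2 * (Y ^ 12 / (ε ^ 2 * η)) := by gcongr
      _ = Y ^ 30 * ((stepScale α μ ε)⁻¹ / ε ^ 2) := by rw [hsη]; field_simp
      _ ≤ Y ^ 30 * iterationScale α μ ε := by
        gcongr
        exact inv_stepScale_div_le hα0 hε hμ hμ1

end Choice

/-! ### From the chain to the algorithm, and the theorem -/

section Conclusion

variable {d : ℕ} {Ω Θ Θ' : Type*} [MeasurableSpace Ω] [MeasurableSpace Θ] [MeasurableSpace Θ']
  {P : Measure Ω} {D : Measure Θ} {D' : Measure Θ'} [IsProbabilityMeasure P]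
  [IsProbabilityMeasure D] [IsProbabilityMeasure D'] {f : Vec d → ℝ} {G : Vec d → Θ → Vec d}
  {Cmp : Vec d → Θ' → Vec d} {ξ : ℕ → Ω → Vec d} {θ : ℕ → Ω → Θ} {θ' : ℕ → Ω → Θ'}
  {fmax L ρ σ μ ε η r δ : ℝ}

theorem sospCount_of_sum_sgdLaw_le (hf : IsRegularObjective f fmax L ρ) (hL : 0 ≤ L) (hρ : 0 ≤ ρ)
    (hG : IsStochasticGradient f G D σ) (hC : IsCompressor Cmp D' μ)
    (hsamples : AreSamples P r D D' ξ θ θ') (hδ₀ : 0 < δ) (hδ₁ : δ < 1) {x₀ : Vec d} {T : ℕ}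
    (hsum : ∑ t ∈ Finset.range T,
      (sgdLaw η r G Cmp D D' (x₀, 0) t).real {s | ¬ IsSOSP f ρ ε s.1} ≤ δ / 2 * T) :
    (T : ℝ) / 2 ≤ ∫ ω, (sospCount f ρ ε T (visitedPoint η G Cmp x₀ ξ θ θ' ω) : ℝ) ∂P ∧
      1 - δ ≤ P.real {ω | (T : ℝ) / 2 ≤
        (sospCount f ρ ε T (visitedPoint η G Cmp x₀ ξ θ θ' ω) : ℝ)} := by
  have hmap := map_compressedSGD (η := η) hG.measurable hC.measurable hsamples x₀
  refine sospCount_of_sum_le (X := fun t ω => visitedPoint η G Cmp x₀ ξ θ θ' ω t) hf hL hρ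
    (fun t => measurable_fst.comp (hmap t).1) hδ₀ hδ₁ (le_of_eq_of_le ?_ hsum)
  refine Finset.sum_congr rfl fun t _ => ?_
  rw [← (hmap t).2, map_measureReal_apply (hmap t).1]
  · rfl
  · exact measurable_fst (measurableSet_isSOSP hf hL hρ).compl

end Conclusion

theorem IsStochasticGradient.integral_gap_le_ite {d : ℕ} {Θ : Type*} [MeasurableSpace Θ]
    {D : Measure Θ} [IsProbabilityMeasure D] {f : Vec d → ℝ} {G : Vec d → Θ → Vec d} {σ ℓ : ℝ}
    (lip : Bool) (hG : IsStochasticGradient f G D σ)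
    (hl : lip = true → IsLipschitzStochasticGradient G ℓ) (x x' : Vec d) :
    ∫ θ, ‖(G x θ - ∇ f x) - (G x' θ - ∇ f x')‖ ^ 2 ∂D ≤
      (if lip then ℓ else 0) ^ 2 * ‖x - x'‖ ^ 2 + (if lip then 0 else 4 * σ ^ 2) := by
  cases lip
  · simpa using hG.integral_gap_le x x'
  · simpa using hG.integral_gap_le_of_lipschitz (hl rfl) x x'

/-- Supplies the two conditions of `isSOSP_of_large`, and fixes A³ as the threshold beyond which the
theorem is trivial. -/
theorem le_sq_and_sq_le_of_pow_le {A L ρ fmax ε : ℝ} (hL : 0 ≤ L) (hρ : 0 < ρ) (hfmax : 0 ≤ fmax)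
    (hA : 1 ≤ A) (hLA : L + fmax ≤ A) (hρA : 1 ≤ A * ρ) (hε : A ^ 3 ≤ ε) :
    2 * L * fmax ≤ ε ^ 2 ∧ L ^ 2 ≤ ρ * ε := by
  have hA0 : 0 < A := by linarith
  refine ⟨?_, ?_⟩
  · calc 2 * L * fmax ≤ (L + fmax) ^ 2 := by nlinarith [sq_nonneg L, sq_nonneg fmax]
      _ ≤ A ^ 2 := pow_le_pow_left₀ (by linarith) hLA 2
      _ ≤ (A ^ 3) ^ 2 := pow_le_pow_left₀ hA0.le (le_self_pow₀ hA (by norm_num)) 2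
      _ ≤ ε ^ 2 := pow_le_pow_left₀ (by positivity) hε 2
  · calc L ^ 2 ≤ 1 * A ^ 2 := by
          rw [one_mul]; exact pow_le_pow_left₀ hL (by linarith) 2
      _ ≤ A * ρ * A ^ 2 := by gcongr
      _ = ρ * A ^ 3 := by ring
      _ ≤ ρ * ε := by gcongr

theorem mainTheorem1 (δ : ℝ) (hδ₀ : 0 < δ) (hδ₁ : δ < 1) :
    ∃ C : ℝ, 0 < C ∧ ∃ k : ℕ,
      ∀ (lip : Bool) (d : ℕ) (L ρ fmax σ ℓ μ ε α Q : ℝ),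
        1 ≤ d → 0 < L → 0 < ρ → 0 ≤ fmax → 0 ≤ σ → 0 ≤ ℓ → 0 < μ → μ ≤ 1 → 0 < ε →
        α = alphaParam lip d →
        Q = hiddenFactor C k lip d L ρ fmax σ ℓ μ ε →
        ∃ (η r : ℝ) (T₀ : ℕ),
          stepScale α μ ε / Q ≤ η ∧ η ≤ stepScale α μ ε ∧
          ε / √η / Q ≤ r ∧ r ≤ Q * (ε / √η) ∧
          (T₀ : ℝ) ≤ Q * (1 / (ε ^ 2 * η)) ∧
          (T₀ : ℝ) ≤ Q * iterationScale α μ ε ∧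
          ∀ (Ω Θ Θ' : Type*) [MeasurableSpace Ω] [MeasurableSpace Θ] [MeasurableSpace Θ']
            (P : Measure Ω) (D : Measure Θ) (D' : Measure Θ')
            [IsProbabilityMeasure P] [IsProbabilityMeasure D] [IsProbabilityMeasure D']
            (f : EuclideanSpace ℝ (Fin d) → ℝ)
            (G : EuclideanSpace ℝ (Fin d) → Θ → EuclideanSpace ℝ (Fin d))
            (Cmp : EuclideanSpace ℝ (Fin d) → Θ' → EuclideanSpace ℝ (Fin d))
            (x₀ : EuclideanSpace ℝ (Fin d))
            (ξ : ℕ → Ω → EuclideanSpace ℝ (Fin d)) (θ : ℕ → Ω → Θ) (θ' : ℕ → Ω → Θ'),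
            IsRegularObjective f fmax L ρ →
            IsStochasticGradient f G D σ →
            (lip = true → IsLipschitzStochasticGradient G ℓ) →
            IsCompressor Cmp D' μ →
            IsLinearCompressor Cmp →
            AreSamples P r D D' ξ θ θ' →
            ∀ T : ℕ, T₀ ≤ T →
              (T : ℝ) / 2 ≤
                ∫ ω, (sospCount f ρ ε T (visitedPoint η G Cmp x₀ ξ θ θ' ω) : ℝ) ∂P ∧
              1 - δ ≤
                P.real {ω | (T : ℝ) / 2 ≤
                  (sospCount f ρ ε T (visitedPoint η G Cmp x₀ ξ θ θ' ω) : ℝ)} := by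
  obtain ⟨K, hK, hKδ, hKexp⟩ := exists_forall_pow_le_exp δ
  have hK0 : 0 < K := by linarith
  -- With these constants Q is exactly the thirtieth power of Y = K A log M; thirty powers cover the
  -- losses Y^16 in η, Y^6 in r and Y^28, with a factor 2, in T₀.
  refine ⟨K ^ 30, by positivity, 30, ?_⟩
  intro lip d L ρ fmax σ ℓ μ ε α Q hd hL hρ hfmax hσ hℓ hμ hμ1 hε hα hQ
  have hd' : (1 : ℝ) ≤ d := by exact_mod_cast hd
  have hα1 : 1 ≤ α := by
    rw [hα, alphaParam]
    split_ifs
    · exact le_rfl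
    · exact hd'
  have hαd : α ≤ d := by
    rw [hα, alphaParam]
    split_ifs
    · exact hd'
    · exact le_rfl
  set ℓ' : ℝ := if lip then ℓ else 0 with hℓ'
  have hℓ0 : 0 ≤ ℓ' := by
    rw [hℓ']
    split_ifs
    · exact hℓ
    · exact le_rfl
  set A := 1 + L + ρ + 1 / ρ + fmax + σ + ℓ' with hA
  set M := 2 + d + 1 / ε + 1 / μ with hM
  have hε' : 0 < 1 / ε := by positivity
  have hμ' : 0 < 1 / μ := by positivity
  have hρ' : 0 < 1 / ρ := by positivity
  have hA1 : 1 ≤ A := by linarith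
  have hM3 : 3 ≤ M := by linarith
  have hM0 : 0 < M := by linarith
  have hlog : 1 ≤ Real.log M := by
    rw [Real.le_log_iff_exp_le hM0]
    linarith [Real.exp_one_lt_d9]
  obtain ⟨Y, hYdef⟩ : ∃ Y, Y = K * A * Real.log M := ⟨_, rfl⟩
  have hQY : Q = Y ^ 30 := by
    rw [hQ, hiddenFactor, hYdef, mul_pow, mul_pow]
  have hKA : K * A ≤ Y := by
    rw [hYdef]
    exact le_mul_of_one_le_right (by positivity) hlog
  have hKY : K ≤ Y := (le_mul_of_one_le_right hK0.le hA1).trans hKA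
  have hAY : A ≤ Y := (le_mul_of_one_le_left (by linarith) (by linarith)).trans hKA
  -- Equivalent to M^5 ≤ exp(Y/10): the logarithm in Q is what makes the exponential growth beat all
  -- powers of d, 1/ε and 1/μ.
  have hlogY : 50 * Real.log M ≤ Y := by
    rw [hYdef]
    refine mul_le_mul_of_nonneg_right ?_ (by linarith)
    exact (by linarith : 50 ≤ K).trans (le_mul_of_one_le_right hK0.le hA1)
  have hY : 100000 ≤ Y := hK.trans hKY
  have hY0 : 0 < Y := by linarith
  have hs := stepScale_pos (μ := μ) (by linarith : 0 < α) hε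
  have hρA : 1 ≤ A * ρ := by
    have : 1 / ρ ≤ A := by linarith
    rwa [div_le_iff₀ hρ] at this
  -- The argument needs ε to be at most polynomial in the other parameters; above the threshold
  -- every point is an SOSP, and T₀ = 0 works with any step size in the allowed range.
  rcases le_or_gt ε (A ^ 3) with hεA | hεA
  · have hδY : 1 ≤ δ * Y := by
      have := hKδ.trans hKY
      rw [div_le_iff₀ hδ₀] at this
      linarith
    obtain ⟨η, r, I, hη, hr, hadm⟩ := exists_isAdmissible (d := d) (Y := Y) (L := L) (ρ := ρ)
      (fmax := fmax) (σ := σ) (δ := δ) (μ := μ) (ε := ε) (α := α) (a := ℓ' ^ 2)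
      (b := if lip then 0 else 4 * σ ^ 2) (M := M) hd hY hL (by linarith) hρ (by linarith)
      (hρA.trans (by gcongr)) (by linarith) hσ (by linarith) hδY hμ hμ1 hε
      (hεA.trans (by gcongr)) hα1 (sq_nonneg _)
      (pow_le_pow_left₀ hℓ0 (by linarith) 2)
      (by
        rw [hα, alphaParam]
        cases lip <;> simp [sq_nonneg])
      (by linarith) (by linarith) (by linarith) (by linarith) (by linarith)
      (by
        rw [← Real.log_le_iff_le_exp (by positivity), Real.log_pow]
        push_cast
        linarith)
      (hKexp Y hKY)
    obtain ⟨T₀, hT₀, hT₁, hT₂⟩ := exists_iteration_bound hY hα1 hε hadm.ε_le hμ hμ1 hη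
    have hη0 := hadm.η_pos
    have hrat : 0 < ε / √η := by positivity
    refine ⟨η, r, T₀, ?_, ?_, ?_, ?_, hQY ▸ hT₁, hQY ▸ hT₂, ?_⟩
    · rw [hη, hQY]
      gcongr
      · linarith
      · norm_num
    · rw [hη]
      exact div_le_self hs.le (one_le_pow₀ (by linarith))
    · rw [hr, hQY]
      gcongr
      · linarith
      · norm_num
    · rw [hr, hQY]
      refine (div_le_self hrat.le (one_le_pow₀ (by linarith))).trans ?_
      exact le_mul_of_one_le_left hrat.le (one_le_pow₀ (by linarith))
    intro Ω Θ Θ' _ _ _ P D D' _ _ _ f G Cmp x₀ ξ θ θ' hf hG hl hC hlin hsamples T hT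
    refine sospCount_of_sum_sgdLaw_le hf hL.le hρ.le hG hC hsamples hδ₀ hδ₁
      (hadm.sum_measureReal_not_isSOSP_le hf hG hC hlin (hG.integral_gap_le_ite lip hl)
        (hT₀.trans ?_) x₀)
    have : (T₀ : ℝ) ≤ T := by exact_mod_cast hT
    gcongr
  · have hQ1 : 1 ≤ Q := hQY ▸ one_le_pow₀ (by linarith)
    have hrat : 0 ≤ ε / √(stepScale α μ ε) := by positivity
    have hit : 0 ≤ iterationScale α μ ε :=
      (by positivity : 0 ≤ (stepScale α μ ε)⁻¹ / ε ^ 2).trans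
        (inv_stepScale_div_le (by linarith) hε hμ hμ1)
    refine ⟨stepScale α μ ε, ε / √(stepScale α μ ε), 0, div_le_self hs.le hQ1, le_rfl,
      div_le_self hrat hQ1, le_mul_of_one_le_left hrat hQ1, ?_, ?_, ?_⟩
    · rw [Nat.cast_zero]
      positivity
    · rw [Nat.cast_zero]
      exact mul_nonneg (by linarith) hit
    intro Ω Θ Θ' _ _ _ P D D' _ _ _ f G Cmp x₀ ξ θ θ' hf hG hl hC hlin hsamples T _
    obtain ⟨hLf, hLρ⟩ := le_sq_and_sq_le_of_pow_le hL.le hρ hfmax hA1 (by linarith) hρA hεA.le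
    refine sospCount_of_sum_sgdLaw_le hf hL.le hρ.le hG hC hsamples hδ₀ hδ₁ ?_
    have h0 : {s : Vec d × Vec d | ¬ IsSOSP f ρ ε s.1} = ∅ :=
      Set.eq_empty_of_forall_notMem fun s hs =>
        hs (isSOSP_of_large hf hL hε.le hLf hLρ s.1)
    simp only [h0, measureReal_empty, Finset.sum_const_zero]
    exact mul_nonneg (by linarith) (Nat.cast_nonneg T)
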